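/- Fix a countably saturated nonstandard universe (Transfer holds, and every countable family of internal sets with the finite intersection property has a common element), and let ${}^*\mathbb N$ be its set of hypernatural numbers. *Borel* subsets of ${}^*\mathbb N$ (of ${}^*\mathbb N\times{}^*\mathbb N$) are the members of the least $\sigma$-algebra containing all internal subsets; a map is Borel if its graph is. For $X,Y\subseteq{}^*\mathbb N$ write $X\le_B Y$ if there is a Borel injection $X\to Y$, $X\equiv_B Y$ if $X\le_B Y\le_B X$, and $X<_B Y$ if $X\le_B Y\not\le_B X$. A *cut* is an initial segment of ${}^*\mathbb N$ (including $\varnothing$ and ${}^*\mathbb N$); it is *additive* if it is closed under $+$. A Borel cut $U$ is *minimal* if $V\not\equiv_B U$ for every cut $V\subsetneq U$. For $c\in{}^*\mathbb N\setminus\mathbb N$ and a standard real $r>0$ let $\widetilde U_{cr}$ be the set of all $x$ for which there is $y$ with $x<y\le\lfloor cr\rfloor$ and $x/y\not\simeq 1$. For $c\in{}^*\mathbb N$ put $c/\mathbb N=\{x:\ nx\le c\text{ for all }n\in\mathbb N\}$ and $c\mathbb N=\{x:\ x\le nc\text{ for some }n\in\mathbb N\}$. Then: 1. For every Borel set $X\subseteq{}^*\mathbb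 N$ there is a minimal Borel cut $U$ with $X\equiv_B U$; moreover there is a Borel bijection of $X$ onto $U$, $U$ is contained in every Borel cut $V$ with $X\equiv_B V$, and $U$ is the only minimal Borel cut with $X\equiv_B U$. 2. For any two Borel sets $X,Y\subseteq{}^*\mathbb N$, $X\le_B Y$ or $Y\le_B X$. 3. (Classification of Borel cardinalities.) A set $U\subseteq{}^*\mathbb N$ is a minimal Borel cut if and only if it is an additive Borel cut, or $U=[0,n)$ for some $n\in\mathbb N$, or $U=\widetilde U_{cr}$ for some $c\in{}^*\mathbb N\setminus\mathbb N$ and some real $r>0$. If a minimal Borel cut $U$ is not additive, there is $c\in U$ with $2c\notin U$ and $c/\mathbb N<_B U<_B c\mathbb N$. For each $c\in{}^*\mathbb N\setminus\mathbb N$, the minimal Borel cuts $U$ with $c/\mathbb N<_B U<_B c\mathbb N$ are exactly the sets $\widetilde U_{cr}$ with $r>0$ real, and $\widetilde U_{cr}\ne\widetilde U_{cr'}$ whenever $r\ne r'$. -/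

import Mathlib

universe u

/-- The finite types over the natural numbers: `ℕ`, products, and power sets. -/
inductive FinType : Type
  | nat : FinType
  | prod : FinType → FinType → FinType
  | pow : FinType → FinType
  deriving DecidableEq

namespace FinType

/-- The standard objects of a given finite type. -/
def Carrier : FinType → Type
  | nat => ℕ
  | prod σ τ => Carrier σ × Carrier τ
  | pow σ => Set (Carrier σ)

def default : (σ : FinType) → Carrier σ
  | nat => (0 : ℕ)
  | prod σ τ => (default σ, default τ)
  | pow σ => (∅ : Set (Carrier σ))

end FinType

open FinType in
/-- A structure for the typed language of sets: objects of every finite type over `ℕ`,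
a membership relation, and ordered pairs. -/
structure TypedStructure where
  Obj : FinType → Type u
  Mem : ∀ {σ : FinType}, Obj σ → Obj (pow σ) → Prop
  pair : ∀ {σ τ : FinType}, Obj σ → Obj τ → Obj (prod σ τ)

/-- The standard universe: all sets of finite type over `ℕ`. -/
def standardUniverse : TypedStructure.{0} where
  Obj := FinType.Carrier
  Mem := fun {σ} (x : σ.Carrier) (A : Set σ.Carrier) => x ∈ A
  pair := fun {σ τ} (x : σ.Carrier) (y : τ.Carrier) => ((x, y) : σ.Carrier × τ.Carrier)

/-- Terms of the typed language: variables of each type, and pairs. -/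
inductive TypedTerm : FinType → Type
  | var (σ : FinType) (i : ℕ) : TypedTerm σ
  | pair {σ τ : FinType} : TypedTerm σ → TypedTerm τ → TypedTerm (FinType.prod σ τ)

/-- First-order formulas of the typed language; every quantifier ranges over the objects of one
type (so these are formulas with bounded quantifiers over the whole universe). -/
inductive TypedFormula : Type
  | eq {σ : FinType} : TypedTerm σ → TypedTerm σ → TypedFormula
  | mem {σ : FinType} : TypedTerm σ → TypedTerm (FinType.pow σ) → TypedFormula
  | neg : TypedFormula → TypedFormula
  | and : TypedFormula → TypedFormula → TypedFormula
  | ex (σ : FinType) (i : ℕ) : TypedFormula → TypedFormula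

namespace TypedStructure

/-- Assignments of objects to the variables (`i`-th variable of type `σ`). -/
abbrev Assignment (M : TypedStructure.{u}) : Type u := (σ : FinType) → ℕ → M.Obj σ

/-- Change the value of the `i`-th variable of type `σ` to `a`. -/
def update (M : TypedStructure.{u}) (v : M.Assignment) (σ : FinType) (i : ℕ) (a : M.Obj σ) :
    M.Assignment :=
  fun τ j => if h : σ = τ ∧ i = j then h.1 ▸ a else v τ j

theorem update_self (M : TypedStructure.{u}) (v : M.Assignment) (σ : FinType) (i : ℕ)
    (a : M.Obj σ) : M.update v σ i a σ i = a := by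
  simp [update]

theorem update_of_ne (M : TypedStructure.{u}) (v : M.Assignment) (σ τ : FinType) {i j : ℕ}
    (hij : i ≠ j) (a : M.Obj σ) : M.update v σ i a τ j = v τ j := by
  simp [update, hij]

/-- The value of a term. -/
def eval (M : TypedStructure.{u}) (v : M.Assignment) : {σ : FinType} → TypedTerm σ → M.Obj σ
  | _, .var σ i => v σ i
  | _, .pair s t => M.pair (M.eval v s) (M.eval v t)

/-- Tarski's satisfaction relation. -/
def Sat (M : TypedStructure.{u}) : TypedFormula → M.Assignment → Prop
  | .eq s t, v => M.eval v s = M.eval v t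
  | .mem s t, v => M.Mem (M.eval v s) (M.eval v t)
  | .neg φ, v => ¬ M.Sat φ v
  | .and φ ψ, v => M.Sat φ v ∧ M.Sat ψ v
  | .ex σ i φ, v => ∃ a : M.Obj σ, M.Sat φ (M.update v σ i a)

/-- The formula "for every `x` there is `y` with `(x, y) ∈ G`". -/
theorem sat_total (M : TypedStructure.{u}) (σ τ : FinType) (v : M.Assignment) :
    M.Sat (.neg (.ex σ 1 (.neg (.ex τ 2 (.mem (.pair (.var σ 1) (.var τ 2))
      (.var (FinType.pow (FinType.prod σ τ)) 0)))))) v ↔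
      ∀ x : M.Obj σ, ∃ y : M.Obj τ, M.Mem (M.pair x y) (v (FinType.pow (FinType.prod σ τ)) 0) := by
  have h10 : (1 : ℕ) ≠ 0 := by decide
  have h20 : (2 : ℕ) ≠ 0 := by decide
  have h21 : (2 : ℕ) ≠ 1 := by decide
  simp only [Sat, eval, update_self, update_of_ne _ _ _ _ h10, update_of_ne _ _ _ _ h20,
    update_of_ne _ _ _ _ h21]
  push Not
  rfl

end TypedStructure

/-- A countably saturated nonstandard universe over `ℕ`: internal objects of every finite type,
with a map `star` from the standard objects for which Transfer holds, and such that every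
countable family of internal sets with the finite intersection property has a common element. -/
structure NonstandardUniverse extends TypedStructure.{u} where
  star : ∀ {σ : FinType}, σ.Carrier → Obj σ
  transfer : ∀ (φ : TypedFormula) (v : standardUniverse.Assignment),
    standardUniverse.Sat φ v ↔ toTypedStructure.Sat φ (fun σ i => star (v σ i))
  saturation : ∀ {σ : FinType} (A : ℕ → Obj (FinType.pow σ)),
    (∀ n : ℕ, ∃ x : Obj σ, ∀ k ≤ n, Mem x (A k)) → ∃ x : Obj σ, ∀ k : ℕ, Mem x (A k)

namespace NonstandardUniverse

open FinType

noncomputable section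

variable (N : NonstandardUniverse.{u})

/-- The hypernatural numbers. -/
abbrev HNat : Type u := N.Obj nat

/-- The star of a natural number. -/
def ofNat (n : ℕ) : N.HNat := N.star (σ := nat) n

/-- The star of a standard set. -/
def starSet {σ : FinType} (A : Set σ.Carrier) : N.Obj (pow σ) := N.star (σ := pow σ) A

/-- The graph of a standard function. -/
def stdGraph {σ τ : FinType} (g : σ.Carrier → τ.Carrier) : Set (prod σ τ).Carrier :=
  {p : σ.Carrier × τ.Carrier | p.2 = g p.1}

theorem exists_starFun {σ τ : FinType} (g : σ.Carrier → τ.Carrier) (x : N.Obj σ) :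
    ∃ y : N.Obj τ, N.Mem (N.pair x y) (N.starSet (stdGraph g)) := by
  obtain ⟨v, hv⟩ : ∃ v : standardUniverse.Assignment, v (pow (prod σ τ)) 0 = stdGraph g :=
    ⟨_, TypedStructure.update_self standardUniverse (fun σ _ => FinType.default σ) _ 0 _⟩
  have h := (N.transfer _ v).1 ((TypedStructure.sat_total standardUniverse σ τ v).2
    (fun a => ⟨g a, by rw [hv]; rfl⟩))
  rw [TypedStructure.sat_total, hv] at h
  exact h x

/-- The star-extension of a standard function (its graph is the star of the standard graph). -/
def starFun {σ τ : FinType} (g : σ.Carrier → τ.Carrier) (x : N.Obj σ) : N.Obj τ :=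
  Classical.choose (N.exists_starFun g x)

def add (x y : N.HNat) : N.HNat :=
  N.starFun (σ := prod nat nat) (τ := nat) (fun p : ℕ × ℕ => (p.1 + p.2 : ℕ)) (N.pair x y)

def mul (x y : N.HNat) : N.HNat :=
  N.starFun (σ := prod nat nat) (τ := nat) (fun p : ℕ × ℕ => (p.1 * p.2 : ℕ)) (N.pair x y)

def le (x y : N.HNat) : Prop :=
  N.Mem (N.pair x y) (N.starSet (σ := prod nat nat) {p : ℕ × ℕ | p.1 ≤ p.2})

def lt (x y : N.HNat) : Prop :=
  N.Mem (N.pair x y) (N.starSet (σ := prod nat nat) {p : ℕ × ℕ | p.1 < p.2})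

/-- `c ∈ *ℕ ∖ ℕ`. -/
def IsNonstandard (c : N.HNat) : Prop := ∀ n : ℕ, c ≠ N.ofNat n

/-- The set of elements of an internal set. -/
def elems {σ : FinType} (a : N.Obj (pow σ)) : Set (N.Obj σ) := {x | N.Mem x a}

/-- Borel sets of type `σ`: the least σ-algebra containing all internal sets. -/
def IsBorel {σ : FinType} (X : Set (N.Obj σ)) : Prop :=
  @MeasurableSet _ (MeasurableSpace.generateFrom (Set.range (N.elems (σ := σ)))) X

/-- The graph of `f` restricted to `X`. -/
def graphOn (f : N.HNat → N.HNat) (X : Set N.HNat) : Set (N.Obj (prod nat nat)) :=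
  {p | ∃ x ∈ X, p = N.pair x (f x)}

/-- `X ≤_B Y`: there is a Borel injection `X → Y`. -/
def BorelLE (X Y : Set N.HNat) : Prop :=
  ∃ f : N.HNat → N.HNat, Set.MapsTo f X Y ∧ Set.InjOn f X ∧ N.IsBorel (N.graphOn f X)

/-- `X ≡_B Y`. -/
def BorelEquiv (X Y : Set N.HNat) : Prop := N.BorelLE X Y ∧ N.BorelLE Y X

/-- `X <_B Y`. -/
def BorelLT (X Y : Set N.HNat) : Prop := N.BorelLE X Y ∧ ¬ N.BorelLE Y X

/-- There is a Borel bijection of `X` onto `Y`. -/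
def BorelBijective (X Y : Set N.HNat) : Prop :=
  ∃ f : N.HNat → N.HNat, Set.BijOn f X Y ∧ N.IsBorel (N.graphOn f X)

/-- Cuts are the initial segments of `*ℕ`. -/
def IsCut (U : Set N.HNat) : Prop := ∀ x ∈ U, ∀ y, N.le y x → y ∈ U

def IsBorelCut (U : Set N.HNat) : Prop := N.IsCut U ∧ N.IsBorel U

/-- A Borel cut `U` is minimal if no cut `V ⊊ U` satisfies `V ≡_B U`. -/
def IsMinimalBorelCut (U : Set N.HNat) : Prop :=
  N.IsBorelCut U ∧ ∀ V, N.IsCut V → V ⊂ U → ¬ N.BorelEquiv V U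

def IsAdditive (U : Set N.HNat) : Prop := ∀ x ∈ U, ∀ y ∈ U, N.add x y ∈ U

/-- The cut `[0, c)`. -/
def below (c : N.HNat) : Set N.HNat := {x | N.lt x c}

/-- The cut `c/ℕ`, i.e. the intersection of the segments `[0, c/n]`. -/
def divNat (c : N.HNat) : Set N.HNat := {x | ∀ n : ℕ, N.le (N.mul (N.ofNat n) x) c}

/-- The cut `cℕ`, i.e. the union of the segments `[0, cn]`. -/
def mulNat (c : N.HNat) : Set N.HNat := {x | ∃ n : ℕ, N.le x (N.mul (N.ofNat n) c)}

/-- For `y > 0`: the quotient `x / y` is infinitely close to `1`, i.e. `n * |x - y| ≤ y` for all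
standard `n`. -/
def QuotNearOne (x y : N.HNat) : Prop :=
  ∀ n : ℕ, N.le (N.mul (N.ofNat n) x) (N.add (N.mul (N.ofNat n) y) y) ∧
    N.le (N.mul (N.ofNat n) y) (N.add (N.mul (N.ofNat n) x) y)

/-- The set of all `x ∈ U` for which some `y ∈ U`, `y > x`, has `x / y` not infinitely close
to `1`. -/
def reduced (U : Set N.HNat) : Set N.HNat :=
  {x | x ∈ U ∧ ∃ y ∈ U, N.lt x y ∧ ¬ N.QuotNearOne x y}

/-- The internal integer part of `c * r`, for a standard real `r ≥ 0`. -/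
def floorMul (c : N.HNat) (r : ℝ) : N.HNat :=
  N.starFun (σ := nat) (τ := nat) (fun n : ℕ => (⌊(n : ℝ) * r⌋₊ : ℕ)) c

/-- The reduction of the segment `[0, ⌊c r⌋]`. -/
def realCut (c : N.HNat) (r : ℝ) : Set N.HNat :=
  N.reduced {x | N.le x (N.floorMul c r)}

end

end NonstandardUniverse

/-! ### Transfer of elementary facts -/

namespace TypedFormula

/-! Internal objects are handled as in an ultrapower. Finitely many of them are always values of
standard functions at one common object `t`, and a standard relation holds between such values iff
it holds at almost all indices for the ultrafilter `ult t`. Arithmetic, internal bijections and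
internal cardinalities are therefore checked index by index.

The size of a Borel set `X` is measured by `innerCut X`, the cut generated by the cardinalities of
its internal subsets. Inside a hyperfinite set of size `h`, a Borel set lies between two internal
sets that differ by at most `h / n` elements, for every positive standard `n`, as in Loeb measure
theory (`IsBorel.exists_approx`). Moreover, a Borel set is determined by countably many internal
sets, so it either has a countable cover by small internal sets or contains a countable intersection
of large ones. Together these show that if no internal subset of `X` has more than `d` elements,
then `X` has an internal cover with at most `(1 + 1/n) d` elements (`IsBorel.exists_cover`). Inner
and outer size thus agree up to a factor infinitely close to `1`.

Non-embeddability: the graph of a Borel injection into `[0, d)` is a Borel set whose internal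
subsets are internal injections, so have at most `d` elements. Covering the graph and projecting
covers the domain by about `d` elements. Hence `[0, w)` has no Borel injection into `[0, u)` if `(k
+ 1) u < k w` for a standard `k > 0`. This makes every listed cut minimal, and minimality together
with the nesting of cuts gives uniqueness and all strict inequalities.

Embeddability: if `X` is infinite and `innerCut X` is additive, the factor `1 + 1/n` is absorbed and
`X` is equivalent to that cut. Otherwise some `c` lies in the cut while `2c` does not. With `r` the
supremum of the standard parts of `x / c` over the cut, `X` receives an injection from `stLT c r`
and has one into `stLE c r`, and these two sets are equivalent by moving countably many monads as in
Hilbert's hotel.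

All injections constructed are countable unions of Borel restrictions of internal injections. Unlike
arbitrary Borel injections, these visibly send Borel sets to Borel sets, so that composition and the
Schröder–Bernstein argument stay within Borel graphs. -/

def all (σ : FinType) (i : ℕ) (φ : TypedFormula) : TypedFormula := .neg (.ex σ i (.neg φ))

def imp (φ ψ : TypedFormula) : TypedFormula := .neg (.and φ (.neg ψ))

end TypedFormula

namespace TypedStructure

theorem sat_all (M : TypedStructure.{u}) (σ : FinType) (i : ℕ) (φ : TypedFormula)
    (v : M.Assignment) : M.Sat (.all σ i φ) v ↔ ∀ a : M.Obj σ, M.Sat φ (M.update v σ i a) := by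
  simp [TypedFormula.all, Sat]

theorem sat_imp (M : TypedStructure.{u}) (φ ψ : TypedFormula) (v : M.Assignment) :
    M.Sat (.imp φ ψ) v ↔ (M.Sat φ v → M.Sat ψ v) := by
  simp [TypedFormula.imp, Sat]

theorem sat_mem (M : TypedStructure.{u}) {σ : FinType} (s : TypedTerm σ)
    (t : TypedTerm (FinType.pow σ)) (v : M.Assignment) :
    M.Sat (.mem s t) v ↔ M.Mem (M.eval v s) (M.eval v t) := Iff.rfl

theorem sat_eq (M : TypedStructure.{u}) {σ : FinType} (s t : TypedTerm σ) (v : M.Assignment) :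
    M.Sat (.eq s t) v ↔ M.eval v s = M.eval v t := Iff.rfl

theorem sat_neg (M : TypedStructure.{u}) (φ : TypedFormula) (v : M.Assignment) :
    M.Sat (.neg φ) v ↔ ¬ M.Sat φ v := Iff.rfl

theorem eval_var (M : TypedStructure.{u}) (v : M.Assignment) (σ : FinType) (i : ℕ) :
    M.eval v (.var σ i) = v σ i := rfl

theorem eval_pair (M : TypedStructure.{u}) (v : M.Assignment) {σ τ : FinType}
    (s : TypedTerm σ) (t : TypedTerm τ) :
    M.eval v (.pair s t) = M.pair (M.eval v s) (M.eval v t) := rfl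

end TypedStructure

namespace NonstandardUniverse

open FinType TypedStructure

variable (N : NonstandardUniverse.{u}) {σ τ ρ : FinType}

/-- Supplies the parameters for all transferred formulas: they occupy the variables `0`, `1`, `2`,
while quantified variables are numbered from `10`, so the indices never clash even when types
coincide. -/
theorem exists_assignment {σ₀ σ₁ σ₂ : FinType} (a : σ₀.Carrier) (b : σ₁.Carrier)
    (c : σ₂.Carrier) : ∃ v : standardUniverse.Assignment, v σ₀ 0 = a ∧ v σ₁ 1 = b ∧ v σ₂ 2 = c :=
  ⟨standardUniverse.update (standardUniverse.update (standardUniverse.update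
    (fun σ _ => FinType.default σ) σ₀ 0 a) σ₁ 1 b) σ₂ 2 c,
    (update_of_ne standardUniverse _ _ _ (by decide) _).trans
      ((update_of_ne standardUniverse _ _ _ (by decide) _).trans
        (update_self standardUniverse _ _ _ _)),
    (update_of_ne standardUniverse _ _ _ (by decide) _).trans (update_self standardUniverse _ _ _ _),
    update_self standardUniverse _ _ _ _⟩

theorem starSet_and {A B C : Set σ.Carrier} (h : ∀ x, x ∈ A → x ∈ B → x ∈ C) (x : N.Obj σ)
    (hA : N.Mem x (N.starSet A)) (hB : N.Mem x (N.starSet B)) : N.Mem x (N.starSet C) := by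
  obtain ⟨v, h0, h1, h2⟩ := exists_assignment (σ₀ := pow σ) (σ₁ := pow σ) (σ₂ := pow σ) A B C
  have := N.transfer (.all σ 10 (.imp (.mem (.var σ 10) (.var (pow σ) 0))
    (.imp (.mem (.var σ 10) (.var (pow σ) 1)) (.mem (.var σ 10) (.var (pow σ) 2))))) v
  simp [sat_all, sat_imp, sat_mem, eval_var, update_self, update_of_ne, h0, h1, h2] at this
  exact this.1 h x hA hB

theorem starSet_compl_iff (A : Set σ.Carrier) (x : N.Obj σ) :
    N.Mem x (N.starSet Aᶜ) ↔ ¬ N.Mem x (N.starSet A) := by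
  obtain ⟨v, h0, h1, -⟩ := exists_assignment (σ₀ := pow σ) (σ₁ := pow σ) (σ₂ := pow σ) A
    (Aᶜ : Set σ.Carrier) A
  have h := N.transfer (.all σ 10 (.imp (.mem (.var σ 10) (.var (pow σ) 0))
    (.neg (.mem (.var σ 10) (.var (pow σ) 1))))) v
  have h' := N.transfer (.all σ 10 (.imp (.neg (.mem (.var σ 10) (.var (pow σ) 0)))
    (.mem (.var σ 10) (.var (pow σ) 1)))) v
  simp only [sat_all, sat_imp, sat_mem, sat_neg, eval_var, update_self, update_of_ne, h0, h1, ne_eq,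
    OfNat.ofNat_ne_zero, OfNat.ofNat_ne_one, not_false_eq_true] at h h'
  exact ⟨fun hx hA => h.1 (fun y hy hc => hc hy) x hA hx, fun hx => h'.1 (fun y hy => hy) x hx⟩

theorem starSet_graph_unique (f : σ.Carrier → τ.Carrier) (x : N.Obj σ) (y z : N.Obj τ)
    (hy : N.Mem (N.pair x y) (N.starSet (stdGraph f)))
    (hz : N.Mem (N.pair x z) (N.starSet (stdGraph f))) : y = z := by
  obtain ⟨v, h0, -, -⟩ := exists_assignment (σ₀ := pow (prod σ τ)) (σ₁ := nat) (σ₂ := nat)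
    (stdGraph f) (0 : ℕ) (0 : ℕ)
  have := N.transfer (.all σ 10 (.all τ 11 (.all τ 12 (.imp
    (.mem (.pair (.var σ 10) (.var τ 11)) (.var (pow (prod σ τ)) 0)) (.imp
    (.mem (.pair (.var σ 10) (.var τ 12)) (.var (pow (prod σ τ)) 0))
    (.eq (.var τ 11) (.var τ 12))))))) v
  simp [sat_all, sat_imp, sat_mem, sat_eq, eval_var, eval_pair, update_self, update_of_ne, h0]
    at this
  exact this.1 (fun a b c (hb : b = f a) (hc : c = f a) => hb.trans hc.symm) x y z hy hz

theorem starSet_map {Γ : Set (prod σ τ).Carrier} {A : Set σ.Carrier} {B : Set τ.Carrier}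
    (h : ∀ (x : σ.Carrier) (y : τ.Carrier), (x, y) ∈ Γ → x ∈ A → y ∈ B) (x : N.Obj σ) (y : N.Obj τ)
    (hΓ : N.Mem (N.pair x y) (N.starSet Γ)) (hA : N.Mem x (N.starSet A)) :
    N.Mem y (N.starSet B) := by
  obtain ⟨v, h0, h1, h2⟩ := exists_assignment (σ₀ := pow (prod σ τ)) (σ₁ := pow σ)
    (σ₂ := pow τ) Γ A B
  have := N.transfer (.all σ 10 (.all τ 11 (.imp
    (.mem (.pair (.var σ 10) (.var τ 11)) (.var (pow (prod σ τ)) 0)) (.imp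
    (.mem (.var σ 10) (.var (pow σ) 1)) (.mem (.var τ 11) (.var (pow τ) 2)))))) v
  simp [sat_all, sat_imp, sat_mem, eval_var, eval_pair, update_self, update_of_ne, h0,
    h1, h2] at this
  exact this.1 h x y hΓ hA

theorem starSet_graph_pair (f : σ.Carrier → τ.Carrier) (g : σ.Carrier → ρ.Carrier) (x : N.Obj σ)
    (y : N.Obj τ) (z : N.Obj ρ) (hy : N.Mem (N.pair x y) (N.starSet (stdGraph f)))
    (hz : N.Mem (N.pair x z) (N.starSet (stdGraph g))) :
    N.Mem (N.pair x (N.pair y z))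
      (N.starSet (stdGraph (σ := σ) (τ := prod τ ρ) fun i => (f i, g i))) := by
  obtain ⟨v, h0, h1, h2⟩ := exists_assignment (σ₀ := pow (prod σ τ)) (σ₁ := pow (prod σ ρ))
    (σ₂ := pow (prod σ (prod τ ρ))) (stdGraph f) (stdGraph g)
    (stdGraph (σ := σ) (τ := prod τ ρ) fun i => (f i, g i))
  have := N.transfer (.all σ 10 (.all τ 11 (.all ρ 12 (.imp
    (.mem (.pair (.var σ 10) (.var τ 11)) (.var (pow (prod σ τ)) 0)) (.imp
    (.mem (.pair (.var σ 10) (.var ρ 12)) (.var (pow (prod σ ρ)) 1))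
    (.mem (.pair (.var σ 10) (.pair (.var τ 11) (.var ρ 12)))
      (.var (pow (prod σ (prod τ ρ))) 2))))))) v
  simp [sat_all, sat_imp, sat_mem, eval_var, eval_pair, update_self, update_of_ne, h0,
    h1, h2] at this
  exact this.1 (fun a b c (hb : b = f a) (hc : c = g a) => Prod.ext hb hc) x y z hy hz

theorem starSet_graph_comp (f : σ.Carrier → τ.Carrier) (g : τ.Carrier → ρ.Carrier) (x : N.Obj σ)
    (y : N.Obj τ) (z : N.Obj ρ) (hy : N.Mem (N.pair x y) (N.starSet (stdGraph f)))
    (hz : N.Mem (N.pair y z) (N.starSet (stdGraph g))) :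
    N.Mem (N.pair x z) (N.starSet (stdGraph fun i => g (f i))) := by
  obtain ⟨v, h0, h1, h2⟩ := exists_assignment (σ₀ := pow (prod σ τ)) (σ₁ := pow (prod τ ρ))
    (σ₂ := pow (prod σ ρ)) (stdGraph f) (stdGraph g) (stdGraph fun i => g (f i))
  have := N.transfer (.all σ 10 (.all τ 11 (.all ρ 12 (.imp
    (.mem (.pair (.var σ 10) (.var τ 11)) (.var (pow (prod σ τ)) 0)) (.imp
    (.mem (.pair (.var τ 11) (.var ρ 12)) (.var (pow (prod τ ρ)) 1))
    (.mem (.pair (.var σ 10) (.var ρ 12)) (.var (pow (prod σ ρ)) 2))))))) v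
  simp [sat_all, sat_imp, sat_mem, eval_var, eval_pair, update_self, update_of_ne, h0,
    h1, h2] at this
  exact this.1 (fun a b c (hb : b = f a) (hc : c = g b) => by subst hb; exact hc) x y z hy hz

theorem starSet_graph_id (x : N.Obj σ) :
    N.Mem (N.pair x x) (N.starSet (stdGraph (σ := σ) (τ := σ) fun i => i)) := by
  obtain ⟨v, h0, -, -⟩ := exists_assignment (σ₀ := pow (prod σ σ)) (σ₁ := nat) (σ₂ := nat)
    (stdGraph (σ := σ) (τ := σ) fun i => i) (0 : ℕ) (0 : ℕ)
  have := N.transfer (.all σ 10 (.mem (.pair (.var σ 10) (.var σ 10)) (.var (pow (prod σ σ)) 0))) v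
  simp [sat_all, sat_mem, eval_var, eval_pair, update_self, update_of_ne, h0] at this
  exact this.1 (fun a => rfl) x

theorem starSet_graph_const (a : τ.Carrier) (x : N.Obj σ) :
    N.Mem (N.pair x (N.star a)) (N.starSet (stdGraph (σ := σ) fun _ => a)) := by
  obtain ⟨v, h0, h1, -⟩ := exists_assignment (σ₀ := pow (prod σ τ)) (σ₁ := τ) (σ₂ := nat)
    (stdGraph (σ := σ) fun _ => a) a (0 : ℕ)
  have := N.transfer (.all σ 10 (.mem (.pair (.var σ 10) (.var τ 1)) (.var (pow (prod σ τ)) 0))) v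
  simp [sat_all, sat_mem, eval_var, eval_pair, update_self, update_of_ne, h0, h1] at this
  exact this.1 (fun a => rfl) x

theorem starSet_graph_fst (x : N.Obj σ) (y : N.Obj τ) :
    N.Mem (N.pair (N.pair x y) x) (N.starSet (stdGraph (σ := prod σ τ) (τ := σ) Prod.fst)) := by
  obtain ⟨v, h0, -, -⟩ := exists_assignment (σ₀ := pow (prod (prod σ τ) σ)) (σ₁ := nat)
    (σ₂ := nat) (stdGraph (σ := prod σ τ) (τ := σ) Prod.fst) (0 : ℕ) (0 : ℕ)
  have := N.transfer (.all σ 10 (.all τ 11 (.mem (.pair (.pair (.var σ 10) (.var τ 11))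
    (.var σ 10)) (.var (pow (prod (prod σ τ) σ)) 0)))) v
  simp [sat_all, sat_mem, eval_var, eval_pair, update_self, update_of_ne, h0] at this
  exact this.1 (fun a b => rfl) x y

theorem starSet_graph_snd (x : N.Obj σ) (y : N.Obj τ) :
    N.Mem (N.pair (N.pair x y) y) (N.starSet (stdGraph (σ := prod σ τ) (τ := τ) Prod.snd)) := by
  obtain ⟨v, h0, -, -⟩ := exists_assignment (σ₀ := pow (prod (prod σ τ) τ)) (σ₁ := nat)
    (σ₂ := nat) (stdGraph (σ := prod σ τ) (τ := τ) Prod.snd) (0 : ℕ) (0 : ℕ)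
  have := N.transfer (.all σ 10 (.all τ 11 (.mem (.pair (.pair (.var σ 10) (.var τ 11))
    (.var τ 11)) (.var (pow (prod (prod σ τ) τ)) 0)))) v
  simp [sat_all, sat_mem, eval_var, eval_pair, update_self, update_of_ne, h0] at this
  exact this.1 (fun a b => rfl) x y

theorem starSet_diagonal (x y : N.Obj σ)
    (h : N.Mem (N.pair x y)
      (N.starSet (σ := prod σ σ) {p : σ.Carrier × σ.Carrier | p.1 = p.2})) : x = y := by
  obtain ⟨v, h0, -, -⟩ := exists_assignment (σ₀ := pow (prod σ σ)) (σ₁ := nat) (σ₂ := nat)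
    {p : σ.Carrier × σ.Carrier | p.1 = p.2} (0 : ℕ) (0 : ℕ)
  have := N.transfer (.all σ 10 (.all σ 11 (.imp
    (.mem (.pair (.var σ 10) (.var σ 11)) (.var (pow (prod σ σ)) 0))
    (.eq (.var σ 10) (.var σ 11))))) v
  simp [sat_all, sat_imp, sat_mem, sat_eq, eval_var, eval_pair, update_self, update_of_ne, h0]
    at this
  exact this.1 (fun a b h => h) x y h

/-- Turns membership in an arbitrary internal set into a standard relation between two objects, so
that the index-by-index criterion also covers internal sets as arguments. -/
theorem starSet_membership (x : N.Obj σ) (A : N.Obj (pow σ)) :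
    N.Mem (N.pair x A) (N.starSet (σ := prod σ (pow σ))
      {p : σ.Carrier × Set σ.Carrier | p.1 ∈ p.2}) ↔ N.Mem x A := by
  obtain ⟨v, h0, -, -⟩ := exists_assignment (σ₀ := pow (prod σ (pow σ))) (σ₁ := nat) (σ₂ := nat)
    {p : σ.Carrier × Set σ.Carrier | p.1 ∈ p.2} (0 : ℕ) (0 : ℕ)
  have h := N.transfer (.all σ 10 (.all (pow σ) 11 (.imp
    (.mem (.pair (.var σ 10) (.var (pow σ) 11)) (.var (pow (prod σ (pow σ))) 0))
    (.mem (.var σ 10) (.var (pow σ) 11))))) v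
  have h' := N.transfer (.all σ 10 (.all (pow σ) 11 (.imp
    (.mem (.var σ 10) (.var (pow σ) 11))
    (.mem (.pair (.var σ 10) (.var (pow σ) 11)) (.var (pow (prod σ (pow σ))) 0))))) v
  simp [sat_all, sat_imp, sat_mem, eval_var, eval_pair, update_self, update_of_ne, h0]
    at h h'
  exact ⟨h.1 (fun a b h => h) x A, h'.1 (fun a b h => h) x A⟩

/-! ### The ultrafilter of an internal object -/

/-- The standard sets whose star contains `a`. -/
def ult (a : N.Obj σ) : Ultrafilter σ.Carrier :=
  Ultrafilter.ofComplNotMemIff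
    { sets := {A | N.Mem a (N.starSet A)}
      univ_sets := by
        by_contra h
        have := (N.starSet_compl_iff Set.univ a).2 h
        exact h (N.starSet_and (fun _ _ _ => trivial) a this this)
      sets_of_superset := fun h h' => N.starSet_and (fun x hx _ => h' hx) a h h
      inter_sets := fun {A B} h h' => N.starSet_and (C := A ∩ B) (fun x hx hx' => ⟨hx, hx'⟩) a h h' }
    (fun A => by
      change ¬ N.Mem a (N.starSet Aᶜ) ↔ N.Mem a (N.starSet A)
      rw [starSet_compl_iff, not_not])

theorem mem_ult {a : N.Obj σ} {A : Set σ.Carrier} : A ∈ N.ult a ↔ N.Mem a (N.starSet A) := Iff.rfl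

theorem starFun_spec (f : σ.Carrier → τ.Carrier) (a : N.Obj σ) :
    N.Mem (N.pair a (N.starFun f a)) (N.starSet (stdGraph f)) :=
  Classical.choose_spec (N.exists_starFun f a)

theorem starFun_eq {f : σ.Carrier → τ.Carrier} {a : N.Obj σ} {b : N.Obj τ}
    (h : N.Mem (N.pair a b) (N.starSet (stdGraph f))) : N.starFun f a = b :=
  N.starSet_graph_unique f a _ _ (N.starFun_spec f a) h

/-- One inclusion between ultrafilters already gives equality, so only the transfer of `x ∈ f ⁻¹' B
→ f x ∈ B`, applied to complements, is needed. -/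
theorem ult_starFun (f : σ.Carrier → τ.Carrier) (a : N.Obj σ) :
    N.ult (N.starFun f a) = (N.ult a).map f := by
  refine (Ultrafilter.eq_of_le ?_).symm
  intro B hB
  change f ⁻¹' B ∈ N.ult a
  by_contra h
  rw [← Ultrafilter.compl_mem_iff_notMem, mem_ult] at h
  have := N.starSet_map (B := Bᶜ) (fun x y (hxy : y = f x) (hx : f x ∉ B) => by
    subst hxy; exact hx) a _ (N.starFun_spec f a) h
  exact (N.starSet_compl_iff _ _).1 this hB

theorem pair_starFun (f : σ.Carrier → τ.Carrier) (g : σ.Carrier → ρ.Carrier) (a : N.Obj σ) :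
    N.pair (N.starFun f a) (N.starFun g a) =
      N.starFun (σ := σ) (τ := prod τ ρ) (fun i => (f i, g i)) a :=
  (N.starFun_eq (N.starSet_graph_pair f g a _ _ (N.starFun_spec f a) (N.starFun_spec g a))).symm

theorem starFun_starFun (g : τ.Carrier → ρ.Carrier) (f : σ.Carrier → τ.Carrier) (a : N.Obj σ) :
    N.starFun g (N.starFun f a) = N.starFun (fun i => g (f i)) a :=
  (N.starFun_eq (N.starSet_graph_comp f g a _ _ (N.starFun_spec f a) (N.starFun_spec g _))).symm

theorem starFun_id (a : N.Obj σ) : N.starFun (σ := σ) (τ := σ) (fun i => i) a = a :=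
  N.starFun_eq (N.starSet_graph_id a)

theorem starFun_const (b : τ.Carrier) (a : N.Obj σ) :
    N.starFun (σ := σ) (τ := τ) (fun _ => b) a = N.star b :=
  N.starFun_eq (N.starSet_graph_const b a)

theorem starFun_fst (a : N.Obj σ) (b : N.Obj τ) :
    N.starFun (σ := prod σ τ) (τ := σ) Prod.fst (N.pair a b) = a :=
  N.starFun_eq (N.starSet_graph_fst a b)

theorem starFun_snd (a : N.Obj σ) (b : N.Obj τ) :
    N.starFun (σ := prod σ τ) (τ := τ) Prod.snd (N.pair a b) = b :=
  N.starFun_eq (N.starSet_graph_snd a b)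

theorem pair_inj {a a' : N.Obj σ} {b b' : N.Obj τ} :
    N.pair a b = N.pair a' b' ↔ a = a' ∧ b = b' := by
  refine ⟨fun h => ⟨?_, ?_⟩, fun ⟨h, h'⟩ => by rw [h, h']⟩
  · rw [← N.starFun_fst a b, h, N.starFun_fst]
  · rw [← N.starFun_snd a b, h, N.starFun_snd]

theorem exists_pair (p : N.Obj (prod σ τ)) : ∃ a b, p = N.pair a b :=
  ⟨N.starFun (σ := prod σ τ) (τ := σ) Prod.fst p, N.starFun (σ := prod σ τ) (τ := τ) Prod.snd p, by
    exact (N.starFun_id p).symm.trans (N.pair_starFun (σ := prod σ τ) _ _ p).symm⟩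

/-- The counterpart of Łoś's theorem; together with pairing it is the way almost every later fact
about internal objects is reduced to standard ones. -/
theorem mem_starSet_starFun (A : Set τ.Carrier) (f : σ.Carrier → τ.Carrier) (a : N.Obj σ) :
    N.Mem (N.starFun f a) (N.starSet A) ↔ ∀ᶠ i in N.ult a, f i ∈ A := by
  rw [← mem_ult, ult_starFun]; rfl

theorem mem_pair_starSet (A : Set (τ.Carrier × ρ.Carrier)) (f : σ.Carrier → τ.Carrier)
    (g : σ.Carrier → ρ.Carrier) (a : N.Obj σ) :
    N.Mem (N.pair (N.starFun f a) (N.starFun g a)) (N.starSet (σ := prod τ ρ) A) ↔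
      ∀ᶠ i in N.ult a, (f i, g i) ∈ A := by
  rw [pair_starFun]
  exact N.mem_starSet_starFun (τ := prod τ ρ) A _ a

theorem starFun_eq_iff (f g : σ.Carrier → τ.Carrier) (a : N.Obj σ) :
    N.starFun f a = N.starFun g a ↔ ∀ᶠ i in N.ult a, f i = g i := by
  have key := N.mem_pair_starSet {p : τ.Carrier × τ.Carrier | p.1 = p.2} f g a
  refine ⟨fun h => key.1 ?_, fun h => N.starSet_diagonal _ _ (key.2 h)⟩
  rw [h]
  exact (N.mem_pair_starSet _ g g a).2 (Filter.Eventually.of_forall fun _ => rfl)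

theorem exists_rep₁ (a : N.Obj σ) (t : N.Obj ρ) : ∃ (ρ' : FinType) (t' : N.Obj ρ')
    (π : ρ'.Carrier → ρ.Carrier) (f : ρ'.Carrier → σ.Carrier),
    t = N.starFun π t' ∧ a = N.starFun f t' :=
  ⟨prod ρ σ, N.pair t a, Prod.fst, Prod.snd, (N.starFun_fst t a).symm, (N.starFun_snd t a).symm⟩

/-- The internal subset of type `τ` given by a family of standard sets. -/
noncomputable def setFun (F : σ.Carrier → Set τ.Carrier) (a : N.Obj σ) : N.Obj (pow τ) :=
  N.starFun (τ := pow τ) F a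

/-- The internal relation given by a family of standard relations. -/
noncomputable def relFun (F : σ.Carrier → Set (τ.Carrier × ρ.Carrier)) (a : N.Obj σ) :
    N.Obj (pow (prod τ ρ)) :=
  N.starFun (τ := pow (prod τ ρ)) F a

theorem mem_setFun (f : σ.Carrier → τ.Carrier) (F : σ.Carrier → Set τ.Carrier) (a : N.Obj σ) :
    N.Mem (N.starFun f a) (N.setFun F a) ↔ ∀ᶠ i in N.ult a, f i ∈ F i := by
  rw [← starSet_membership]
  exact N.mem_pair_starSet (ρ := pow τ) {p : τ.Carrier × Set τ.Carrier | p.1 ∈ p.2} f F a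

theorem mem_relFun (f : σ.Carrier → τ.Carrier) (g : σ.Carrier → ρ.Carrier)
    (F : σ.Carrier → Set (τ.Carrier × ρ.Carrier)) (a : N.Obj σ) :
    N.Mem (N.pair (N.starFun f a) (N.starFun g a)) (N.relFun F a) ↔
      ∀ᶠ i in N.ult a, (f i, g i) ∈ F i := by
  rw [pair_starFun]
  exact N.mem_setFun (τ := prod τ ρ) _ F a

theorem setFun_starFun (F : τ.Carrier → Set ρ.Carrier) (f : σ.Carrier → τ.Carrier) (a : N.Obj σ) :
    N.setFun F (N.starFun f a) = N.setFun (fun i => F (f i)) a :=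
  N.starFun_starFun (ρ := pow ρ) F f a

end NonstandardUniverse

/-! ### The ordered semiring of hypernatural numbers -/

namespace NonstandardUniverse

open FinType TypedStructure Filter

variable (N : NonstandardUniverse.{u}) {σ τ ρ : FinType}

/-- The hypernatural number given by a family of natural numbers. -/
noncomputable def natFun (f : σ.Carrier → ℕ) (a : N.Obj σ) : N.HNat :=
  N.starFun (τ := nat) f a

theorem exists_natFun₁ (x : N.HNat) : ∃ (ρ : FinType) (t : N.Obj ρ) (f : ρ.Carrier → ℕ),
    x = N.natFun f t := ⟨nat, x, fun i => i, (N.starFun_id x).symm⟩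

/-- The common base point is the pair itself and the functions are the projections; iterating gives
a base point for any finite list. -/
theorem exists_starFun₂ (x : N.Obj σ) (y : N.Obj τ) : ∃ (ρ : FinType) (t : N.Obj ρ)
    (f : ρ.Carrier → σ.Carrier) (g : ρ.Carrier → τ.Carrier),
    x = N.starFun f t ∧ y = N.starFun g t :=
  ⟨prod σ τ, N.pair x y, Prod.fst, Prod.snd, (N.starFun_fst x y).symm, (N.starFun_snd x y).symm⟩

theorem exists_starFun₃ {σ₁ σ₂ σ₃ : FinType} (x : N.Obj σ₁) (y : N.Obj σ₂) (z : N.Obj σ₃) :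
    ∃ (ρ : FinType) (t : N.Obj ρ) (f : ρ.Carrier → σ₁.Carrier) (g : ρ.Carrier → σ₂.Carrier)
      (h : ρ.Carrier → σ₃.Carrier),
      x = N.starFun f t ∧ y = N.starFun g t ∧ z = N.starFun h t := by
  obtain ⟨ρ, t, f, g, rfl, rfl⟩ := N.exists_starFun₂ x y
  obtain ⟨ρ', t', π, h, rfl, rfl⟩ := N.exists_starFun₂ t z
  exact ⟨ρ', t', _, _, h, N.starFun_starFun _ _ _, N.starFun_starFun _ _ _, rfl⟩

theorem exists_starFun₄ {σ₁ σ₂ σ₃ σ₄ : FinType} (x : N.Obj σ₁) (y : N.Obj σ₂) (z : N.Obj σ₃)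
    (w : N.Obj σ₄) :
    ∃ (ρ : FinType) (t : N.Obj ρ) (f : ρ.Carrier → σ₁.Carrier) (g : ρ.Carrier → σ₂.Carrier)
      (h : ρ.Carrier → σ₃.Carrier) (k : ρ.Carrier → σ₄.Carrier),
      x = N.starFun f t ∧ y = N.starFun g t ∧ z = N.starFun h t ∧ w = N.starFun k t := by
  obtain ⟨ρ, t, f, g, h, rfl, rfl, rfl⟩ := N.exists_starFun₃ x y z
  obtain ⟨ρ', t', π, k, rfl, rfl⟩ := N.exists_starFun₂ t w
  exact ⟨ρ', t', _, _, _, k, N.starFun_starFun _ _ _, N.starFun_starFun _ _ _,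
    N.starFun_starFun _ _ _, rfl⟩

theorem exists_natFun₂ (x y : N.HNat) : ∃ (ρ : FinType) (t : N.Obj ρ) (f g : ρ.Carrier → ℕ),
    x = N.natFun f t ∧ y = N.natFun g t := N.exists_starFun₂ x y

theorem exists_natFun₃ (x y z : N.HNat) : ∃ (ρ : FinType) (t : N.Obj ρ) (f g h : ρ.Carrier → ℕ),
    x = N.natFun f t ∧ y = N.natFun g t ∧ z = N.natFun h t := N.exists_starFun₃ x y z

theorem exists_natFun₄ (x y z w : N.HNat) :
    ∃ (ρ : FinType) (t : N.Obj ρ) (f g h k : ρ.Carrier → ℕ),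
    x = N.natFun f t ∧ y = N.natFun g t ∧ z = N.natFun h t ∧ w = N.natFun k t :=
  N.exists_starFun₄ x y z w

theorem natFun_eq_iff {f g : σ.Carrier → ℕ} {t : N.Obj σ} :
    N.natFun f t = N.natFun g t ↔ ∀ᶠ i in N.ult t, f i = g i :=
  N.starFun_eq_iff (τ := nat) f g t

theorem ofNat_eq_natFun (n : ℕ) (t : N.Obj σ) : N.ofNat n = N.natFun (fun _ => n) t :=
  (N.starFun_const (τ := nat) n t).symm

theorem add_natFun (f g : σ.Carrier → ℕ) (t : N.Obj σ) :
    N.add (N.natFun f t) (N.natFun g t) = N.natFun (fun i => f i + g i) t := by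
  have h := N.pair_starFun (τ := nat) (ρ := nat) f g t
  exact (congrArg _ h).trans (N.starFun_starFun (τ := prod nat nat) (ρ := nat) _ _ _)

theorem mul_natFun (f g : σ.Carrier → ℕ) (t : N.Obj σ) :
    N.mul (N.natFun f t) (N.natFun g t) = N.natFun (fun i => f i * g i) t := by
  have h := N.pair_starFun (τ := nat) (ρ := nat) f g t
  exact (congrArg _ h).trans (N.starFun_starFun (τ := prod nat nat) (ρ := nat) _ _ _)

theorem le_natFun (f g : σ.Carrier → ℕ) (t : N.Obj σ) :
    N.le (N.natFun f t) (N.natFun g t) ↔ ∀ᶠ i in N.ult t, f i ≤ g i :=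
  N.mem_pair_starSet (τ := nat) (ρ := nat) _ f g t

theorem lt_natFun (f g : σ.Carrier → ℕ) (t : N.Obj σ) :
    N.lt (N.natFun f t) (N.natFun g t) ↔ ∀ᶠ i in N.ult t, f i < g i :=
  N.mem_pair_starSet (τ := nat) (ρ := nat) _ f g t

/-- Truncated subtraction of hypernatural numbers. -/
noncomputable def sub (x y : N.HNat) : N.HNat :=
  N.starFun (σ := prod nat nat) (τ := nat) (fun p : ℕ × ℕ => (p.1 - p.2 : ℕ)) (N.pair x y)

theorem sub_natFun (f g : σ.Carrier → ℕ) (t : N.Obj σ) :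
    N.sub (N.natFun f t) (N.natFun g t) = N.natFun (fun i => f i - g i) t := by
  have h := N.pair_starFun (τ := nat) (ρ := nat) f g t
  exact (congrArg _ h).trans (N.starFun_starFun (τ := prod nat nat) (ρ := nat) _ _ _)

/-- The operations and casts are definitionally `N.add`, `N.mul` and `N.ofNat`, so statements in
terms of these can be fed to the algebra library by `change` or `exact`. -/
noncomputable instance : CommSemiring N.HNat where
  add := N.add
  mul := N.mul
  zero := N.ofNat 0
  one := N.ofNat 1
  natCast := N.ofNat
  nsmul := @nsmulRec _ ⟨N.ofNat 0⟩ ⟨N.add⟩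
  npow := @npowRec _ ⟨N.ofNat 1⟩ ⟨N.mul⟩
  natCast_zero := rfl
  natCast_succ n := by
    change N.ofNat (n + 1) = N.add (N.ofNat n) (N.ofNat 1)
    obtain ⟨t⟩ : Nonempty N.HNat := ⟨N.ofNat 0⟩
    simp only [N.ofNat_eq_natFun _ t, add_natFun]
  add_assoc x y z := by
    change N.add (N.add x y) z = N.add x (N.add y z)
    obtain ⟨ρ, t, f, g, h, rfl, rfl, rfl⟩ := N.exists_natFun₃ x y z
    simp only [add_natFun, add_assoc]
  zero_add x := by
    change N.add (N.ofNat 0) x = x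
    obtain ⟨ρ, t, f, rfl⟩ := N.exists_natFun₁ x
    simp only [add_natFun, N.ofNat_eq_natFun _ t, zero_add]
  add_zero x := by
    change N.add x (N.ofNat 0) = x
    obtain ⟨ρ, t, f, rfl⟩ := N.exists_natFun₁ x
    simp only [add_natFun, N.ofNat_eq_natFun _ t, add_zero]
  add_comm x y := by
    change N.add x y = N.add y x
    obtain ⟨ρ, t, f, g, rfl, rfl⟩ := N.exists_natFun₂ x y
    simp only [add_natFun, add_comm]
  mul_assoc x y z := by
    change N.mul (N.mul x y) z = N.mul x (N.mul y z)
    obtain ⟨ρ, t, f, g, h, rfl, rfl, rfl⟩ := N.exists_natFun₃ x y z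
    simp only [mul_natFun, mul_assoc]
  mul_comm x y := by
    change N.mul x y = N.mul y x
    obtain ⟨ρ, t, f, g, rfl, rfl⟩ := N.exists_natFun₂ x y
    simp only [mul_natFun, mul_comm]
  one_mul x := by
    change N.mul (N.ofNat 1) x = x
    obtain ⟨ρ, t, f, rfl⟩ := N.exists_natFun₁ x
    simp only [mul_natFun, N.ofNat_eq_natFun _ t, one_mul]
  mul_one x := by
    change N.mul x (N.ofNat 1) = x
    obtain ⟨ρ, t, f, rfl⟩ := N.exists_natFun₁ x
    simp only [mul_natFun, N.ofNat_eq_natFun _ t, mul_one]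
  zero_mul x := by
    change N.mul (N.ofNat 0) x = N.ofNat 0
    obtain ⟨ρ, t, f, rfl⟩ := N.exists_natFun₁ x
    simp only [mul_natFun, N.ofNat_eq_natFun _ t, zero_mul]
  mul_zero x := by
    change N.mul x (N.ofNat 0) = N.ofNat 0
    obtain ⟨ρ, t, f, rfl⟩ := N.exists_natFun₁ x
    simp only [mul_natFun, N.ofNat_eq_natFun _ t, mul_zero]
  left_distrib x y z := by
    change N.mul x (N.add y z) = N.add (N.mul x y) (N.mul x z)
    obtain ⟨ρ, t, f, g, h, rfl, rfl, rfl⟩ := N.exists_natFun₃ x y z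
    simp only [add_natFun, mul_natFun, mul_add]
  right_distrib x y z := by
    change N.mul (N.add x y) z = N.add (N.mul x z) (N.mul y z)
    obtain ⟨ρ, t, f, g, h, rfl, rfl, rfl⟩ := N.exists_natFun₃ x y z
    simp only [add_natFun, mul_natFun, add_mul]

noncomputable instance : LinearOrder N.HNat where
  le := N.le
  lt := N.lt
  le_refl x := by
    obtain ⟨ρ, t, f, rfl⟩ := N.exists_natFun₁ x
    exact (N.le_natFun f f t).2 (.of_forall fun _ => le_rfl)
  le_trans x y z := by
    obtain ⟨ρ, t, f, g, h, rfl, rfl, rfl⟩ := N.exists_natFun₃ x y z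
    simp only [le_natFun]
    intro h1 h2
    filter_upwards [h1, h2] with i h1 h2 using h1.trans h2
  le_antisymm x y := by
    obtain ⟨ρ, t, f, g, rfl, rfl⟩ := N.exists_natFun₂ x y
    simp only [le_natFun, natFun_eq_iff]
    intro h1 h2
    filter_upwards [h1, h2] with i h1 h2 using le_antisymm h1 h2
  le_total x y := by
    obtain ⟨ρ, t, f, g, rfl, rfl⟩ := N.exists_natFun₂ x y
    simp only [le_natFun]
    rw [← Ultrafilter.eventually_or]
    exact .of_forall fun _ => le_total _ _
  lt_iff_le_not_ge x y := by
    obtain ⟨ρ, t, f, g, rfl, rfl⟩ := N.exists_natFun₂ x y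
    simp only [le_natFun, lt_natFun]
    rw [← Ultrafilter.eventually_not, ← eventually_and]
    simp only [lt_iff_le_not_ge]
  toDecidableLE := Classical.decRel _

variable {N}

theorem natFun_add (f g : σ.Carrier → ℕ) (t : N.Obj σ) :
    N.natFun f t + N.natFun g t = N.natFun (fun i => f i + g i) t := N.add_natFun f g t

theorem natFun_mul (f g : σ.Carrier → ℕ) (t : N.Obj σ) :
    N.natFun f t * N.natFun g t = N.natFun (fun i => f i * g i) t := N.mul_natFun f g t

theorem natFun_le {f g : σ.Carrier → ℕ} {t : N.Obj σ} :
    N.natFun f t ≤ N.natFun g t ↔ ∀ᶠ i in N.ult t, f i ≤ g i := N.le_natFun f g t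

theorem natFun_lt {f g : σ.Carrier → ℕ} {t : N.Obj σ} :
    N.natFun f t < N.natFun g t ↔ ∀ᶠ i in N.ult t, f i < g i := N.lt_natFun f g t

theorem natCast_eq_natFun (n : ℕ) (t : N.Obj σ) : (n : N.HNat) = N.natFun (fun _ => n) t :=
  N.ofNat_eq_natFun n t

theorem one_eq_natFun (t : N.Obj σ) : (1 : N.HNat) = N.natFun (fun _ => 1) t :=
  N.ofNat_eq_natFun 1 t

theorem zero_eq_natFun (t : N.Obj σ) : (0 : N.HNat) = N.natFun (fun _ => 0) t :=
  N.ofNat_eq_natFun 0 t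

instance : IsStrictOrderedRing N.HNat where
  zero_le_one := by
    rw [zero_eq_natFun (N.ofNat 0), one_eq_natFun (N.ofNat 0), natFun_le]
    exact .of_forall fun _ => zero_le_one
  exists_pair_ne := ⟨0, 1, by
    rw [zero_eq_natFun (N.ofNat 0), one_eq_natFun (N.ofNat 0), Ne, natFun_eq_iff]
    simpa using (N.ult _).neBot.ne⟩
  add_le_add_left x y := by
    intro h z
    obtain ⟨ρ, t, f, g, h, rfl, rfl, rfl⟩ := N.exists_natFun₃ x y z
    simp only [natFun_add, natFun_le] at *
    filter_upwards [h] with i h using by omega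
  le_of_add_le_add_left x y z := by
    obtain ⟨ρ, t, f, g, h, rfl, rfl, rfl⟩ := N.exists_natFun₃ x y z
    simp only [natFun_add, natFun_le]
    intro h
    filter_upwards [h] with i h using by omega
  mul_lt_mul_of_pos_left x hx y z := by
    obtain ⟨ρ, t, f, g, h, rfl, rfl, rfl⟩ := N.exists_natFun₃ x y z
    simp only [natFun_mul, natFun_lt, zero_eq_natFun t] at *
    intro h
    filter_upwards [h, hx] with i h hx using Nat.mul_lt_mul_of_pos_left h hx
  mul_lt_mul_of_pos_right x hx y z := by
    obtain ⟨ρ, t, f, g, h, rfl, rfl, rfl⟩ := N.exists_natFun₃ x y z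
    simp only [natFun_mul, natFun_lt, zero_eq_natFun t] at *
    intro h
    filter_upwards [h, hx] with i h hx using Nat.mul_lt_mul_of_pos_right h hx

instance : CanonicallyOrderedAdd N.HNat where
  exists_add_of_le {x y} := by
    obtain ⟨ρ, t, f, g, rfl, rfl⟩ := N.exists_natFun₂ x y
    intro h
    refine ⟨N.natFun (fun i => g i - f i) t, ?_⟩
    simp only [natFun_add, natFun_eq_iff, natFun_le] at *
    filter_upwards [h] with i h using by omega
  le_add_self x y := by
    obtain ⟨ρ, t, f, g, rfl, rfl⟩ := N.exists_natFun₂ x y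
    simp only [natFun_add, natFun_le]
    exact .of_forall fun i => by omega
  le_self_add x y := by
    obtain ⟨ρ, t, f, g, rfl, rfl⟩ := N.exists_natFun₂ x y
    simp only [natFun_add, natFun_le]
    exact .of_forall fun i => by omega

noncomputable instance : Sub N.HNat := ⟨N.sub⟩

theorem natFun_sub (f g : σ.Carrier → ℕ) (t : N.Obj σ) :
    N.natFun f t - N.natFun g t = N.natFun (fun i => f i - g i) t := N.sub_natFun f g t

instance : OrderedSub N.HNat where
  tsub_le_iff_right x y z := by
    obtain ⟨ρ, t, f, g, h, rfl, rfl, rfl⟩ := N.exists_natFun₃ x y z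
    simp only [natFun_add, natFun_le, natFun_sub, tsub_le_iff_right]

theorem lt_add_one_iff' {x y : N.HNat} : x < y + 1 ↔ x ≤ y := by
  obtain ⟨ρ, t, f, g, rfl, rfl⟩ := N.exists_natFun₂ x y
  simp only [natFun_add, natFun_le, natFun_lt, one_eq_natFun t, Nat.lt_add_one_iff]

noncomputable instance : SuccAddOrder N.HNat where
  succ x := x + 1
  succ_eq_add_one _ := rfl
  le_succ x := lt_add_one_iff'.1 (lt_of_lt_of_le (lt_add_one x) (le_add_right le_rfl))
  max_of_succ_le {x} h := absurd h (lt_add_one x).not_ge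
  succ_le_of_lt {x y} := by
    obtain ⟨ρ, t, f, g, rfl, rfl⟩ := N.exists_natFun₂ x y
    simp only [natFun_add, natFun_le, natFun_lt, one_eq_natFun t]
    exact id

theorem natFun_starFun (g : τ.Carrier → ℕ) (f : σ.Carrier → τ.Carrier) (t : N.Obj σ) :
    N.natFun g (N.starFun f t) = N.natFun (fun i => g (f i)) t :=
  N.starFun_starFun (ρ := nat) g f t

/-- Division of a hypernatural number by a positive natural number. -/
theorem exists_div (x : N.HNat) {n : ℕ} (hn : 0 < n) :
    ∃ q : N.HNat, ∀ y : N.HNat, n * y ≤ x ↔ y ≤ q := by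
  obtain ⟨ρ, t, f, rfl⟩ := N.exists_natFun₁ x
  refine ⟨N.natFun (fun i => f i / n) t, fun y => ?_⟩
  obtain ⟨ρ', t', π, g, rfl, rfl⟩ : ∃ (ρ' : FinType) (t' : N.Obj ρ') (π : ρ'.Carrier → ρ.Carrier)
    (g : ρ'.Carrier → ℕ), t = N.starFun π t' ∧ y = N.natFun g t' := N.exists_starFun₂ t y
  simp only [natFun_starFun, natCast_eq_natFun _ t', natFun_mul, natFun_le,
    Nat.le_div_iff_mul_le hn, mul_comm]


end NonstandardUniverse

/-! ### Internal sets -/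

namespace NonstandardUniverse

open FinType TypedStructure Filter

variable {N : NonstandardUniverse.{u}} {σ τ ρ : FinType}

/-- `S` is (the set of elements of) an internal set. -/
def IsInternal (S : Set (N.Obj σ)) : Prop := ∃ A, N.elems A = S

theorem isInternal_elems (A : N.Obj (pow σ)) : IsInternal (N.elems A) := ⟨A, rfl⟩

/-- Internal choice: a witness selected at each index represents an internal witness.
Counterexamples to a transferred property are produced this way. -/
theorem exists_mem_starFun {t : N.Obj σ} {R : σ.Carrier → Set τ.Carrier}
    (h : ∀ᶠ i in N.ult t, (R i).Nonempty) :
    ∃ f : σ.Carrier → τ.Carrier, ∀ᶠ i in N.ult t, f i ∈ R i := by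
  classical
  exact ⟨fun i => if h : (R i).Nonempty then h.some else FinType.default τ, by
    filter_upwards [h] with i hi
    rw [dif_pos hi]
    exact hi.some_mem⟩

/-- If the inclusion fails at almost all indices, choosing an element of the difference at each of
them yields an internal element violating the inclusion. -/
theorem elems_setFun_subset {F G : σ.Carrier → Set τ.Carrier} {t : N.Obj σ} :
    N.elems (N.setFun F t) ⊆ N.elems (N.setFun G t) ↔ ∀ᶠ i in N.ult t, F i ⊆ G i := by
  constructor
  · intro h
    by_contra hc
    rw [← Ultrafilter.eventually_not] at hc
    obtain ⟨f, hf⟩ := exists_mem_starFun (R := fun i => F i \ G i)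
      (hc.mono fun i hi => by rwa [Set.not_subset_iff_exists_mem_notMem] at hi)
    have h1 : N.Mem (N.starFun f t) (N.setFun F t) := (N.mem_setFun _ _ _).2 (hf.mono fun i h => h.1)
    have h2 := (N.mem_setFun _ _ _).1 (h h1)
    obtain ⟨i, hi⟩ := (h2.and hf).exists
    exact hi.2.2 hi.1
  · intro h x hx
    obtain ⟨ρ, t', π, f, rfl, rfl⟩ := N.exists_rep₁ x t
    change N.Mem _ _
    change N.Mem _ _ at hx
    rw [setFun_starFun, mem_setFun] at *
    rw [ult_starFun] at h
    filter_upwards [hx, h] with i hx h using h hx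

theorem elems_injective : Function.Injective (N.elems (σ := σ)) := by
  intro A B h
  obtain ⟨ρ, t, F, G, rfl, rfl⟩ : ∃ (ρ : FinType) (t : N.Obj ρ)
    (F G : ρ.Carrier → Set σ.Carrier), A = N.setFun F t ∧ B = N.setFun G t := N.exists_starFun₂ A B
  have h1 := elems_setFun_subset.1 h.subset
  have h2 := elems_setFun_subset.1 h.superset
  refine (N.starFun_eq_iff (τ := pow σ) F G t).2 ?_
  filter_upwards [h1, h2] with i h1 h2 using Set.Subset.antisymm h1 h2

theorem exists_setFun₂ (A B : N.Obj (pow τ)) : ∃ (ρ : FinType) (t : N.Obj ρ)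
    (F G : ρ.Carrier → Set τ.Carrier), A = N.setFun F t ∧ B = N.setFun G t := N.exists_starFun₂ A B

/-- Comprehension: a standard relation with an internal parameter defines an internal set. -/
theorem isInternal_of_starSet {R : Set (τ.Carrier × σ.Carrier)} (a : N.Obj σ) :
    IsInternal {x : N.Obj τ | N.Mem (N.pair x a) (N.starSet (σ := prod τ σ) R)} := by
  refine ⟨N.setFun (fun i => {x | (x, i) ∈ R}) a, ?_⟩
  ext x
  obtain ⟨ρ, t', f, g, rfl, rfl⟩ := N.exists_starFun₂ x a
  change N.Mem _ _ ↔ N.Mem _ _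
  rw [setFun_starFun, mem_setFun, mem_pair_starSet]
  rfl

theorem elems_setFun_diff (F G : σ.Carrier → Set τ.Carrier) (t : N.Obj σ) :
    N.elems (N.setFun (fun i => F i \ G i) t) = N.elems (N.setFun F t) \ N.elems (N.setFun G t) := by
  ext x
  obtain ⟨ρ, t', π, f, rfl, rfl⟩ := N.exists_rep₁ x t
  change N.Mem _ _ ↔ N.Mem _ _ ∧ ¬ N.Mem _ _
  simp only [setFun_starFun, mem_setFun]
  rw [← Ultrafilter.eventually_not, ← eventually_and]
  rfl

theorem elems_setFun_union (F G : σ.Carrier → Set τ.Carrier) (t : N.Obj σ) :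
    N.elems (N.setFun (fun i => F i ∪ G i) t) = N.elems (N.setFun F t) ∪ N.elems (N.setFun G t) := by
  ext x
  obtain ⟨ρ, t', π, f, rfl, rfl⟩ := N.exists_rep₁ x t
  change N.Mem _ _ ↔ N.Mem _ _ ∨ N.Mem _ _
  simp only [setFun_starFun, mem_setFun]
  rw [← Ultrafilter.eventually_or]
  rfl

theorem elems_setFun_univ (t : N.Obj σ) :
    N.elems (N.setFun (fun _ => (Set.univ : Set τ.Carrier)) t) = Set.univ := by
  ext x
  obtain ⟨ρ, t', π, f, rfl, rfl⟩ := N.exists_rep₁ x t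
  change N.Mem _ _ ↔ True
  simp [setFun_starFun, mem_setFun]

theorem isInternal_univ : IsInternal (Set.univ : Set (N.Obj σ)) :=
  ⟨_, elems_setFun_univ (N.ofNat 0)⟩

theorem IsInternal.diff {S T : Set (N.Obj σ)} (hS : IsInternal S) (hT : IsInternal T) :
    IsInternal (S \ T) := by
  obtain ⟨A, rfl⟩ := hS
  obtain ⟨B, rfl⟩ := hT
  obtain ⟨ρ, t, F, G, rfl, rfl⟩ := exists_setFun₂ A B
  exact ⟨_, elems_setFun_diff F G t⟩

theorem IsInternal.union {S T : Set (N.Obj σ)} (hS : IsInternal S) (hT : IsInternal T) :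
    IsInternal (S ∪ T) := by
  obtain ⟨A, rfl⟩ := hS
  obtain ⟨B, rfl⟩ := hT
  obtain ⟨ρ, t, F, G, rfl, rfl⟩ := exists_setFun₂ A B
  exact ⟨_, elems_setFun_union F G t⟩

theorem IsInternal.compl {S : Set (N.Obj σ)} (hS : IsInternal S) : IsInternal Sᶜ := by
  rw [Set.compl_eq_univ_sdiff]; exact isInternal_univ.diff hS

theorem IsInternal.inter {S T : Set (N.Obj σ)} (hS : IsInternal S) (hT : IsInternal T) :
    IsInternal (S ∩ T) := by
  rw [← Set.sdiff_compl]; exact hS.diff hT.compl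

theorem isInternal_empty : IsInternal (∅ : Set (N.Obj σ)) := by
  simpa using (isInternal_univ (N := N) (σ := σ)).compl

theorem isInternal_iUnion_lt {S : ℕ → Set (N.Obj σ)} (hS : ∀ n, IsInternal (S n)) (n : ℕ) :
    IsInternal (⋃ i < n, S i) := by
  induction n with
  | zero => simpa using isInternal_empty
  | succ n ih => rw [Set.biUnion_lt_succ]; exact ih.union (hS n)

theorem isInternal_singleton (x : N.Obj σ) : IsInternal {x} := by
  have := isInternal_of_starSet (R := {p : σ.Carrier × σ.Carrier | p.1 = p.2}) x
  convert this using 1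
  ext y
  obtain ⟨ρ, t, f, g, rfl, rfl⟩ := N.exists_starFun₂ x y
  rw [Set.mem_singleton_iff, starFun_eq_iff]
  exact (N.mem_pair_starSet {p : σ.Carrier × σ.Carrier | p.1 = p.2} g f t).symm

theorem isInternal_Iic (c : N.HNat) : IsInternal (Set.Iic c) :=
  isInternal_of_starSet (τ := nat) (σ := nat) (R := {p : ℕ × ℕ | p.1 ≤ p.2}) c

theorem isInternal_Iio (c : N.HNat) : IsInternal (Set.Iio c) :=
  isInternal_of_starSet (τ := nat) (σ := nat) (R := {p : ℕ × ℕ | p.1 < p.2}) c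

/-- Countable saturation, for internal sets given as sets of objects. -/
theorem exists_mem_forall_of_isInternal {S : ℕ → Set (N.Obj σ)} (hS : ∀ n, IsInternal (S n))
    (h : ∀ n, ∃ x, ∀ k ≤ n, x ∈ S k) : ∃ x, ∀ n, x ∈ S n := by
  choose A hA using hS
  obtain ⟨x, hx⟩ := N.saturation A (fun n => (h n).imp fun x hx k hk => by
    have := hx k hk; rw [← hA] at this; exact this)
  exact ⟨x, fun n => by rw [← hA]; exact hx n⟩

/-- The image of an internal set under an internal relation. -/
def relImage (R : Set (N.Obj (prod σ τ))) (B : Set (N.Obj σ)) : Set (N.Obj τ) :=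
  {y | ∃ x ∈ B, N.pair x y ∈ R}

theorem elems_relFun_mem {F : σ.Carrier → Set (τ.Carrier × ρ.Carrier)} {f : σ.Carrier → τ.Carrier}
    {g : σ.Carrier → ρ.Carrier} {t : N.Obj σ} :
    N.pair (N.starFun f t) (N.starFun g t) ∈ N.elems (N.relFun F t) ↔
      ∀ᶠ i in N.ult t, (f i, g i) ∈ F i := N.mem_relFun f g F t

theorem relFun_starFun {σ' : FinType} (F : σ'.Carrier → Set (τ.Carrier × ρ.Carrier))
    (f : σ.Carrier → σ'.Carrier) (a : N.Obj σ) :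
    N.relFun F (N.starFun f a) = N.relFun (fun i => F (f i)) a :=
  N.starFun_starFun (ρ := pow (prod τ ρ)) F f a

theorem exists_relFun_setFun (R : N.Obj (pow (prod σ τ))) (B : N.Obj (pow σ)) :
    ∃ (ρ : FinType) (t : N.Obj ρ) (F : ρ.Carrier → Set (σ.Carrier × τ.Carrier))
    (G : ρ.Carrier → Set σ.Carrier), R = N.relFun F t ∧ B = N.setFun G t := N.exists_starFun₂ R B

theorem relImage_setFun (F : ρ.Carrier → Set (σ.Carrier × τ.Carrier)) (G : ρ.Carrier → Set σ.Carrier)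
    (t : N.Obj ρ) : relImage (N.elems (N.relFun F t)) (N.elems (N.setFun G t)) =
      N.elems (N.setFun (fun i => {y | ∃ x ∈ G i, (x, y) ∈ F i}) t) := by
  ext y
  constructor
  · rintro ⟨x, hx, hxy⟩
    obtain ⟨ρ', t', π, f, g, rfl, rfl, rfl⟩ := N.exists_starFun₃ t x y
    change N.Mem _ _ at hx
    change N.Mem _ _
    rw [relFun_starFun, elems_relFun_mem] at hxy
    rw [setFun_starFun, mem_setFun] at *
    filter_upwards [hx, hxy] with i h1 h2 using ⟨_, h1, h2⟩
  · intro hy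
    obtain ⟨ρ', t', π, g, rfl, rfl⟩ := N.exists_starFun₂ t y
    change N.Mem _ _ at hy
    rw [setFun_starFun, mem_setFun] at hy
    obtain ⟨f, hf⟩ := exists_mem_starFun (R := fun i => {x | x ∈ G (π i) ∧ (x, g i) ∈ F (π i)}) hy
    refine ⟨N.starFun f t', ?_, ?_⟩
    · change N.Mem _ _
      rw [setFun_starFun, mem_setFun]
      exact hf.mono fun i h => h.1
    · rw [relFun_starFun, elems_relFun_mem]
      exact hf.mono fun i h => h.2

theorem IsInternal.relImage {R : Set (N.Obj (prod σ τ))} {B : Set (N.Obj σ)} (hR : IsInternal R)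
    (hB : IsInternal B) : IsInternal (relImage R B) := by
  obtain ⟨R, rfl⟩ := hR
  obtain ⟨B, rfl⟩ := hB
  obtain ⟨ρ, t, F, G, rfl, rfl⟩ := exists_relFun_setFun R B
  exact ⟨_, (relImage_setFun F G t).symm⟩

end NonstandardUniverse

/-! ### Internal relations -/

namespace NonstandardUniverse

open FinType TypedStructure Filter

variable {N : NonstandardUniverse.{u}} {σ τ ρ : FinType}

theorem IsInternal.preimage {S : Set (N.Obj τ)} (hS : IsInternal S) (f : σ.Carrier → τ.Carrier) :
    IsInternal (N.starFun f ⁻¹' S) := by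
  obtain ⟨A, rfl⟩ := hS
  convert isInternal_of_starSet (N := N) (σ := pow τ)
    (R := {p : σ.Carrier × Set τ.Carrier | f p.1 ∈ p.2}) A using 1
  ext x
  obtain ⟨ρ, t, g, F, rfl, rfl⟩ : ∃ (ρ : FinType) (t : N.Obj ρ) (g : ρ.Carrier → σ.Carrier)
    (F : ρ.Carrier → Set τ.Carrier), x = N.starFun g t ∧ A = N.setFun F t := N.exists_starFun₂ x A
  change N.Mem _ _ ↔ _
  rw [starFun_starFun, mem_setFun]
  exact (N.mem_pair_starSet (ρ := pow τ) {p : σ.Carrier × Set τ.Carrier | f p.1 ∈ p.2} g F t).symm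

theorem mem_starSet_stdGraph {f : σ.Carrier → τ.Carrier} {x : N.Obj σ} {y : N.Obj τ} :
    N.Mem (N.pair x y) (N.starSet (stdGraph f)) ↔ y = N.starFun f x :=
  ⟨fun h => (N.starFun_eq h).symm, fun h => h ▸ N.starFun_spec f x⟩

theorem IsInternal.image {S : Set (N.Obj σ)} (hS : IsInternal S) (f : σ.Carrier → τ.Carrier) :
    IsInternal (N.starFun f '' S) := by
  convert IsInternal.relImage (isInternal_elems (N.starSet (stdGraph f))) hS using 1
  ext y
  exact exists_congr fun x => and_congr_right fun _ =>
    (mem_starSet_stdGraph.trans eq_comm).symm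

/-- First component of an internal pair. -/
noncomputable def fst (p : N.Obj (prod σ τ)) : N.Obj σ :=
  N.starFun (σ := prod σ τ) (τ := σ) Prod.fst p

/-- Second component of an internal pair. -/
noncomputable def snd (p : N.Obj (prod σ τ)) : N.Obj τ :=
  N.starFun (σ := prod σ τ) (τ := τ) Prod.snd p

@[simp] theorem fst_pair (x : N.Obj σ) (y : N.Obj τ) : fst (N.pair x y) = x := N.starFun_fst x y

@[simp] theorem snd_pair (x : N.Obj σ) (y : N.Obj τ) : snd (N.pair x y) = y := N.starFun_snd x y

@[simp] theorem pair_fst_snd (p : N.Obj (prod σ τ)) : N.pair (fst p) (snd p) = p := by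
  obtain ⟨x, y, rfl⟩ := N.exists_pair p
  simp

theorem IsInternal.preimage_fst {S : Set (N.Obj σ)} (hS : IsInternal S) :
    IsInternal {p : N.Obj (prod σ τ) | fst p ∈ S} :=
  hS.preimage (σ := prod σ τ) Prod.fst

theorem IsInternal.preimage_snd {S : Set (N.Obj τ)} (hS : IsInternal S) :
    IsInternal {p : N.Obj (prod σ τ) | snd p ∈ S} :=
  hS.preimage (σ := prod σ τ) Prod.snd

theorem IsInternal.image_snd {S : Set (N.Obj (prod σ τ))} (hS : IsInternal S) :
    IsInternal (snd '' S) := hS.image (σ := prod σ τ) (τ := τ) Prod.snd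

/-- The converse of a relation. -/
def relInv (R : Set (N.Obj (prod σ τ))) : Set (N.Obj (prod τ σ)) := {p | N.pair (snd p) (fst p) ∈ R}

@[simp] theorem pair_mem_relInv {R : Set (N.Obj (prod σ τ))} {x : N.Obj σ} {y : N.Obj τ} :
    N.pair y x ∈ relInv R ↔ N.pair x y ∈ R := by simp [relInv]

theorem starFun_pair_mk {σ₁ σ₂ : FinType} (f : σ.Carrier → σ₁.Carrier) (g : σ.Carrier → σ₂.Carrier)
    (x : N.Obj σ) :
    N.starFun (σ := σ) (τ := prod σ₁ σ₂) (fun i => (f i, g i)) x =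
      N.pair (N.starFun f x) (N.starFun g x) := (N.pair_starFun f g x).symm

theorem relInv_eq_preimage (R : Set (N.Obj (prod σ τ))) : relInv R =
    N.starFun (σ := prod τ σ) (τ := prod σ τ) (fun p : τ.Carrier × σ.Carrier => (p.2, p.1)) ⁻¹' R := by
  ext p
  have : N.starFun (σ := prod τ σ) (τ := prod σ τ)
      (fun p : τ.Carrier × σ.Carrier => (p.2, p.1)) p = N.pair (snd p) (fst p) :=
    starFun_pair_mk (σ := prod τ σ) _ _ p
  rw [Set.mem_preimage, this]
  rfl

theorem IsInternal.relInv {R : Set (N.Obj (prod σ τ))} (hR : IsInternal R) :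
    IsInternal (relInv R) := by
  rw [relInv_eq_preimage]
  exact hR.preimage _

/-- The composition of two relations, the first one being applied first. -/
def relComp (R : Set (N.Obj (prod σ τ))) (Q : Set (N.Obj (prod τ ρ))) : Set (N.Obj (prod σ ρ)) :=
  {p | ∃ y, N.pair (fst p) y ∈ R ∧ N.pair y (snd p) ∈ Q}

@[simp] theorem pair_mem_relComp {R : Set (N.Obj (prod σ τ))} {Q : Set (N.Obj (prod τ ρ))}
    {x : N.Obj σ} {z : N.Obj ρ} :
    N.pair x z ∈ relComp R Q ↔ ∃ y, N.pair x y ∈ R ∧ N.pair y z ∈ Q := by simp [relComp]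

/-- The composite is the projection to the outer coordinates of an internal set of triples; `f` and
`g` are the standard coordinate maps on triples. -/
theorem IsInternal.relComp {R : Set (N.Obj (prod σ τ))} {Q : Set (N.Obj (prod τ ρ))}
    (hR : IsInternal R) (hQ : IsInternal Q) : IsInternal (relComp R Q) := by
  let f : (prod (prod σ τ) ρ).Carrier → (prod τ ρ).Carrier :=
    fun p : (σ.Carrier × τ.Carrier) × ρ.Carrier => (p.1.2, p.2)
  let g : (prod (prod σ τ) ρ).Carrier → (prod σ ρ).Carrier :=
    fun p : (σ.Carrier × τ.Carrier) × ρ.Carrier => (p.1.1, p.2)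
  have hf : ∀ x y z, N.starFun f (N.pair (N.pair x y) z) = N.pair y z := fun x y z => by
    obtain ⟨ρ', t, a, b, c, rfl, rfl, rfl⟩ := N.exists_starFun₃ x y z
    rw [N.pair_starFun a b]
    exact (congrArg (N.starFun f) (N.pair_starFun (τ := prod σ τ) _ c t)).trans
      ((N.starFun_starFun f _ t).trans (N.pair_starFun b c t).symm)
  have hg : ∀ x y z, N.starFun g (N.pair (N.pair x y) z) = N.pair x z := fun x y z => by
    obtain ⟨ρ', t, a, b, c, rfl, rfl, rfl⟩ := N.exists_starFun₃ x y z
    rw [N.pair_starFun a b]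
    exact (congrArg (N.starFun g) (N.pair_starFun (τ := prod σ τ) _ c t)).trans
      ((N.starFun_starFun g _ t).trans (N.pair_starFun a c t).symm)
  convert ((hR.preimage_fst (τ := ρ)).inter (hQ.preimage f)).image g using 1
  ext p
  obtain ⟨x, z, rfl⟩ := N.exists_pair p
  simp only [pair_mem_relComp, Set.mem_image, Set.mem_inter_iff, Set.mem_ofPred_eq,
    Set.mem_preimage]
  constructor
  · rintro ⟨y, h1, h2⟩
    exact ⟨N.pair (N.pair x y) z, ⟨by simpa using h1, by rwa [hf]⟩, hg _ _ _⟩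
  · rintro ⟨q, ⟨h1, h2⟩, h3⟩
    obtain ⟨q, z', rfl⟩ := N.exists_pair q
    obtain ⟨x', y, rfl⟩ := N.exists_pair q
    rw [hg, pair_inj] at h3
    rw [hf] at h2
    obtain ⟨rfl, rfl⟩ := h3
    exact ⟨y, by simpa using h1, h2⟩

/-- A relation that is functional in both directions. -/
def BiUnique (R : Set (N.Obj (prod σ τ))) : Prop :=
  (∀ x y y', N.pair x y ∈ R → N.pair x y' ∈ R → y = y') ∧
    ∀ x x' y, N.pair x y ∈ R → N.pair x' y ∈ R → x = x'

theorem BiUnique.relInv {R : Set (N.Obj (prod σ τ))} (h : BiUnique R) : BiUnique (relInv R) :=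
  ⟨fun x y y' => by simpa using h.2 y y' x, fun x x' y => by simpa using h.1 y x x'⟩

theorem BiUnique.relComp {R : Set (N.Obj (prod σ τ))} {Q : Set (N.Obj (prod τ ρ))}
    (hR : BiUnique R) (hQ : BiUnique Q) : BiUnique (relComp R Q) := by
  constructor
  · intro x z z'
    simp only [pair_mem_relComp]
    rintro ⟨y, h1, h2⟩ ⟨y', h1', h2'⟩
    obtain rfl := hR.1 _ _ _ h1 h1'
    exact hQ.1 _ _ _ h2 h2'
  · intro x x' z
    simp only [pair_mem_relComp]
    rintro ⟨y, h1, h2⟩ ⟨y', h1', h2'⟩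
    obtain rfl := hQ.2 _ _ _ h2 h2'
    exact hR.2 _ _ _ h1 h1'

theorem isInternal_diagonal : IsInternal {p : N.Obj (prod σ σ) | fst p = snd p} := by
  refine ⟨N.starSet (σ := prod σ σ) {p : σ.Carrier × σ.Carrier | p.1 = p.2}, ?_⟩
  ext p
  obtain ⟨x, y, rfl⟩ := N.exists_pair p
  obtain ⟨ρ, t, f, g, rfl, rfl⟩ := N.exists_starFun₂ x y
  rw [Set.mem_ofPred_eq, fst_pair, snd_pair, starFun_eq_iff]
  exact N.mem_pair_starSet {p : σ.Carrier × σ.Carrier | p.1 = p.2} f g t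

theorem biUnique_diagonal : BiUnique {p : N.Obj (prod σ σ) | fst p = snd p} :=
  ⟨fun x y y' h h' => by simp_all, fun x y y' h h' => by simp_all⟩

/-- The relation `y + b = x + a`. -/
def translation (a b : N.HNat) : Set (N.Obj (prod nat nat)) :=
  {p | (snd p : N.HNat) + b = (fst p : N.HNat) + a}

theorem isInternal_translation (a b : N.HNat) : IsInternal (translation a b) := by
  convert isInternal_of_starSet (N := N) (τ := prod nat nat) (σ := prod nat nat)
    (R := {p : (ℕ × ℕ) × (ℕ × ℕ) | p.1.2 + p.2.2 = p.1.1 + p.2.1}) (N.pair a b) using 1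
  ext p
  obtain ⟨x, y, rfl⟩ := N.exists_pair p
  obtain ⟨ρ, t, f, g, h, k, rfl, rfl, rfl, rfl⟩ := N.exists_natFun₄ x y a b
  simp only [translation, Set.mem_ofPred_eq, fst_pair, snd_pair, natFun_add, natFun_eq_iff]
  have h1 : N.pair (N.natFun f t) (N.natFun g t) = _ := N.pair_starFun (τ := nat) (ρ := nat) f g t
  have h2 : N.pair (N.natFun h t) (N.natFun k t) = _ := N.pair_starFun (τ := nat) (ρ := nat) h k t
  rw [h1, h2]
  exact (N.mem_pair_starSet (τ := prod nat nat) (ρ := prod nat nat)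
    {p : (ℕ × ℕ) × (ℕ × ℕ) | p.1.2 + p.2.2 = p.1.1 + p.2.1}
    (fun i => (f i, g i)) (fun i => (h i, k i)) t).symm

theorem biUnique_translation (a b : N.HNat) : BiUnique (translation a b) := by
  constructor
  · intro x y y' h h'
    simp only [translation, Set.mem_ofPred_eq, fst_pair, snd_pair] at h h'
    exact add_right_cancel (h.trans h'.symm)
  · intro x y y' h h'
    simp only [translation, Set.mem_ofPred_eq, fst_pair, snd_pair] at h h'
    exact add_right_cancel (h.symm.trans h')

/-! ### Internal bijections -/

/-- `R` is the graph of a bijection of `S` onto `T`. -/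
structure IsBij (R : Set (N.Obj (prod σ τ))) (S : Set (N.Obj σ)) (T : Set (N.Obj τ)) : Prop where
  left_mem : ∀ x y, N.pair x y ∈ R → x ∈ S
  right_mem : ∀ x y, N.pair x y ∈ R → y ∈ T
  exists_right : ∀ x ∈ S, ∃ y, N.pair x y ∈ R
  exists_left : ∀ y ∈ T, ∃ x, N.pair x y ∈ R
  biUnique : BiUnique R

theorem IsBij.relInv {R : Set (N.Obj (prod σ τ))} {S : Set (N.Obj σ)} {T : Set (N.Obj τ)}
    (h : IsBij R S T) : IsBij (relInv R) T S :=
  ⟨fun x y hx => h.right_mem y x (by simpa using hx), fun x y hx => h.left_mem y x (by simpa using hx),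
    fun x hx => by simpa using h.exists_left x hx, fun x hx => by simpa using h.exists_right x hx,
    h.biUnique.relInv⟩

/-- Uniqueness of the second component transfers. -/
theorem forall_eq_of_relFun {r : ρ.Carrier → Set (σ.Carrier × τ.Carrier)} {t : N.Obj ρ} :
    (∀ x y y', N.pair x y ∈ N.elems (N.relFun r t) → N.pair x y' ∈ N.elems (N.relFun r t) → y = y') ↔
      ∀ᶠ i in N.ult t, ∀ x y y', (x, y) ∈ r i → (x, y') ∈ r i → y = y' := by
  constructor
  · intro h
    by_contra hc
    rw [← Ultrafilter.eventually_not] at hc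
    obtain ⟨f, hf⟩ := exists_mem_starFun (N := N) (t := t) (τ := prod σ (prod τ τ))
      (R := fun i => {q : σ.Carrier × τ.Carrier × τ.Carrier |
        (q.1, q.2.1) ∈ r i ∧ (q.1, q.2.2) ∈ r i ∧ q.2.1 ≠ q.2.2}) (hc.mono fun i hi => by
          push Not at hi
          obtain ⟨x, y, y', h1, h2, h3⟩ := hi
          exact ⟨(x, y, y'), h1, h2, h3⟩)
    let f' : ρ.Carrier → σ.Carrier × τ.Carrier × τ.Carrier := f
    have := h (N.starFun (fun i => (f' i).1) t) (N.starFun (fun i => (f' i).2.1) t)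
      (N.starFun (fun i => (f' i).2.2) t) (elems_relFun_mem.2 (hf.mono fun i hi => hi.1))
      (elems_relFun_mem.2 (hf.mono fun i hi => hi.2.1))
    rw [starFun_eq_iff] at this
    obtain ⟨i, h1, h2⟩ := (this.and hf).exists
    exact h2.2.2 h1
  · intro h x y y' h1 h2
    obtain ⟨ρ', t', π, a, b, c, rfl, rfl, rfl, rfl⟩ := N.exists_starFun₄ t x y y'
    simp only [relFun_starFun, elems_relFun_mem] at h1 h2
    rw [ult_starFun] at h
    rw [starFun_eq_iff]
    filter_upwards [h, h1, h2] with i h h1 h2 using h _ _ _ h1 h2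

/-- Totality transfers. -/
theorem forall_exists_of_relFun {r : ρ.Carrier → Set (σ.Carrier × τ.Carrier)}
    {F : ρ.Carrier → Set σ.Carrier} {t : N.Obj ρ} :
    (∀ x ∈ N.elems (N.setFun F t), ∃ y, N.pair x y ∈ N.elems (N.relFun r t)) ↔
      ∀ᶠ i in N.ult t, ∀ x ∈ F i, ∃ y, (x, y) ∈ r i := by
  constructor
  · intro h
    by_contra hc
    rw [← Ultrafilter.eventually_not] at hc
    obtain ⟨f, hf⟩ := exists_mem_starFun (N := N) (t := t)
      (R := fun i => {x | x ∈ F i ∧ ∀ y, (x, y) ∉ r i}) (hc.mono fun i hi => by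
          push Not at hi
          exact hi)
    obtain ⟨y, hy⟩ := h _ ((N.mem_setFun f F t).2 (hf.mono fun i hi => hi.1))
    obtain ⟨ρ', t', π, g, rfl, rfl⟩ := N.exists_starFun₂ t y
    rw [starFun_starFun, relFun_starFun, elems_relFun_mem] at hy
    rw [ult_starFun] at hf
    have hf' : ∀ᶠ i in N.ult t', f (π i) ∈ F (π i) ∧ ∀ y, (f (π i), y) ∉ r (π i) := hf
    obtain ⟨i, h1, h2⟩ := (hy.and hf').exists
    exact h2.2 _ h1
  · intro h x hx
    obtain ⟨ρ', t', π, g, rfl, rfl⟩ := N.exists_starFun₂ t x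
    change N.Mem _ _ at hx
    rw [setFun_starFun, mem_setFun] at hx
    rw [ult_starFun] at h
    obtain ⟨f, hf⟩ := exists_mem_starFun (N := N) (t := t')
      (R := fun i => {y | (g i, y) ∈ r (π i)}) (by
        filter_upwards [hx, h] with i hx h using h _ hx)
    refine ⟨N.starFun f t', ?_⟩
    rw [relFun_starFun, elems_relFun_mem]
    exact hf

theorem relInv_relFun (r : ρ.Carrier → Set (σ.Carrier × τ.Carrier)) (t : N.Obj ρ) :
    relInv (N.elems (N.relFun r t)) = N.elems (N.relFun (fun i => Prod.swap ⁻¹' (r i)) t) := by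
  ext p
  obtain ⟨x, y, rfl⟩ := N.exists_pair p
  obtain ⟨ρ', t', π, a, b, rfl, rfl, rfl⟩ := N.exists_starFun₃ t x y
  simp only [pair_mem_relInv, relFun_starFun, elems_relFun_mem]
  rfl

/-- Standard bijections, as relations. -/
def StdBij (r : Set (σ.Carrier × τ.Carrier)) (S : Set σ.Carrier) (T : Set τ.Carrier) : Prop :=
  r ⊆ S ×ˢ T ∧ ((∀ x ∈ S, ∃ y, (x, y) ∈ r) ∧ ∀ y ∈ T, ∃ x, (x, y) ∈ r) ∧
    (∀ x y y', (x, y) ∈ r → (x, y') ∈ r → y = y') ∧ ∀ y x x', (x, y) ∈ r → (x', y) ∈ r → x = x'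

theorem isBij_relFun {r : ρ.Carrier → Set (σ.Carrier × τ.Carrier)} {F : ρ.Carrier → Set σ.Carrier}
    {G : ρ.Carrier → Set τ.Carrier} {t : N.Obj ρ} :
    IsBij (N.elems (N.relFun r t)) (N.elems (N.setFun F t)) (N.elems (N.setFun G t)) ↔
      ∀ᶠ i in N.ult t, StdBij (r i) (F i) (G i) := by
  have h1 : N.elems (N.relFun r t) ⊆ N.elems (N.relFun (fun i => F i ×ˢ G i) t) ↔
      ∀ᶠ i in N.ult t, r i ⊆ F i ×ˢ G i := elems_setFun_subset (τ := prod σ τ)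
  have h2 : N.elems (N.relFun (fun i => F i ×ˢ G i) t) =
      {p | fst p ∈ N.elems (N.setFun F t) ∧ snd p ∈ N.elems (N.setFun G t)} := by
    ext p
    obtain ⟨x, y, rfl⟩ := N.exists_pair p
    obtain ⟨ρ', t', π, a, b, rfl, rfl, rfl⟩ := N.exists_starFun₃ t x y
    simp only [Set.mem_ofPred_eq, fst_pair, snd_pair, relFun_starFun, elems_relFun_mem,
      setFun_starFun]
    exact eventually_and.trans (and_congr (N.mem_setFun _ _ _).symm (N.mem_setFun _ _ _).symm)
  have h3 := forall_eq_of_relFun (N := N) (r := r) (t := t)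
  have h4 := forall_eq_of_relFun (N := N) (r := fun i => Prod.swap ⁻¹' (r i)) (t := t)
  have h5 := forall_exists_of_relFun (N := N) (r := r) (F := F) (t := t)
  have h6 := forall_exists_of_relFun (N := N) (r := fun i => Prod.swap ⁻¹' (r i)) (F := G) (t := t)
  simp only [← relInv_relFun, pair_mem_relInv] at h4 h6
  simp only [StdBij, eventually_and]
  rw [← h1, ← h3, ← h5, h2]
  refine Iff.trans ?_ (and_congr Iff.rfl (and_congr (and_congr Iff.rfl h6) (and_congr Iff.rfl h4)))
  constructor
  · rintro ⟨a, b, c, d, e⟩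
    refine ⟨fun p hp => ?_, ⟨c, d⟩, e.1, fun x y y' => e.2 y y' x⟩
    obtain ⟨x, y, rfl⟩ := N.exists_pair p
    simpa using ⟨a _ _ hp, b _ _ hp⟩
  · rintro ⟨a, ⟨b, c⟩, d, e⟩
    exact ⟨fun x y h => by simpa using (a h).1, fun x y h => by simpa using (a h).2, b, c,
      d, fun x y y' => e y' x y⟩

/-- Makes the bijections between two fixed internal sets an internal family, so that saturation can
produce one bijection meeting countably many requirements. -/
theorem isInternal_isBij {S : Set (N.Obj σ)} {T : Set (N.Obj τ)} (hS : IsInternal S)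
    (hT : IsInternal T) : IsInternal {R : N.Obj (pow (prod σ τ)) | IsBij (N.elems R) S T} := by
  obtain ⟨A, rfl⟩ := hS
  obtain ⟨B, rfl⟩ := hT
  convert isInternal_of_starSet (N := N) (τ := pow (prod σ τ)) (σ := prod (pow σ) (pow τ))
    (R := {p : Set (σ.Carrier × τ.Carrier) × Set σ.Carrier × Set τ.Carrier |
      StdBij p.1 p.2.1 p.2.2}) (N.pair A B) using 1
  ext R
  obtain ⟨ρ, t, r, F, G, rfl, rfl, rfl⟩ : ∃ (ρ : FinType) (t : N.Obj ρ)
    (r : ρ.Carrier → Set (σ.Carrier × τ.Carrier)) (F : ρ.Carrier → Set σ.Carrier)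
    (G : ρ.Carrier → Set τ.Carrier), R = N.relFun r t ∧ A = N.setFun F t ∧ B = N.setFun G t :=
    N.exists_starFun₃ R A B
  rw [Set.mem_ofPred_eq, isBij_relFun]
  have h2 : N.pair (N.setFun F t) (N.setFun G t) = _ :=
    N.pair_starFun (τ := pow σ) (ρ := pow τ) F G t
  rw [h2]
  exact (N.mem_pair_starSet (τ := pow (prod σ τ)) (ρ := prod (pow σ) (pow τ))
    {p : Set (σ.Carrier × τ.Carrier) × Set σ.Carrier × Set τ.Carrier |
      StdBij p.1 p.2.1 p.2.2} r (fun i => (F i, G i)) t).symm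

theorem isInternal_subset_elems {S : Set (N.Obj σ)} (hS : IsInternal S) :
    IsInternal {A : N.Obj (pow σ) | S ⊆ N.elems A} := by
  obtain ⟨B, rfl⟩ := hS
  convert isInternal_of_starSet (N := N) (τ := pow σ) (σ := pow σ)
    (R := {p : Set σ.Carrier × Set σ.Carrier | p.2 ⊆ p.1}) B using 1
  ext A
  obtain ⟨ρ, t, F, G, rfl, rfl⟩ := exists_setFun₂ A B
  rw [Set.mem_ofPred_eq, elems_setFun_subset]
  exact (N.mem_pair_starSet (τ := pow σ) (ρ := pow σ)
    {p : Set σ.Carrier × Set σ.Carrier | p.2 ⊆ p.1} F G t).symm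

theorem isInternal_elems_subset {S : Set (N.Obj σ)} (hS : IsInternal S) :
    IsInternal {A : N.Obj (pow σ) | N.elems A ⊆ S} := by
  obtain ⟨B, rfl⟩ := hS
  convert isInternal_of_starSet (N := N) (τ := pow σ) (σ := pow σ)
    (R := {p : Set σ.Carrier × Set σ.Carrier | p.1 ⊆ p.2}) B using 1
  ext A
  obtain ⟨ρ, t, F, G, rfl, rfl⟩ := exists_setFun₂ A B
  rw [Set.mem_ofPred_eq, elems_setFun_subset]
  exact (N.mem_pair_starSet (τ := pow σ) (ρ := pow σ)
    {p : Set σ.Carrier × Set σ.Carrier | p.1 ⊆ p.2} F G t).symm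

end NonstandardUniverse

/-! ### Internal cardinalities -/

namespace NonstandardUniverse

open FinType TypedStructure Filter

variable {N : NonstandardUniverse.{u}} {σ τ ρ : FinType}

/-- `S` is an internal set with at most `d` elements. -/
def CardLE (S : Set (N.Obj σ)) (d : N.HNat) : Prop :=
  ∃ A, N.elems A = S ∧ N.Mem (N.pair A d) (N.starSet (σ := prod (pow σ) nat)
    {p : Set σ.Carrier × ℕ | p.1.encard ≤ p.2})

/-- `S` is an internal set with exactly `d` elements. -/
def HasCard (S : Set (N.Obj σ)) (d : N.HNat) : Prop :=
  ∃ A, N.elems A = S ∧ N.Mem (N.pair A d) (N.starSet (σ := prod (pow σ) nat)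
    {p : Set σ.Carrier × ℕ | p.1.encard = p.2})

theorem cardLE_setFun {F : ρ.Carrier → Set σ.Carrier} {f : ρ.Carrier → ℕ} {t : N.Obj ρ} :
    CardLE (N.elems (N.setFun F t)) (N.natFun f t) ↔ ∀ᶠ i in N.ult t, (F i).encard ≤ f i := by
  have h := N.mem_pair_starSet (τ := pow σ) (ρ := nat)
    {p : Set σ.Carrier × ℕ | p.1.encard ≤ p.2} F f t
  refine ⟨fun ⟨A, hA, h'⟩ => ?_, fun h' => ⟨_, rfl, h.2 h'⟩⟩
  rw [elems_injective hA] at h'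
  exact h.1 h'

theorem hasCard_setFun {F : ρ.Carrier → Set σ.Carrier} {f : ρ.Carrier → ℕ} {t : N.Obj ρ} :
    HasCard (N.elems (N.setFun F t)) (N.natFun f t) ↔ ∀ᶠ i in N.ult t, (F i).encard = f i := by
  have h := N.mem_pair_starSet (τ := pow σ) (ρ := nat)
    {p : Set σ.Carrier × ℕ | p.1.encard = p.2} F f t
  refine ⟨fun ⟨A, hA, h'⟩ => ?_, fun h' => ⟨_, rfl, h.2 h'⟩⟩
  rw [elems_injective hA] at h'
  exact h.1 h'

theorem CardLE.isInternal {S : Set (N.Obj σ)} {d : N.HNat} (h : CardLE S d) : IsInternal S :=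
  ⟨h.choose, h.choose_spec.1⟩

theorem HasCard.isInternal {S : Set (N.Obj σ)} {d : N.HNat} (h : HasCard S d) : IsInternal S :=
  ⟨h.choose, h.choose_spec.1⟩

theorem exists_setFun_natFun (A : N.Obj (pow σ)) (x : N.HNat) : ∃ (ρ : FinType) (t : N.Obj ρ)
    (F : ρ.Carrier → Set σ.Carrier) (f : ρ.Carrier → ℕ), A = N.setFun F t ∧ x = N.natFun f t :=
  N.exists_starFun₂ A x

theorem exists_setFun₂_natFun₂ (A : N.Obj (pow σ)) (B : N.Obj (pow τ)) (x y : N.HNat) :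
    ∃ (ρ : FinType) (t : N.Obj ρ) (F : ρ.Carrier → Set σ.Carrier) (G : ρ.Carrier → Set τ.Carrier)
      (f g : ρ.Carrier → ℕ),
      A = N.setFun F t ∧ B = N.setFun G t ∧ x = N.natFun f t ∧ y = N.natFun g t :=
  N.exists_starFun₄ A B x y

theorem HasCard.cardLE {S : Set (N.Obj σ)} {d : N.HNat} (h : HasCard S d) : CardLE S d := by
  obtain ⟨A, rfl⟩ := h.isInternal
  obtain ⟨ρ, t, F, f, rfl, rfl⟩ := exists_setFun_natFun A d
  rw [hasCard_setFun] at h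
  exact cardLE_setFun.2 (h.mono fun i h => h.le)

theorem CardLE.union {S T : Set (N.Obj σ)} {x y : N.HNat} (hS : CardLE S x) (hT : CardLE T y) :
    CardLE (S ∪ T) (x + y) := by
  obtain ⟨A, rfl⟩ := hS.isInternal
  obtain ⟨B, rfl⟩ := hT.isInternal
  obtain ⟨ρ, t, F, G, f, g, rfl, rfl, rfl, rfl⟩ := exists_setFun₂_natFun₂ A B x y
  rw [← elems_setFun_union, natFun_add]
  rw [cardLE_setFun] at *
  filter_upwards [hS, hT] with i h1 h2
  push_cast
  exact (Set.encard_union_le _ _).trans (add_le_add h1 h2)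

theorem HasCard.union {S T : Set (N.Obj σ)} {x y : N.HNat} (hS : HasCard S x) (hT : HasCard T y)
    (h : Disjoint S T) : HasCard (S ∪ T) (x + y) := by
  obtain ⟨A, rfl⟩ := hS.isInternal
  obtain ⟨B, rfl⟩ := hT.isInternal
  obtain ⟨ρ, t, F, G, f, g, rfl, rfl, rfl, rfl⟩ := exists_setFun₂_natFun₂ A B x y
  rw [← elems_setFun_union, natFun_add]
  rw [hasCard_setFun] at *
  have h3 : ∀ᶠ i in N.ult t, F i ⊆ F i \ G i := by
    rw [← elems_setFun_subset, elems_setFun_diff, h.sdiff_eq_left]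
  filter_upwards [hS, hT, h3] with i h1 h2 h3
  push_cast
  rw [Set.encard_union_eq, h1, h2]
  exact Set.disjoint_left.2 fun x hx => (h3 hx).2

theorem CardLE.mono {S T : Set (N.Obj σ)} {x y : N.HNat} (hS : CardLE S x) (hT : IsInternal T)
    (h : T ⊆ S) (hxy : x ≤ y) : CardLE T y := by
  obtain ⟨A, rfl⟩ := hS.isInternal
  obtain ⟨B, rfl⟩ := hT
  obtain ⟨ρ, t, F, G, f, g, rfl, rfl, rfl, rfl⟩ := exists_setFun₂_natFun₂ A B x y
  rw [cardLE_setFun] at *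
  rw [elems_setFun_subset] at h
  rw [natFun_le] at hxy
  filter_upwards [hS, h, hxy] with i h1 h2 h3
  exact (Set.encard_le_encard h2).trans (h1.trans (by exact_mod_cast h3))

theorem CardLE.mono_right {S : Set (N.Obj σ)} {x y : N.HNat} (hS : CardLE S x)
    (hxy : x ≤ y) : CardLE S y := hS.mono hS.isInternal subset_rfl hxy

theorem CardLE.exists_hasCard {S : Set (N.Obj σ)} {x : N.HNat} (hS : CardLE S x) :
    ∃ y ≤ x, HasCard S y := by
  obtain ⟨A, rfl⟩ := hS.isInternal
  obtain ⟨ρ, t, F, f, rfl, rfl⟩ := exists_setFun_natFun A x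
  rw [cardLE_setFun] at hS
  refine ⟨N.natFun (fun i => (F i).ncard) t, ?_, ?_⟩
  · rw [natFun_le]
    filter_upwards [hS] with i hi
    have hfin : (F i).Finite := Set.finite_of_encard_le_coe hi
    rw [← hfin.cast_ncard_eq] at hi
    exact_mod_cast hi
  · rw [hasCard_setFun]
    filter_upwards [hS] with i hi
    exact (Set.Finite.cast_ncard_eq (Set.finite_of_encard_le_coe hi)).symm

theorem HasCard.le_of_subset {S T : Set (N.Obj σ)} {x y : N.HNat} (hS : HasCard S x)
    (hT : CardLE T y) (h : S ⊆ T) : x ≤ y := by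
  obtain ⟨A, rfl⟩ := hS.isInternal
  obtain ⟨B, rfl⟩ := hT.isInternal
  obtain ⟨ρ, t, F, G, f, g, rfl, rfl, rfl, rfl⟩ := exists_setFun₂_natFun₂ A B x y
  rw [cardLE_setFun] at *
  rw [hasCard_setFun] at *
  rw [elems_setFun_subset] at h
  rw [natFun_le]
  filter_upwards [hS, h, hT] with i h1 h2 h3
  have := (Set.encard_le_encard h2).trans h3
  rw [h1] at this
  exact_mod_cast this

theorem HasCard.unique {S : Set (N.Obj σ)} {x y : N.HNat} (hx : HasCard S x) (hy : HasCard S y) :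
    x = y :=
  le_antisymm (hx.le_of_subset hy.cardLE subset_rfl) (hy.le_of_subset hx.cardLE subset_rfl)

theorem HasCard.diff {S T : Set (N.Obj σ)} {x y : N.HNat} (hS : HasCard S x) (hT : HasCard T y)
    (h : S ⊆ T) : HasCard (T \ S) (y - x) := by
  obtain ⟨z, -, hz⟩ := (hT.cardLE.mono (hT.isInternal.diff hS.isInternal)
    Set.sdiff_subset le_rfl).exists_hasCard
  have h1 := hz.union hS disjoint_sdiff_self_left
  rw [Set.sdiff_union_of_subset h] at h1
  rw [hT.unique h1, add_tsub_cancel_right]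
  exact hz

/-- A non-small internal set has subsets of every smaller cardinality. -/
theorem exists_hasCard_of_not_cardLE {S : Set (N.Obj σ)} {d : N.HNat} (hS : IsInternal S)
    (h : ¬ CardLE S d) : ∃ T ⊆ S, HasCard T (d + 1) := by
  obtain ⟨A, rfl⟩ := hS
  obtain ⟨ρ, t, F, f, rfl, rfl⟩ := exists_setFun_natFun A d
  rw [cardLE_setFun, ← Ultrafilter.eventually_not] at h
  obtain ⟨G, hG⟩ := exists_mem_starFun (N := N) (t := t) (τ := pow σ)
    (R := fun i => {B : Set σ.Carrier | B ⊆ F i ∧ B.encard = (f i + 1 : ℕ)}) (by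
      filter_upwards [h] with i hi
      obtain ⟨B, h1, h2⟩ := Set.exists_subset_encard_eq (s := F i) (k := (f i + 1 : ℕ)) (by
        push_cast
        exact Order.add_one_le_of_lt (not_le.1 hi))
      exact ⟨B, h1, h2⟩)
  refine ⟨N.elems (N.setFun G t), elems_setFun_subset.2 (hG.mono fun i hi => hi.1), ?_⟩
  rw [one_eq_natFun t, natFun_add]
  exact hasCard_setFun.2 (hG.mono fun i hi => hi.2)

theorem HasCard.exists_subset {S : Set (N.Obj σ)} {x y : N.HNat} (hS : HasCard S y) (h : x ≤ y) :
    ∃ T ⊆ S, HasCard T x := by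
  rcases eq_or_ne x 0 with rfl | hx
  · refine ⟨∅, Set.empty_subset _, ?_⟩
    have := hS.diff hS subset_rfl
    rwa [Set.sdiff_self, tsub_self] at this
  · have h1 : x - 1 + 1 = x := tsub_add_cancel_of_le (Order.one_le_iff_pos.2 (pos_iff_ne_zero.2 hx))
    rw [← h1]
    refine exists_hasCard_of_not_cardLE hS.isInternal fun hc => ?_
    have h2 := h.trans (hS.le_of_subset hc subset_rfl)
    have h3 := lt_add_one (x - 1)
    rw [h1] at h3
    exact h3.not_ge h2

/-- `T \ S` has at least `y - x` elements, so `S` can be filled up to size exactly `y` from it. This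
makes internal subsets of prescribed sizes nested. -/
theorem HasCard.exists_between {S T : Set (N.Obj σ)} {x y : N.HNat} (hS : HasCard S x)
    (hT : HasCard T y) (h : x ≤ y) : ∃ D, S ⊆ D ∧ D ⊆ S ∪ T ∧ HasCard D y := by
  obtain ⟨z, -, hz⟩ := (hT.cardLE.mono (hT.isInternal.diff hS.isInternal)
    Set.sdiff_subset le_rfl).exists_hasCard
  have hle : y ≤ x + z := by
    refine hT.le_of_subset (hS.cardLE.union hz.cardLE) ?_
    rw [Set.union_sdiff_self]
    exact Set.subset_union_right
  obtain ⟨E, hE, hE'⟩ := hz.exists_subset (x := y - x) (tsub_le_iff_left.2 hle)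
  refine ⟨S ∪ E, Set.subset_union_left,
    Set.union_subset_union_right _ (hE.trans Set.sdiff_subset), ?_⟩
  have := hS.union hE' (Set.disjoint_left.2 fun a ha ha' => (hE ha').2 ha)
  rwa [add_tsub_cancel_of_le h] at this

theorem isInternal_hasCard (d : N.HNat) :
    IsInternal {A : N.Obj (pow σ) | HasCard (N.elems A) d} := by
  convert isInternal_of_starSet (N := N) (τ := pow σ) (σ := nat)
    (R := {p : Set σ.Carrier × ℕ | p.1.encard = p.2}) d using 1
  ext A
  refine ⟨fun ⟨B, hB, h⟩ => ?_, fun h => ⟨A, rfl, h⟩⟩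
  rwa [elems_injective hB] at h

theorem isInternal_cardLE (d : N.HNat) :
    IsInternal {A : N.Obj (pow σ) | CardLE (N.elems A) d} := by
  convert isInternal_of_starSet (N := N) (τ := pow σ) (σ := nat)
    (R := {p : Set σ.Carrier × ℕ | p.1.encard ≤ p.2}) d using 1
  ext A
  refine ⟨fun ⟨B, hB, h⟩ => ?_, fun h => ⟨A, rfl, h⟩⟩
  rwa [elems_injective hB] at h

theorem hasCard_Ico (a d : N.HNat) : HasCard (Set.Ico a (a + d)) d := by
  obtain ⟨ρ, t, f, g, rfl, rfl⟩ := N.exists_natFun₂ a d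
  obtain ⟨F, hF⟩ : ∃ F : ρ.Carrier → Set nat.Carrier,
    ∀ i, F i = (Set.Ico (f i) (f i + g i) : Set ℕ) := ⟨_, fun i => rfl⟩
  have : Set.Ico (N.natFun f t) (N.natFun f t + N.natFun g t) = N.elems (N.setFun F t) := by
    ext x
    obtain ⟨ρ', t', π, h, rfl, rfl⟩ : ∃ (ρ' : FinType) (t' : N.Obj ρ') (π : ρ'.Carrier → ρ.Carrier)
      (h : ρ'.Carrier → ℕ), t = N.starFun π t' ∧ x = N.natFun h t' := N.exists_starFun₂ t x
    simp only [natFun_starFun, natFun_add, Set.mem_Ico, natFun_le, natFun_lt, setFun_starFun]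
    rw [← eventually_and]
    refine Iff.trans ?_ (N.mem_setFun (τ := nat) h (fun i => F (π i)) t').symm
    exact eventually_congr (.of_forall fun i => by rw [hF]; rfl)
  rw [this, hasCard_setFun]
  refine .of_forall fun i => ?_
  rw [hF]
  change (Set.Ico (f i) (f i + g i)).encard = _
  rw [← Finset.coe_Ico, Set.encard_coe_eq_coe_finsetCard]
  simp

theorem hasCard_Iio (d : N.HNat) : HasCard (Set.Iio d) d := by
  have := hasCard_Ico 0 d
  rwa [zero_add, ← Set.Ici_inter_Iio, show Set.Ici (0 : N.HNat) = Set.univ from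
    Set.eq_univ_of_forall fun x => Set.mem_Ici.2 zero_le, Set.univ_inter] at this

theorem exists_stdBij {S : Set σ.Carrier} {T : Set τ.Carrier} (e : S ≃ T) :
    ∃ r, StdBij r S T := by
  refine ⟨{p | ∃ x : S, p = (x.1, (e x).1)}, ?_, ⟨?_, ?_⟩, ?_, ?_⟩
  · rintro _ ⟨x, rfl⟩
    exact ⟨x.2, (e x).2⟩
  · exact fun x hx => ⟨_, ⟨x, hx⟩, rfl⟩
  · exact fun y hy => ⟨(e.symm ⟨y, hy⟩).1, e.symm ⟨y, hy⟩, by simp⟩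
  · rintro x y y' ⟨a, ha⟩ ⟨b, hb⟩
    simp only [Prod.mk.injEq] at ha hb
    have : a = b := Subtype.ext (ha.1.symm.trans hb.1)
    rw [ha.2, hb.2, this]
  · rintro y x x' ⟨a, ha⟩ ⟨b, hb⟩
    simp only [Prod.mk.injEq] at ha hb
    have : e a = e b := Subtype.ext (ha.2.symm.trans hb.2)
    rw [ha.1, hb.1, e.injective this]

theorem exists_isBij {F : ρ.Carrier → Set σ.Carrier} {G : ρ.Carrier → Set τ.Carrier} {t : N.Obj ρ}
    (h : ∀ᶠ i in N.ult t, Nonempty (F i ≃ G i)) :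
    ∃ R, IsInternal R ∧ IsBij R (N.elems (N.setFun F t)) (N.elems (N.setFun G t)) := by
  obtain ⟨r, hr⟩ := exists_mem_starFun (N := N) (t := t) (τ := pow (prod σ τ))
    (R := fun i => {r : Set (σ.Carrier × τ.Carrier) | StdBij r (F i) (G i)})
    (h.mono fun i ⟨e⟩ => exists_stdBij e)
  exact ⟨N.elems (N.relFun r t), isInternal_elems _, isBij_relFun.2 hr⟩

theorem nonempty_equiv_of_encard_eq {α β : Type} {S : Set α} {T : Set β} {n : ℕ}
    (hS : S.encard = n) (hT : T.encard = n) : Nonempty (S ≃ T) := by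
  have := (Set.finite_of_encard_eq_coe hS).to_subtype
  have := (Set.finite_of_encard_eq_coe hT).to_subtype
  rw [← Finite.card_eq, Nat.card_coe_set_eq, Nat.card_coe_set_eq, Set.ncard_def, Set.ncard_def, hS, hT]

theorem nonempty_equiv_univ_of_infinite {S : Set ℕ} (hS : S.Infinite) :
    Nonempty (S ≃ (Set.univ : Set ℕ)) := by
  have := hS.to_subtype
  exact ⟨(nonempty_denumerable S).some.eqv.trans (Equiv.Set.univ ℕ).symm⟩

theorem HasCard.exists_isBij {S : Set (N.Obj σ)} {T : Set (N.Obj τ)} {d : N.HNat}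
    (hS : HasCard S d) (hT : HasCard T d) : ∃ R, IsInternal R ∧ IsBij R S T := by
  obtain ⟨A, rfl⟩ := hS.isInternal
  obtain ⟨B, rfl⟩ := hT.isInternal
  obtain ⟨ρ, t, F, G, f, g, rfl, rfl, rfl, h⟩ := exists_setFun₂_natFun₂ A B d d
  rw [hasCard_setFun] at hS hT
  refine NonstandardUniverse.exists_isBij ?_
  filter_upwards [hS, hT] with i h1 h2
  exact nonempty_equiv_of_encard_eq h1 h2

/-- An internal set of hypernatural numbers without hyperfinite cardinality is in internal
bijection with the set of all hypernatural numbers. -/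
theorem exists_isBij_univ {S : Set N.HNat} (hS : IsInternal S) (h : ∀ d, ¬ CardLE S d) :
    ∃ R, IsInternal R ∧ IsBij R S (Set.univ : Set N.HNat) := by
  obtain ⟨A, rfl⟩ := hS
  obtain ⟨ρ, t, F, G, rfl, hG⟩ := exists_setFun₂ A A
  rw [← elems_setFun_univ t]
  refine NonstandardUniverse.exists_isBij ?_
  have : ∀ᶠ i in N.ult t, ¬ (F i).Finite := by
    rw [Ultrafilter.eventually_not]
    intro hc
    refine h (N.natFun (fun i => (F i).ncard) t) (cardLE_setFun.2 ?_)
    filter_upwards [hc] with i hi using hi.cast_ncard_eq.ge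
  filter_upwards [this] with i hi
  exact nonempty_equiv_univ_of_infinite hi

/-- Being internally infinite is a single standard property of an internal set, although it
quantifies over all hypernatural bounds; this is what allows saturation to preserve it. -/
theorem isInternal_not_finite : IsInternal {A : N.Obj (pow σ) | ∀ d, ¬ CardLE (N.elems A) d} := by
  -- The family is constant, so the base point `N.ofNat 0` is a dummy; `h'` below moves it to the
  -- base point of the set under consideration.
  refine ⟨N.setFun (τ := pow σ) (fun _ => {B : Set σ.Carrier | B.Infinite}) (N.ofNat 0), ?_⟩
  ext A
  obtain ⟨ρ, t, π, F, h, rfl⟩ : ∃ (ρ : FinType) (t : N.Obj ρ) (π : ρ.Carrier → ℕ)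
    (F : ρ.Carrier → Set σ.Carrier), N.ofNat 0 = N.natFun π t ∧ A = N.setFun F t :=
    N.exists_starFun₂ (N.ofNat 0) A
  have key : N.setFun F t ∈ N.elems (N.setFun (σ := ρ) (τ := pow σ)
      (fun _ => {B : Set σ.Carrier | B.Infinite}) t) ↔ ∀ᶠ i in N.ult t, (F i).Infinite :=
    N.mem_setFun (τ := pow σ) F _ t
  have h' : N.setFun (τ := pow σ) (fun _ => {B : Set σ.Carrier | B.Infinite}) (N.ofNat 0) =
      N.setFun (σ := ρ) (τ := pow σ) (fun _ => {B : Set σ.Carrier | B.Infinite}) t := by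
    rw [h]; exact N.setFun_starFun (τ := nat) (ρ := pow σ) _ π t
  rw [h', key]
  constructor
  · intro h d hd
    obtain ⟨ρ', t', π', g, rfl, rfl⟩ : ∃ (ρ' : FinType) (t' : N.Obj ρ') (π : ρ'.Carrier → ρ.Carrier)
      (h : ρ'.Carrier → ℕ), t = N.starFun π t' ∧ d = N.natFun h t' := N.exists_starFun₂ t d
    rw [setFun_starFun, cardLE_setFun] at hd
    rw [ult_starFun] at h
    have h' : ∀ᶠ i in N.ult t', (F (π' i)).Infinite := h
    obtain ⟨i, h1, h2⟩ := (hd.and h').exists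
    exact h2 (Set.finite_of_encard_le_coe h1)
  · intro h
    change ∀ᶠ i in N.ult t, ¬ (F i).Finite
    rw [Ultrafilter.eventually_not]
    intro hc
    refine h (N.natFun (fun i => (F i).ncard) t) (cardLE_setFun.2 ?_)
    filter_upwards [hc] with i hi using hi.cast_ncard_eq.ge

theorem CardLE.image_fst {S : Set (N.Obj (prod σ τ))} {d : N.HNat} (h : CardLE S d) :
    CardLE (fst '' S) d := by
  obtain ⟨A, rfl⟩ := h.isInternal
  obtain ⟨ρ, t, r, f, rfl, rfl⟩ : ∃ (ρ : FinType) (t : N.Obj ρ)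
    (r : ρ.Carrier → Set (σ.Carrier × τ.Carrier)) (f : ρ.Carrier → ℕ),
    A = N.relFun r t ∧ d = N.natFun f t := N.exists_starFun₂ A d
  have h' : ∀ᶠ i in N.ult t, (r i).encard ≤ f i := (cardLE_setFun (σ := prod σ τ)).1 h
  have : fst '' N.elems (N.relFun r t) = N.elems (N.setFun (fun i => Prod.fst '' (r i)) t) := by
    have h1 := relImage_setFun (fun i => Prod.swap ⁻¹' (r i)) (fun _ => Set.univ) t
    rw [← relInv_relFun, elems_setFun_univ] at h1
    convert h1 using 1
    · ext x
      simp only [relImage, Set.mem_image, Set.mem_ofPred_eq, pair_mem_relInv, Set.mem_univ, true_and]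
      constructor
      · rintro ⟨p, hp, rfl⟩
        exact ⟨snd p, by simpa using hp⟩
      · rintro ⟨y, hy⟩
        exact ⟨_, hy, fst_pair _ _⟩
    · congr 2
      ext i x
      simp
  rw [this, cardLE_setFun]
  filter_upwards [h'] with i hi using (Set.encard_image_le _ _).trans hi

theorem CardLE.of_image_snd {S : Set (N.Obj (prod σ τ))} {d : N.HNat} (hS : IsInternal S)
    (hinj : BiUnique S) (h : CardLE (snd '' S) d) : CardLE S d := by
  obtain ⟨A, rfl⟩ := hS
  obtain ⟨ρ, t, r, f, rfl, rfl⟩ : ∃ (ρ : FinType) (t : N.Obj ρ)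
    (r : ρ.Carrier → Set (σ.Carrier × τ.Carrier)) (f : ρ.Carrier → ℕ),
    A = N.relFun r t ∧ d = N.natFun f t := N.exists_starFun₂ A d
  have : snd '' N.elems (N.relFun r t) = N.elems (N.setFun (fun i => Prod.snd '' (r i)) t) := by
    have h1 := relImage_setFun r (fun _ => Set.univ) t
    rw [elems_setFun_univ] at h1
    convert h1 using 1
    · ext x
      simp only [relImage, Set.mem_image, Set.mem_ofPred_eq, Set.mem_univ, true_and]
      constructor
      · rintro ⟨p, hp, rfl⟩
        exact ⟨fst p, by simpa using hp⟩
      · rintro ⟨y, hy⟩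
        exact ⟨_, hy, snd_pair _ _⟩
    · congr 2
      ext i x
      simp
  rw [this, cardLE_setFun] at h
  have h2 := hinj.relInv.1
  rw [relInv_relFun, forall_eq_of_relFun] at h2
  refine (cardLE_setFun (σ := prod σ τ)).2 ?_
  filter_upwards [h, h2] with i h1 h2
  rw [Set.InjOn.encard_image] at h1
  · exact h1
  · rintro ⟨a, b⟩ hp ⟨a', b'⟩ hq h
    simp only at h
    subst h
    exact Prod.ext (h2 b _ _ hp hq) rfl

end NonstandardUniverse

/-! ### Borel sets and their approximation by internal sets -/

namespace NonstandardUniverse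

open FinType TypedStructure Filter

variable {N : NonstandardUniverse.{u}} {σ τ ρ : FinType}

theorem IsInternal.isBorel {S : Set (N.Obj σ)} (h : IsInternal S) : N.IsBorel S :=
  MeasurableSpace.measurableSet_generateFrom h

theorem IsBorel.compl {S : Set (N.Obj σ)} (h : N.IsBorel S) : N.IsBorel Sᶜ :=
  @MeasurableSet.compl _ _ (MeasurableSpace.generateFrom _) h

theorem IsBorel.iUnion {S : ℕ → Set (N.Obj σ)} (h : ∀ n, N.IsBorel (S n)) :
    N.IsBorel (⋃ n, S n) :=
  @MeasurableSet.iUnion _ _ (MeasurableSpace.generateFrom _) _ _ h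

theorem IsBorel.iInter {S : ℕ → Set (N.Obj σ)} (h : ∀ n, N.IsBorel (S n)) :
    N.IsBorel (⋂ n, S n) :=
  @MeasurableSet.iInter _ _ (MeasurableSpace.generateFrom _) _ _ h

theorem IsBorel.inter {S T : Set (N.Obj σ)} (h : N.IsBorel S) (h' : N.IsBorel T) :
    N.IsBorel (S ∩ T) :=
  @MeasurableSet.inter _ (MeasurableSpace.generateFrom _) _ _ h h'

theorem IsBorel.diff {S T : Set (N.Obj σ)} (h : N.IsBorel S) (h' : N.IsBorel T) :
    N.IsBorel (S \ T) :=
  @MeasurableSet.diff _ (MeasurableSpace.generateFrom _) _ _ h h'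

/-- Induction on Borel sets. -/
theorem IsBorel.induction {P : Set (N.Obj σ) → Prop} (hint : ∀ S, IsInternal S → P S)
    (hcompl : ∀ S, P S → P Sᶜ) (hunion : ∀ S : ℕ → Set (N.Obj σ), (∀ n, P (S n)) → P (⋃ n, S n))
    {S : Set (N.Obj σ)} (hS : N.IsBorel S) : P S :=
  MeasurableSpace.generateFrom_induction _ (fun S _ => P S) (fun S hS _ => hint S hS)
    (hint _ isInternal_empty) (fun S _ h => hcompl S h) (fun S _ h => hunion S h) S hS

/-- A Borel set is determined by countably many internal sets. -/
theorem IsBorel.exists_determining {X : Set (N.Obj σ)} (hX : N.IsBorel X) :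
    ∃ A : ℕ → Set (N.Obj σ), (∀ n, IsInternal (A n)) ∧
      ∀ x y, (∀ n, x ∈ A n ↔ y ∈ A n) → (x ∈ X ↔ y ∈ X) := by
  refine IsBorel.induction (P := fun X => ∃ A : ℕ → Set (N.Obj σ), (∀ n, IsInternal (A n)) ∧
      ∀ x y, (∀ n, x ∈ A n ↔ y ∈ A n) → (x ∈ X ↔ y ∈ X)) (fun S hS => ⟨fun _ => S, fun _ => hS, fun x y h => h 0⟩) ?_ ?_ hX
  · rintro S ⟨A, hA, h⟩
    exact ⟨A, hA, fun x y hxy => not_congr (h x y hxy)⟩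
  · intro S hS
    choose A hA h using hS
    refine ⟨fun n => A n.unpair.1 n.unpair.2, fun n => hA _ _, fun x y hxy => ?_⟩
    simp only [Set.mem_iUnion]
    refine exists_congr fun n => h n x y fun m => ?_
    simpa using hxy (Nat.pair n m)

/-- Either `X` is covered by countably many internal sets satisfying `P`, or it contains the
intersection of a decreasing sequence of internal sets not satisfying `P`. -/
theorem IsBorel.cover_or_exists_iInter_subset {X : Set (N.Obj σ)} (hX : N.IsBorel X)
    (P : Set (N.Obj σ) → Prop) :
    (∃ E : ℕ → Set (N.Obj σ), (∀ n, IsInternal (E n)) ∧ (∀ n, P (E n)) ∧ X ⊆ ⋃ n, E n) ∨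
      X = ∅ ∨ ∃ D : ℕ → Set (N.Obj σ), (∀ n, IsInternal (D n)) ∧ Antitone D ∧ (∀ n, ¬ P (D n)) ∧
        ⋂ n, D n ⊆ X := by
  classical
  obtain ⟨A, hA, hdet⟩ := hX.exists_determining
  -- `D x n` is the atom containing `x` of the algebra generated by the first `n` determining sets.
  -- Each level has finitely many atoms, hence there are countably many in all. If every point of
  -- `X` has an atom satisfying `P`, these atoms cover; otherwise a bad point gives a branch of bad
  -- atoms, and its intersection lies in `X`.
  let D : N.Obj σ → ℕ → Set (N.Obj σ) := fun x n => {y | ∀ k < n, (x ∈ A k ↔ y ∈ A k)}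
  have hD : ∀ x n, D x (n + 1) = D x n ∩ if x ∈ A n then A n else (A n)ᶜ := by
    intro x n
    ext y
    by_cases hx : x ∈ A n <;>
    · simp only [D, Set.mem_ofPred_eq, Nat.lt_succ_iff_lt_or_eq, or_imp, forall_and, forall_eq, hx,
        Set.mem_inter_iff]
      simp
  have hD0 : ∀ x, D x 0 = Set.univ := fun x => by simp [D]
  have hint : ∀ x n, IsInternal (D x n) := by
    intro x n
    induction n with
    | zero => rw [hD0]; exact isInternal_univ
    | succ n ih =>
      rw [hD]
      split_ifs
      · exact ih.inter (hA n)
      · exact ih.inter (hA n).compl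
  have hfin : ∀ n, (Set.range fun x => D x n).Finite := by
    intro n
    induction n with
    | zero => simp only [hD0]; exact Set.finite_range_const
    | succ n ih =>
      refine ((ih.image fun S => S ∩ A n).union (ih.image fun S => S ∩ (A n)ᶜ)).subset ?_
      rintro _ ⟨x, rfl⟩
      simp only [hD]
      split_ifs
      · exact Or.inl ⟨_, ⟨x, rfl⟩, rfl⟩
      · exact Or.inr ⟨_, ⟨x, rfl⟩, rfl⟩
  have hself : ∀ x n, x ∈ D x n := fun x n k _ => Iff.rfl
  by_cases h : ∃ x ∈ X, ∀ n, ¬ P (D x n)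
  · obtain ⟨x, hx, h⟩ := h
    refine Or.inr (Or.inr ⟨D x, hint x, ?_, h, ?_⟩)
    · exact fun m n hmn y hy k hk => hy k (hk.trans_le hmn)
    · intro y hy
      refine (hdet x y fun n => ?_).1 hx
      exact Set.mem_iInter.1 hy (n + 1) n (Nat.lt_succ_self n)
  · push Not at h
    rcases X.eq_empty_or_nonempty with hX | ⟨x₀, hx₀⟩
    · exact Or.inr (Or.inl hX)
    let 𝓒 : Set (Set (N.Obj σ)) := (⋃ n, Set.range fun x => D x n) ∩ {S | P S}
    have h𝓒 : 𝓒.Countable :=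
      (Set.countable_iUnion fun n => (hfin n).countable).mono Set.inter_subset_left
    have hmem : ∀ x ∈ X, ∃ S ∈ 𝓒, x ∈ S := by
      intro x hx
      obtain ⟨n, hn⟩ := h x hx
      exact ⟨D x n, ⟨Set.mem_iUnion.2 ⟨n, x, rfl⟩, hn⟩, hself x n⟩
    obtain ⟨S₀, hS₀, -⟩ := hmem x₀ hx₀
    obtain ⟨E, hE⟩ := h𝓒.exists_eq_range ⟨S₀, hS₀⟩
    have hE' : ∀ n, E n ∈ 𝓒 := fun n => hE ▸ Set.mem_range_self n
    refine Or.inl ⟨E, fun n => ?_, fun n => (hE' n).2, fun x hx => ?_⟩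
    · obtain ⟨m, x, hx⟩ := Set.mem_iUnion.1 (hE' n).1
      rw [← hx]
      exact hint x m
    · obtain ⟨S, hS, hxS⟩ := hmem x hx
      rw [hE] at hS
      obtain ⟨n, rfl⟩ := hS
      exact Set.mem_iUnion.2 ⟨n, hxS⟩

/-- A decreasing sequence of internal sets of large cardinality has an internal set of the same
cardinality in its intersection. -/
theorem exists_hasCard_subset_iInter {D : ℕ → Set (N.Obj σ)} (hD : ∀ n, IsInternal (D n))
    (hanti : Antitone D) {d : N.HNat} (h : ∀ n, ∃ T ⊆ D n, HasCard T d) :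
    ∃ T ⊆ ⋂ n, D n, HasCard T d := by
  -- Saturation over the internal sets of size `d` contained in `D n`; by antitonicity a witness for
  -- `n` also serves all smaller indices.
  obtain ⟨A, hA⟩ := exists_mem_forall_of_isInternal
    (S := fun n => {A : N.Obj (pow σ) | HasCard (N.elems A) d} ∩ {A | N.elems A ⊆ D n})
    (fun n => (isInternal_hasCard d).inter (isInternal_elems_subset (hD n))) (fun n => by
      obtain ⟨T, hT, hT'⟩ := h n
      obtain ⟨A, rfl⟩ := hT'.isInternal
      exact ⟨A, fun k hk => ⟨hT', hT.trans (hanti hk)⟩⟩)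
  exact ⟨N.elems A, Set.subset_iInter fun n => (hA n).2, (hA 0).1⟩

/-- Countably many internal sets whose finite unions have few elements outside `S` are all
contained in one internal set with few elements outside `S`. -/
theorem exists_cover_of_forall {E : ℕ → Set (N.Obj σ)} (hE : ∀ n, IsInternal (E n))
    {S H : Set (N.Obj σ)} (hS : IsInternal S) (hH : IsInternal H) (hEH : ∀ n, E n ⊆ H) {d : N.HNat}
    (h : ∀ n, CardLE ((⋃ i < n, E i) \ S) d) :
    ∃ C, IsInternal C ∧ C ⊆ H ∧ (∀ n, E n ⊆ C) ∧ CardLE (C \ S) d := by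
  have hint : IsInternal {A : N.Obj (pow σ) | CardLE (N.elems A \ S) d} := by
    obtain ⟨B, rfl⟩ := hS
    convert isInternal_of_starSet (N := N) (τ := pow σ) (σ := prod (pow σ) nat)
      (R := {p : Set σ.Carrier × Set σ.Carrier × ℕ | (p.1 \ p.2.1).encard ≤ p.2.2})
      (N.pair B d) using 1
    ext A
    obtain ⟨ρ, t, F, G, f, rfl, rfl, rfl⟩ : ∃ (ρ : FinType) (t : N.Obj ρ)
      (F G : ρ.Carrier → Set σ.Carrier) (f : ρ.Carrier → ℕ),
      A = N.setFun F t ∧ B = N.setFun G t ∧ d = N.natFun f t := N.exists_starFun₃ A B d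
    rw [Set.mem_ofPred_eq, ← elems_setFun_diff, cardLE_setFun]
    have h2 : N.pair (N.setFun G t) (N.natFun f t) = _ :=
      N.pair_starFun (τ := pow σ) (ρ := nat) G f t
    rw [h2]
    exact (N.mem_pair_starSet (τ := pow σ) (ρ := prod (pow σ) nat)
      {p : Set σ.Carrier × Set σ.Carrier × ℕ | (p.1 \ p.2.1).encard ≤ p.2.2} F
      (fun i => (G i, f i)) t).symm
  obtain ⟨A, hA⟩ := exists_mem_forall_of_isInternal
    (S := fun n => {A : N.Obj (pow σ) | CardLE (N.elems A \ S) d} ∩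
      ({A | N.elems A ⊆ H} ∩ {A | E n ⊆ N.elems A}))
    (fun n => hint.inter ((isInternal_elems_subset hH).inter (isInternal_subset_elems (hE n))))
    (fun n => by
      obtain ⟨A, hA⟩ := isInternal_iUnion_lt hE (n + 1)
      refine ⟨A, fun k hk => ⟨?_, ?_, ?_⟩⟩
      · rw [Set.mem_ofPred_eq, hA]; exact h _
      · rw [Set.mem_ofPred_eq, hA]; exact Set.iUnion₂_subset fun i _ => hEH i
      · rw [Set.mem_ofPred_eq, hA]; exact Set.subset_biUnion_of_mem (u := E) (Nat.lt_succ_of_le hk))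
  exact ⟨N.elems A, isInternal_elems A, (hA 0).2.1, fun n => (hA n).2.2, (hA 0).1⟩

/-- A bounded sequence eventually increases by at most a standard fraction of the bound. -/
theorem exists_forall_mul_le {a : ℕ → N.HNat} {h : N.HNat} (hb : ∀ n, a n ≤ h)
    (p : ℕ) : ∃ k, ∀ m, k ≤ m → p * a m ≤ p * a k + h := by
  by_contra hc
  push Not at hc
  -- If increases of `p * a` by more than `h` never stop, `p` of them bring `p * a` strictly above
  -- `p * h`, contrary to the bound. Strictness is only available for `j > 0`, and `p = 0` is
  -- handled separately.
  have : ∀ j : ℕ, ∃ k, j * h ≤ p * a k ∧ (j = 0 ∨ j * h < p * a k) := by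
    intro j
    induction j with
    | zero => exact ⟨0, by simp, Or.inl rfl⟩
    | succ j ih =>
      obtain ⟨k, hk, -⟩ := ih
      obtain ⟨m, -, hm⟩ := hc k
      have h1 : ((j + 1 : ℕ) : N.HNat) * h < p * a m := by
        push_cast
        rw [add_mul, one_mul]
        exact (add_le_add_left hk h).trans_lt hm
      exact ⟨m, h1.le, Or.inr h1⟩
  obtain ⟨k, hk, hk'⟩ := this p
  have h1 : (p : N.HNat) * a k ≤ p * h := mul_le_mul_of_nonneg_left (hb k) zero_le
  rcases hk' with rfl | hk'
  · obtain ⟨m, -, hm⟩ := hc 0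
    simp at hm
  · exact hk'.not_ge h1

theorem cardLE_iUnion_lt {E : ℕ → Set (N.Obj σ)} {e : ℕ → N.HNat} (h : ∀ n, CardLE (E n) (e n))
    (n : ℕ) : CardLE (⋃ i < n, E i) (∑ i ∈ Finset.range n, e i) := by
  induction n with
  | zero =>
    simp only [not_lt_zero, Set.iUnion_of_empty, Set.iUnion_empty, Finset.range_zero,
      Finset.sum_empty]
    exact (h 0).exists_hasCard.choose_spec.2.exists_subset (x := 0) zero_le |>.choose_spec.2.cardLE.mono
      isInternal_empty (Set.empty_subset _) le_rfl
  | succ n ih => rw [Set.biUnion_lt_succ, Finset.sum_range_succ]; exact ih.union (h n)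

/-- If the `i`-th term is at most the fraction `1 / (p * 2 ^ (i + 1))` of `h`, then the sum is at
most the fraction `1 / p`. -/
theorem mul_sum_le {p : ℕ} {h : N.HNat} {e : ℕ → N.HNat}
    (he : ∀ i, ((p * 2 ^ (i + 1) : ℕ) : N.HNat) * e i ≤ h) (n : ℕ) :
    p * ∑ i ∈ Finset.range n, e i ≤ h := by
  -- The inductive form of `p * ∑ ≤ (1 - 2⁻ⁿ) h`, with denominators cleared and the subtraction
  -- moved to the left.
  have key : ∀ n, ((2 ^ n : ℕ) : N.HNat) * (p * ∑ i ∈ Finset.range n, e i) + h ≤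
      ((2 ^ n : ℕ) : N.HNat) * h := by
    intro n
    induction n with
    | zero => simp
    | succ n ih =>
      rw [Finset.sum_range_succ]
      have h1 := he n
      calc ((2 ^ (n + 1) : ℕ) : N.HNat) * (p * (∑ i ∈ Finset.range n, e i + e n)) + h
          = 2 * (((2 ^ n : ℕ) : N.HNat) * (p * ∑ i ∈ Finset.range n, e i)) +
            ((p * 2 ^ (n + 1) : ℕ) : N.HNat) * e n + h := by push_cast; ring
        _ ≤ 2 * (((2 ^ n : ℕ) : N.HNat) * (p * ∑ i ∈ Finset.range n, e i)) + h + h := by gcongr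
        _ = 2 * (((2 ^ n : ℕ) : N.HNat) * (p * ∑ i ∈ Finset.range n, e i) + h) := by ring
        _ ≤ 2 * (((2 ^ n : ℕ) : N.HNat) * h) := by gcongr
        _ = ((2 ^ (n + 1) : ℕ) : N.HNat) * h := by push_cast; ring
  have h1 : ((2 ^ n : ℕ) : N.HNat) * (p * ∑ i ∈ Finset.range n, e i) ≤
      ((2 ^ n : ℕ) : N.HNat) * h := le_self_add.trans (key n)
  exact le_of_mul_le_mul_left h1 (by positivity)

/-- Approximation of Borel sets by internal sets inside a hyperfinite set. -/
theorem IsBorel.exists_approx {X : Set (N.Obj σ)} (hX : N.IsBorel X) {H : Set (N.Obj σ)}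
    {h : N.HNat} (hH : HasCard H h) (n : ℕ) (hn : 0 < n) : ∃ A B e, IsInternal A ∧ IsInternal B ∧
      A ⊆ X ∩ H ∧ X ∩ H ⊆ B ∧ B ⊆ H ∧ CardLE (B \ A) e ∧ n * e ≤ h := by
  revert n
  refine IsBorel.induction (P := fun X => ∀ n : ℕ, 0 < n → ∃ A B e, IsInternal A ∧ IsInternal B ∧
      A ⊆ X ∩ H ∧ X ∩ H ⊆ B ∧ B ⊆ H ∧ CardLE (B \ A) e ∧ n * e ≤ h) ?_ ?_ ?_ hX
  · intro S hS n _
    have hSH := hS.inter hH.isInternal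
    refine ⟨S ∩ H, S ∩ H, 0, hSH, hSH, subset_rfl, subset_rfl, Set.inter_subset_right, ?_, by simp⟩
    rw [Set.sdiff_self]
    have := (hH.diff hH subset_rfl).cardLE
    rwa [Set.sdiff_self, tsub_self] at this
  · intro S hS n hn
    obtain ⟨A, B, e, hA, hB, h1, h2, h3, h4, h5⟩ := hS n hn
    refine ⟨H \ B, H \ A, e, hH.isInternal.diff hB, hH.isInternal.diff hA, ?_, ?_,
      Set.sdiff_subset, ?_, h5⟩
    · exact fun x hx => ⟨fun hxS => hx.2 (h2 ⟨hxS, hx.1⟩), hx.1⟩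
    · exact fun x hx => ⟨hx.2, fun hxA => hx.1 (h1 hxA).1⟩
    · convert h4 using 1
      ext x
      constructor
      · rintro ⟨⟨hxH, hxA⟩, hx⟩
        exact ⟨by_contra fun hxB => hx ⟨hxH, hxB⟩, hxA⟩
      · rintro ⟨hxB, hxA⟩
        exact ⟨⟨h3 hxB, hxA⟩, fun hx => hx.2 hxB⟩
  · intro S hS n hn
    -- Half of the error budget `h / n` is spent on the gaps `B i \ A i`, whose sizes sum to at most
    -- `h / (2n)`. The other half pays for replacing the infinite union of the `A i` by the finite
    -- one up to `k`.
    choose A B e hA hB h1 h2 h3 h4 h5 using fun i => hS i ((2 * n) * 2 ^ (i + 1)) (by positivity)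
    have hAH : ∀ m, (⋃ i < m, A i) ⊆ H := fun m =>
      Set.iUnion₂_subset fun i _ => (h1 i).trans Set.inter_subset_right
    have hAint := isInternal_iUnion_lt hA
    choose a ha ha' using fun m =>
      (hH.cardLE.mono (hAint m) (hAH m) le_rfl).exists_hasCard
    have hmono : ∀ ⦃k m : ℕ⦄, k ≤ m → (⋃ i < k, A i) ⊆ ⋃ i < m, A i := fun k m hkm =>
      Set.biUnion_subset_biUnion_left fun i hi => lt_of_lt_of_le hi hkm
    obtain ⟨k, hk⟩ := exists_forall_mul_le ha (2 * n)
    obtain ⟨q, hq⟩ := exists_div h hn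
    obtain ⟨C, hC, hCH, hEC, hcard⟩ := exists_cover_of_forall hB (hAint k) hH.isInternal h3
      (d := q) (fun m => by
        have hle : (⋃ i < m, B i) \ (⋃ i < k, A i) ⊆
            ((⋃ i < max m k, A i) \ ⋃ i < k, A i) ∪ ⋃ i < m, B i \ A i := by
          rintro x ⟨hx, hx'⟩
          obtain ⟨i, hi, hxi⟩ := Set.mem_iUnion₂.1 hx
          by_cases hxA : x ∈ A i
          · exact Or.inl ⟨Set.mem_iUnion₂.2 ⟨i, lt_of_lt_of_le hi (le_max_left _ _), hxA⟩, hx'⟩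
          · exact Or.inr (Set.mem_iUnion₂.2 ⟨i, hi, hxi, hxA⟩)
        have hc1 := (ha' k).diff (ha' (max m k)) (hmono (le_max_right _ _))
        have hc2 := cardLE_iUnion_lt h4 m
        refine (hc1.cardLE.union hc2).mono ((isInternal_iUnion_lt hB m).diff (hAint k)) hle ?_
        rw [← hq]
        have e1 : ((2 * n : ℕ) : N.HNat) * (a (max m k) - a k) ≤ h := by
          rw [mul_tsub, tsub_le_iff_left]
          exact hk _ (le_max_right _ _)
        have e2 := mul_sum_le h5 m
        have e3 : 2 * (n * (a (max m k) - a k + ∑ i ∈ Finset.range m, e i)) ≤ 2 * h := by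
          calc _ = ((2 * n : ℕ) : N.HNat) * (a (max m k) - a k) +
                ((2 * n : ℕ) : N.HNat) * ∑ i ∈ Finset.range m, e i := by push_cast; ring
            _ ≤ h + h := add_le_add e1 e2
            _ = 2 * h := by ring
        exact le_of_mul_le_mul_left e3 (by positivity))
    refine ⟨_, C, q, hAint k, hC, ?_, ?_, hCH, hcard, (hq q).2 le_rfl⟩
    · refine Set.iUnion₂_subset fun i _ => (h1 i).trans ?_
      exact Set.inter_subset_inter_left _ (Set.subset_iUnion S i)
    · rintro x ⟨hx, hxH⟩
      obtain ⟨i, hi⟩ := Set.mem_iUnion.1 hx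
      exact hEC i (h2 i ⟨hi, hxH⟩)

/-- A Borel set without internal subsets of more than `d` elements is covered by an internal set
with not much more than `d` elements. -/
theorem IsBorel.exists_cover {X : Set (N.Obj σ)} (hX : N.IsBorel X) {d : N.HNat}
    (h : ∀ Y ⊆ X, IsInternal Y → CardLE Y d) {n : ℕ} (hn : 0 < n) :
    ∃ C e, X ⊆ C ∧ CardLE C e ∧ n * e ≤ (n + 1) * d := by
  -- In the first case each covering set has at most `d` elements, so `X` can be approximated inside
  -- it. In the last case every `D n` has a subset of size `d + 1`, and saturation puts one such set
  -- inside `X`, which is excluded.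
  rcases hX.cover_or_exists_iInter_subset (fun E => CardLE E d) with
    ⟨E, hE, hEd, hXE⟩ | rfl | ⟨D, hD, hanti, hDd, hDX⟩
  · choose f hf hf' using fun i => (hEd i).exists_hasCard
    -- Finite unions of the `A i` are internal subsets of `X`, so have at most `d` elements however
    -- many are taken; the weights `2 ^ (i + 1)` keep the total of the gaps below `d / n`.
    choose A B e hA hB h1 h2 h3 h4 h5 using fun i => hX.exists_approx (hf' i) (n * 2 ^ (i + 1))
      (by positivity)
    obtain ⟨q, hq⟩ := exists_div d hn
    obtain ⟨C, hC, -, hBC, hcard⟩ := exists_cover_of_forall hB isInternal_empty isInternal_univ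
      (fun _ => Set.subset_univ _) (d := d + q) (fun m => by
        rw [Set.sdiff_empty]
        have hle : (⋃ i < m, B i) ⊆ (⋃ i < m, A i) ∪ ⋃ i < m, B i \ A i := by
          intro x hx
          obtain ⟨i, hi, hxi⟩ := Set.mem_iUnion₂.1 hx
          by_cases hxA : x ∈ A i
          · exact Or.inl (Set.mem_iUnion₂.2 ⟨i, hi, hxA⟩)
          · exact Or.inr (Set.mem_iUnion₂.2 ⟨i, hi, hxi, hxA⟩)
        have hc1 := h _ (Set.iUnion₂_subset fun i (_ : i < m) => (h1 i).trans Set.inter_subset_left)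
          (isInternal_iUnion_lt hA m)
        refine (hc1.union (cardLE_iUnion_lt h4 m)).mono (isInternal_iUnion_lt hB m) hle ?_
        gcongr
        rw [← hq]
        exact mul_sum_le (fun i => (h5 i).trans (hf i)) m)
    rw [Set.sdiff_empty] at hcard
    refine ⟨C, _, fun x hx => ?_, hcard, ?_⟩
    · obtain ⟨i, hi⟩ := Set.mem_iUnion.1 (hXE hx)
      exact hBC i (h2 i ⟨hx, hi⟩)
    · rw [mul_add, add_mul, one_mul]
      gcongr
      exact (hq q).2 le_rfl
  · exact ⟨∅, d, subset_rfl, h ∅ subset_rfl isInternal_empty,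
      mul_le_mul_of_nonneg_right le_self_add zero_le⟩
  · obtain ⟨T, hT, hT'⟩ := exists_hasCard_subset_iInter hD hanti
      (fun n => exists_hasCard_of_not_cardLE (hD n) (hDd n))
    have := hT'.le_of_subset (h T (hT.trans hDX) hT'.isInternal) subset_rfl
    exact absurd this (lt_add_one d).not_ge

end NonstandardUniverse

/-! ### Piecewise internal injections -/

namespace NonstandardUniverse

open FinType TypedStructure Filter

variable {N : NonstandardUniverse.{u}} {σ τ ρ : FinType}

/-- Injectivity makes images commute with complements relative to the full image, which is internal;
unions are automatic. So the induction over Borel sets goes through. -/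
theorem IsBorel.relImage {R : Set (N.Obj (prod σ τ))} (hR : IsInternal R) (hu : BiUnique R)
    {B : Set (N.Obj σ)} (hB : N.IsBorel B) : N.IsBorel (relImage R B) := by
  refine IsBorel.induction (P := fun B => N.IsBorel (NonstandardUniverse.relImage R B))
    (fun S hS => (hR.relImage hS).isBorel) ?_ ?_ hB
  · intro S hS
    convert (hR.relImage isInternal_univ).isBorel.diff hS using 1
    ext y
    constructor
    · rintro ⟨x, hx, hxy⟩
      refine ⟨⟨x, trivial, hxy⟩, ?_⟩
      rintro ⟨x', hx', hxy'⟩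
      obtain rfl := hu.2 _ _ _ hxy hxy'
      exact hx hx'
    · rintro ⟨⟨x, -, hxy⟩, h⟩
      exact ⟨x, fun hx => h ⟨x, hx, hxy⟩, hxy⟩
  · intro S hS
    convert IsBorel.iUnion hS using 1
    ext y
    simp only [NonstandardUniverse.relImage, Set.mem_iUnion, Set.mem_ofPred_eq]
    constructor
    · rintro ⟨x, ⟨i, hi⟩, h⟩
      exact ⟨i, x, hi, h⟩
    · rintro ⟨i, x, hi, h⟩
      exact ⟨x, ⟨i, hi⟩, h⟩

theorem IsBorel.preimage_fst {B : Set (N.Obj σ)} (hB : N.IsBorel B) :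
    N.IsBorel {p : N.Obj (prod σ τ) | fst p ∈ B} := by
  refine IsBorel.induction (P := fun B => N.IsBorel {p : N.Obj (prod σ τ) | fst p ∈ B})
    (fun S hS => hS.preimage_fst.isBorel) (fun S hS => hS.compl) (fun S hS => ?_) hB
  convert IsBorel.iUnion hS using 1
  ext p
  simp

/-- A relation on the hypernatural numbers that is a countable union of Borel restrictions of
internal relations that are functional in both directions. -/
def PiecewiseInternal (G : Set (N.Obj (prod nat nat))) : Prop :=
  ∃ (B : ℕ → Set N.HNat) (F : ℕ → Set (N.Obj (prod nat nat))), (∀ n, N.IsBorel (B n)) ∧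
    (∀ n, IsInternal (F n)) ∧ (∀ n, BiUnique (F n)) ∧
    ∀ x y, N.pair x y ∈ G ↔ ∃ n, x ∈ B n ∧ N.pair x y ∈ F n

theorem set_ext_pair {R Q : Set (N.Obj (prod σ τ))} (h : ∀ x y, N.pair x y ∈ R ↔ N.pair x y ∈ Q) :
    R = Q := by
  ext p
  obtain ⟨x, y, rfl⟩ := N.exists_pair p
  exact h x y

theorem PiecewiseInternal.isBorel {G : Set (N.Obj (prod nat nat))} (h : PiecewiseInternal G) :
    N.IsBorel G := by
  obtain ⟨B, F, hB, hF, hu, hG⟩ := h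
  have : G = ⋃ n, {p : N.Obj (prod nat nat) | fst p ∈ B n} ∩ F n :=
    set_ext_pair fun x y => by simp [hG]
  rw [this]
  exact IsBorel.iUnion fun n => (hB n).preimage_fst.inter (hF n).isBorel

/-- The reason for working with piecewise internal graphs: Borel images are Borel, as the
Schröder–Bernstein construction requires. -/
theorem PiecewiseInternal.isBorel_relImage {G : Set (N.Obj (prod nat nat))}
    (h : PiecewiseInternal G) {A : Set N.HNat} (hA : N.IsBorel A) : N.IsBorel (relImage G A) := by
  obtain ⟨B, F, hB, hF, hu, hG⟩ := h
  have : relImage G A = ⋃ n, relImage (F n) (A ∩ B n) := by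
    ext y
    simp only [relImage, Set.mem_ofPred_eq, Set.mem_iUnion, hG, Set.mem_inter_iff]
    constructor
    · rintro ⟨x, hx, n, hn, h⟩
      exact ⟨n, x, ⟨hx, hn⟩, h⟩
    · rintro ⟨n, x, ⟨hx, hn⟩, h⟩
      exact ⟨x, hx, n, hn, h⟩
  rw [this]
  exact IsBorel.iUnion fun n => IsBorel.relImage (hF n) (hu n) (hA.inter (hB n))

theorem PiecewiseInternal.relInv {G : Set (N.Obj (prod nat nat))} (h : PiecewiseInternal G) :
    PiecewiseInternal (relInv G) := by
  obtain ⟨B, F, hB, hF, hu, hG⟩ := h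
  refine ⟨fun n => relImage (F n) (B n), fun n => NonstandardUniverse.relInv (F n),
    fun n => IsBorel.relImage (hF n) (hu n) (hB n), fun n => (hF n).relInv,
    fun n => (hu n).relInv, fun y x => ?_⟩
  simp only [pair_mem_relInv, hG]
  refine exists_congr fun n => ⟨fun h => ⟨⟨x, h.1, h.2⟩, h.2⟩, ?_⟩
  rintro ⟨⟨x', hx', h⟩, h'⟩
  obtain rfl := (hu n).2 _ _ _ h h'
  exact ⟨hx', h'⟩

theorem PiecewiseInternal.iUnion {G : ℕ → Set (N.Obj (prod nat nat))}
    (h : ∀ n, PiecewiseInternal (G n)) : PiecewiseInternal (⋃ n, G n) := by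
  choose B F hB hF hu hG using h
  refine ⟨fun n => B n.unpair.1 n.unpair.2, fun n => F n.unpair.1 n.unpair.2, fun n => hB _ _,
    fun n => hF _ _, fun n => hu _ _, fun x y => ?_⟩
  simp only [Set.mem_iUnion, hG]
  constructor
  · rintro ⟨i, j, h⟩
    exact ⟨Nat.pair i j, by simpa using h⟩
  · rintro ⟨n, h⟩
    exact ⟨_, _, h⟩

theorem PiecewiseInternal.union {G H : Set (N.Obj (prod nat nat))} (hG : PiecewiseInternal G)
    (hH : PiecewiseInternal H) : PiecewiseInternal (G ∪ H) := by
  convert PiecewiseInternal.iUnion (G := fun n => if n = 0 then G else H)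
    (fun n => by split_ifs <;> assumption) using 1
  ext p
  simp only [Set.mem_union, Set.mem_iUnion]
  constructor
  · rintro (h | h)
    · exact ⟨0, by simpa using h⟩
    · exact ⟨1, by simpa using h⟩
  · rintro ⟨n, h⟩
    split_ifs at h
    · exact Or.inl h
    · exact Or.inr h

theorem PiecewiseInternal.restrict {G : Set (N.Obj (prod nat nat))} (hG : PiecewiseInternal G)
    {A : Set N.HNat} (hA : N.IsBorel A) : PiecewiseInternal (G ∩ {p | fst p ∈ A}) := by
  obtain ⟨B, F, hB, hF, hu, hG⟩ := hG
  refine ⟨fun n => B n ∩ A, F, fun n => (hB n).inter hA, hF, hu, fun x y => ?_⟩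
  simp only [Set.mem_inter_iff, hG, Set.mem_ofPred_eq, fst_pair]
  constructor
  · rintro ⟨⟨n, h1, h2⟩, h3⟩
    exact ⟨n, ⟨h1, h3⟩, h2⟩
  · rintro ⟨n, ⟨h1, h3⟩, h2⟩
    exact ⟨⟨n, h1, h2⟩, h3⟩

theorem IsInternal.piecewiseInternal {F : Set (N.Obj (prod nat nat))} (hF : IsInternal F)
    (hu : BiUnique F) : PiecewiseInternal F :=
  ⟨fun _ => Set.univ, fun _ => F, fun _ => isInternal_univ.isBorel, fun _ => hF, fun _ => hu,
    fun x y => by simp⟩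

/-- Composites of internal pieces are internal. The Borel restriction on the middle variable is
pulled back to the first one along the inverse of the first piece. -/
theorem PiecewiseInternal.relComp {G H : Set (N.Obj (prod nat nat))} (hG : PiecewiseInternal G)
    (hH : PiecewiseInternal H) : PiecewiseInternal (relComp G H) := by
  obtain ⟨B, F, hB, hF, hu, hG⟩ := hG
  obtain ⟨B', F', hB', hF', hu', hH⟩ := hH
  have : NonstandardUniverse.relComp G H = ⋃ n, ⋃ m, (NonstandardUniverse.relComp (F n) (F' m) ∩
      {p : N.Obj (prod nat nat) | fst p ∈ B n ∩ relImage (NonstandardUniverse.relInv (F n)) (B' m)}) := by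
    refine set_ext_pair fun x z => ?_
    simp only [pair_mem_relComp, hG, hH, Set.mem_iUnion, Set.mem_inter_iff, Set.mem_ofPred_eq,
      fst_pair, relImage, pair_mem_relInv]
    constructor
    · rintro ⟨y, ⟨n, h1, h2⟩, m, h3, h4⟩
      exact ⟨n, m, ⟨y, h2, h4⟩, h1, y, h3, h2⟩
    · rintro ⟨n, m, ⟨y, h2, h4⟩, h1, y', h3, h2'⟩
      obtain rfl := (hu n).1 _ _ _ h2 h2'
      exact ⟨y, ⟨n, h1, h2⟩, m, h3, h4⟩
  rw [this]
  refine .iUnion fun n => .iUnion fun m => PiecewiseInternal.restrict ?_ ?_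
  · exact ((hF n).relComp (hF' m)).piecewiseInternal ((hu n).relComp (hu' m))
  · exact (hB n).inter (IsBorel.relImage (hF n).relInv (hu n).relInv (hB' m))

/-- There is a piecewise internal injection of `X` into `Y`. -/
def PiecewiseLE (X Y : Set N.HNat) : Prop :=
  ∃ G : Set (N.Obj (prod nat nat)), PiecewiseInternal G ∧ BiUnique G ∧
    (∀ x ∈ X, ∃ y, N.pair x y ∈ G) ∧ ∀ x y, N.pair x y ∈ G → x ∈ X ∧ y ∈ Y

theorem PiecewiseLE.trans {X Y Z : Set N.HNat} (h : PiecewiseLE X Y) (h' : PiecewiseLE Y Z) :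
    PiecewiseLE X Z := by
  obtain ⟨G, hG, hu, ht, hm⟩ := h
  obtain ⟨H, hH, hu', ht', hm'⟩ := h'
  refine ⟨relComp G H, hG.relComp hH, hu.relComp hu', fun x hx => ?_, fun x z => ?_⟩
  · obtain ⟨y, hy⟩ := ht x hx
    obtain ⟨z, hz⟩ := ht' y (hm _ _ hy).2
    exact ⟨z, by simpa using ⟨y, hy, hz⟩⟩
  · simp only [pair_mem_relComp]
    rintro ⟨y, h1, h2⟩
    exact ⟨(hm _ _ h1).1, (hm' _ _ h2).2⟩

/-- Restriction of a piecewise internal partial injection. -/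
theorem PiecewiseInternal.piecewiseLE {G : Set (N.Obj (prod nat nat))} (hG : PiecewiseInternal G)
    {X Y : Set N.HNat} (hX : N.IsBorel X)
    (hf : ∀ x ∈ X, ∀ y y', N.pair x y ∈ G → N.pair x y' ∈ G → y = y')
    (hi : ∀ x ∈ X, ∀ x' ∈ X, ∀ y, N.pair x y ∈ G → N.pair x' y ∈ G → x = x')
    (ht : ∀ x ∈ X, ∃ y, N.pair x y ∈ G) (hm : ∀ x ∈ X, ∀ y, N.pair x y ∈ G → y ∈ Y) :
    PiecewiseLE X Y := by
  refine ⟨_, hG.restrict hX, ⟨fun x y y' h h' => ?_, fun x x' y h h' => ?_⟩, fun x hx => ?_,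
    fun x y h => ?_⟩
  · exact hf x (by simpa using h.2) _ _ h.1 h'.1
  · exact hi x (by simpa using h.2) x' (by simpa using h'.2) _ h.1 h'.1
  · obtain ⟨y, hy⟩ := ht x hx
    exact ⟨y, hy, by simpa using hx⟩
  · have hx : x ∈ X := by simpa using h.2
    exact ⟨hx, hm x hx y h.1⟩

theorem IsBorel.piecewiseLE_of_subset {X Y : Set N.HNat} (hX : N.IsBorel X) (h : X ⊆ Y) :
    PiecewiseLE X Y := by
  refine (isInternal_diagonal.piecewiseInternal biUnique_diagonal).piecewiseLE hX
    (fun x _ => biUnique_diagonal.1 x) (fun x _ x' _ => biUnique_diagonal.2 x x')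
    (fun x _ => ⟨x, by simp⟩) (fun x hx y hxy => ?_)
  simp only [Set.mem_ofPred_eq, fst_pair, snd_pair] at hxy
  exact hxy ▸ h hx

theorem borelLE_iff {X Y : Set N.HNat} : N.BorelLE X Y ↔ ∃ G : Set (N.Obj (prod nat nat)),
    N.IsBorel G ∧ BiUnique G ∧ (∀ x ∈ X, ∃ y, N.pair x y ∈ G) ∧
      ∀ x y, N.pair x y ∈ G → x ∈ X ∧ y ∈ Y := by
  constructor
  · rintro ⟨f, hm, hi, hb⟩
    refine ⟨_, hb, ⟨?_, ?_⟩, fun x hx => ⟨f x, x, hx, rfl⟩, ?_⟩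
    · rintro x y y' ⟨a, ha, h⟩ ⟨b, hb, h'⟩
      rw [pair_inj] at h h'
      rw [h.2, h'.2, ← h.1, ← h'.1]
    · rintro x x' y ⟨a, ha, h⟩ ⟨b, hb, h'⟩
      rw [pair_inj] at h h'
      rw [h.1, h'.1]
      exact hi ha hb (h.2.symm.trans h'.2)
    · rintro x y ⟨a, ha, h⟩
      rw [pair_inj] at h
      rw [h.1, h.2]
      exact ⟨ha, hm ha⟩
  · rintro ⟨G, hb, hu, ht, hm⟩
    choose! f hf using ht
    refine ⟨f, fun x hx => (hm _ _ (hf x hx)).2, fun x hx x' hx' h => ?_, ?_⟩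
    · have := hf x' hx'
      rw [← h] at this
      exact hu.2 _ _ _ (hf x hx) this
    · convert hb using 1
      ext p
      constructor
      · rintro ⟨x, hx, rfl⟩
        exact hf x hx
      · intro hp
        obtain ⟨x, y, rfl⟩ := N.exists_pair p
        have hx := (hm x y hp).1
        exact ⟨x, hx, by rw [hu.1 _ _ _ hp (hf x hx)]⟩

theorem PiecewiseLE.borelLE {X Y : Set N.HNat} (h : PiecewiseLE X Y) : N.BorelLE X Y := by
  obtain ⟨G, hG, h⟩ := h
  exact borelLE_iff.2 ⟨G, hG.isBorel, h⟩

/-- Composition of an internal relation with a Borel one. -/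
theorem IsBorel.relComp_left {F : Set (N.Obj (prod σ τ))} (hF : IsInternal F) (hu : BiUnique F)
    {Γ : Set (N.Obj (prod τ ρ))} (hΓ : N.IsBorel Γ) : N.IsBorel (relComp F Γ) := by
  let f : (prod (prod τ ρ) (prod σ ρ)).Carrier → (prod σ τ).Carrier :=
    fun p : (τ.Carrier × ρ.Carrier) × (σ.Carrier × ρ.Carrier) => (p.2.1, p.1.1)
  let g : (prod (prod τ ρ) (prod σ ρ)).Carrier → (prod ρ ρ).Carrier :=
    fun p : (τ.Carrier × ρ.Carrier) × (σ.Carrier × ρ.Carrier) => (p.1.2, p.2.2)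
  have hf : ∀ y z x z', N.starFun f (N.pair (N.pair y z) (N.pair x z')) = N.pair x y := by
    intro y z x z'
    obtain ⟨ρ', t, a, b, c, d, rfl, rfl, rfl, rfl⟩ := N.exists_starFun₄ y z x z'
    rw [N.pair_starFun a b, N.pair_starFun c d]
    exact (congrArg (N.starFun f) (N.pair_starFun (τ := prod τ ρ) (ρ := prod σ ρ) _ _ t)).trans
      ((N.starFun_starFun f _ t).trans (N.pair_starFun c a t).symm)
  have hg : ∀ y z x z', N.starFun g (N.pair (N.pair y z) (N.pair x z')) = N.pair z z' := by
    intro y z x z'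
    obtain ⟨ρ', t, a, b, c, d, rfl, rfl, rfl, rfl⟩ := N.exists_starFun₄ y z x z'
    rw [N.pair_starFun a b, N.pair_starFun c d]
    exact (congrArg (N.starFun g) (N.pair_starFun (τ := prod τ ρ) (ρ := prod σ ρ) _ _ t)).trans
      ((N.starFun_starFun g _ t).trans (N.pair_starFun b d t).symm)
  -- `R` moves `(y, z)` to `(x, z)` whenever `F` relates `x` to `y`. It is internal and injective,
  -- and the image of `Γ` under it is the composite, so no projection of a Borel set is taken.
  let R : Set (N.Obj (prod (prod τ ρ) (prod σ ρ))) :=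
    N.starFun f ⁻¹' F ∩ N.starFun g ⁻¹' {p | fst p = snd p}
  have hR : IsInternal R := (hF.preimage f).inter (isInternal_diagonal.preimage g)
  have hmem : ∀ y z x z', N.pair (N.pair y z) (N.pair x z') ∈ R ↔ N.pair x y ∈ F ∧ z = z' := by
    intro y z x z'
    simp only [R, Set.mem_inter_iff, Set.mem_preimage, hf, hg, Set.mem_ofPred_eq, fst_pair, snd_pair]
  have hRu : BiUnique R := by
    constructor
    · intro p q q'
      obtain ⟨y, z, rfl⟩ := N.exists_pair p
      obtain ⟨x, z₁, rfl⟩ := N.exists_pair q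
      obtain ⟨x', z₂, rfl⟩ := N.exists_pair q'
      rw [hmem, hmem, pair_inj]
      rintro ⟨h, rfl⟩ ⟨h', rfl⟩
      exact ⟨hu.2 _ _ _ h h', rfl⟩
    · intro p q q'
      obtain ⟨y, z, rfl⟩ := N.exists_pair p
      obtain ⟨x, z₁, rfl⟩ := N.exists_pair q
      obtain ⟨x', z₂, rfl⟩ := N.exists_pair q'
      rw [hmem, hmem, pair_inj]
      rintro ⟨h, rfl⟩ ⟨h', rfl⟩
      exact ⟨hu.1 _ _ _ h h', rfl⟩
  convert IsBorel.relImage hR hRu hΓ using 1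
  refine set_ext_pair fun x z => ?_
  simp only [pair_mem_relComp, NonstandardUniverse.relImage, Set.mem_ofPred_eq]
  constructor
  · rintro ⟨y, h1, h2⟩
    exact ⟨_, h2, (hmem _ _ _ _).2 ⟨h1, rfl⟩⟩
  · rintro ⟨p, hp, h⟩
    obtain ⟨y, z', rfl⟩ := N.exists_pair p
    obtain ⟨h1, rfl⟩ := (hmem _ _ _ _).1 h
    exact ⟨y, h1, hp⟩

theorem IsBorel.relInv {Γ : Set (N.Obj (prod σ τ))} (hΓ : N.IsBorel Γ) : N.IsBorel (relInv Γ) := by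
  refine IsBorel.induction (P := fun Γ => N.IsBorel (NonstandardUniverse.relInv Γ))
    (fun S hS => hS.relInv.isBorel) (fun S hS => hS.compl) (fun S hS => ?_) hΓ
  convert IsBorel.iUnion hS using 1
  ext p
  simp [NonstandardUniverse.relInv]

/-- Composition with an arbitrary Borel injection is allowed as long as the other factor is
piecewise internal, because on each piece it is an image under an internal injection. -/
theorem PiecewiseLE.trans_borelLE {X Y Z : Set N.HNat} (h : PiecewiseLE X Y)
    (h' : N.BorelLE Y Z) : N.BorelLE X Z := by
  obtain ⟨G, ⟨B, F, hB, hF, hu, hG⟩, huG, ht, hm⟩ := h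
  rw [borelLE_iff] at *
  obtain ⟨Γ, hΓ, huΓ, htΓ, hmΓ⟩ := h'
  refine ⟨relComp G Γ, ?_, huG.relComp huΓ, fun x hx => ?_, fun x z => ?_⟩
  · have : relComp G Γ = ⋃ n, {p : N.Obj (prod nat nat) | fst p ∈ B n} ∩ relComp (F n) Γ := by
      refine set_ext_pair fun x z => ?_
      simp only [pair_mem_relComp, hG, Set.mem_iUnion, Set.mem_inter_iff, Set.mem_ofPred_eq,
        fst_pair]
      constructor
      · rintro ⟨y, ⟨n, h1, h2⟩, h3⟩
        exact ⟨n, h1, y, h2, h3⟩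
      · rintro ⟨n, h1, y, h2, h3⟩
        exact ⟨y, ⟨n, h1, h2⟩, h3⟩
    rw [this]
    exact IsBorel.iUnion fun n => (hB n).preimage_fst.inter
      (IsBorel.relComp_left (hF n) (hu n) hΓ)
  · obtain ⟨y, hy⟩ := ht x hx
    obtain ⟨z, hz⟩ := htΓ y (hm _ _ hy).2
    exact ⟨z, by simpa using ⟨y, hy, hz⟩⟩
  · simp only [pair_mem_relComp]
    rintro ⟨y, h1, h2⟩
    exact ⟨(hm _ _ h1).1, (hmΓ _ _ h2).2⟩

theorem BorelLE.trans_piecewiseLE {X Y Z : Set N.HNat} (h : N.BorelLE X Y)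
    (h' : PiecewiseLE Y Z) : N.BorelLE X Z := by
  obtain ⟨G, ⟨B, F, hB, hF, hu, hG⟩, huG, ht, hm⟩ := h'
  rw [borelLE_iff] at *
  obtain ⟨Γ, hΓ, huΓ, htΓ, hmΓ⟩ := h
  refine ⟨relComp Γ G, ?_, huΓ.relComp huG, fun x hx => ?_, fun x z => ?_⟩
  · have : relComp Γ G = ⋃ n, relInv (relComp (relInv (F n))
        (relInv (Γ ∩ relInv {p : N.Obj (prod nat nat) | fst p ∈ B n}))) := by
      refine set_ext_pair fun x z => ?_
      simp only [pair_mem_relComp, hG, Set.mem_iUnion, Set.mem_inter_iff, Set.mem_ofPred_eq,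
        fst_pair, pair_mem_relInv]
      constructor
      · rintro ⟨y, h3, ⟨n, h1, h2⟩⟩
        exact ⟨n, y, h2, h3, h1⟩
      · rintro ⟨n, y, h2, h3, h1⟩
        exact ⟨y, h3, ⟨n, h1, h2⟩⟩
    rw [this]
    exact IsBorel.iUnion fun n => (IsBorel.relComp_left (hF n).relInv (hu n).relInv
      (hΓ.inter (hB n).preimage_fst.relInv).relInv).relInv
  · obtain ⟨y, hy⟩ := htΓ x hx
    obtain ⟨z, hz⟩ := ht y (hmΓ _ _ hy).2
    exact ⟨z, by simpa using ⟨y, hy, hz⟩⟩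
  · simp only [pair_mem_relComp]
    rintro ⟨y, h1, h2⟩
    exact ⟨(hmΓ _ _ h1).1, (hm _ _ h2).2⟩

/-- The Schröder–Bernstein theorem for piecewise internal injections. -/
theorem PiecewiseLE.borelBijective {X Y : Set N.HNat} (hX : N.IsBorel X) (hY : N.IsBorel Y)
    (h : PiecewiseLE X Y) (h' : PiecewiseLE Y X) : N.BorelBijective X Y := by
  obtain ⟨G, hG, hu, ht, hm⟩ := h
  obtain ⟨H, hH, hu', ht', hm'⟩ := h'
  -- The points whose backward orbit stops in `X` outside the range of `H`. The bijection `K`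
  -- follows `G` on these and the inverse of `H` on the rest.
  let A : ℕ → Set N.HNat := fun n => Nat.rec (X \ relImage H Y)
    (fun _ S => relImage H (relImage G S)) n
  have hA0 : A 0 = X \ relImage H Y := rfl
  have hAs : ∀ n, A (n + 1) = relImage H (relImage G (A n)) := fun n => rfl
  have hAb : ∀ n, N.IsBorel (A n) := by
    intro n
    induction n with
    | zero => exact hX.diff (hH.isBorel_relImage hY)
    | succ n ih => exact hH.isBorel_relImage (hG.isBorel_relImage ih)
  let K : Set (N.Obj (prod nat nat)) :=
    (G ∩ {p | fst p ∈ ⋃ n, A n}) ∪ (relInv H ∩ {p | fst p ∈ X \ ⋃ n, A n})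
  have hK : PiecewiseInternal K := (hG.restrict (IsBorel.iUnion hAb)).union
    (hH.relInv.restrict (hX.diff (IsBorel.iUnion hAb)))
  have hKmem : ∀ x y, N.pair x y ∈ K ↔ (N.pair x y ∈ G ∧ x ∈ ⋃ n, A n) ∨
      (N.pair y x ∈ H ∧ x ∉ ⋃ n, A n) := by
    intro x y
    simp only [K, Set.mem_union, Set.mem_inter_iff, pair_mem_relInv, Set.mem_ofPred_eq, fst_pair,
      Set.mem_sdiff]
    refine or_congr Iff.rfl (and_congr_right fun h => ⟨fun h => h.2, fun h' => ⟨(hm' _ _ h).2, h'⟩⟩)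
  have htot : ∀ x ∈ X, ∃ y, N.pair x y ∈ K := by
    intro x hx
    by_cases hxA : x ∈ ⋃ n, A n
    · obtain ⟨y, hy⟩ := ht x hx
      exact ⟨y, (hKmem x y).2 (Or.inl ⟨hy, hxA⟩)⟩
    · have : x ∈ relImage H Y := by
        by_contra hc
        exact hxA (Set.mem_iUnion.2 ⟨0, hx, hc⟩)
      obtain ⟨y, -, hy⟩ := this
      exact ⟨y, (hKmem x y).2 (Or.inr ⟨hy, hxA⟩)⟩
  have hKm : ∀ x y, N.pair x y ∈ K → x ∈ X ∧ y ∈ Y := by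
    intro x y h
    rcases (hKmem x y).1 h with ⟨h, -⟩ | ⟨h, -⟩
    · exact hm _ _ h
    · exact (hm' _ _ h).symm
  have hstep : ∀ {x y x'}, N.pair x y ∈ G → x ∈ ⋃ n, A n → N.pair y x' ∈ H → x' ∈ ⋃ n, A n := by
    intro x y x' h1 h2 h3
    obtain ⟨n, hn⟩ := Set.mem_iUnion.1 h2
    exact Set.mem_iUnion.2 ⟨n + 1, y, ⟨x, hn, h1⟩, h3⟩
  have hKu : BiUnique K := by
    constructor
    · intro x y y' h h'
      rcases (hKmem x y).1 h with ⟨h, hx⟩ | ⟨h, hx⟩ <;> rcases (hKmem x y').1 h' with ⟨h', hx'⟩ | ⟨h', hx'⟩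
      · exact hu.1 _ _ _ h h'
      · exact absurd hx hx'
      · exact absurd hx' hx
      · exact hu'.2 _ _ _ h h'
    · intro x x' y h h'
      rcases (hKmem x y).1 h with ⟨h, hx⟩ | ⟨h, hx⟩ <;> rcases (hKmem x' y).1 h' with ⟨h', hx'⟩ | ⟨h', hx'⟩
      · exact hu.2 _ _ _ h h'
      · exact absurd (hstep h hx h') hx'
      · exact absurd (hstep h' hx' h) hx
      · exact hu'.1 _ _ _ h h'
  have hsurj : ∀ y ∈ Y, ∃ x, N.pair x y ∈ K := by
    intro y hy
    obtain ⟨x', hx'⟩ := ht' y hy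
    by_cases hxA : x' ∈ ⋃ n, A n
    · obtain ⟨n, hn⟩ := Set.mem_iUnion.1 hxA
      cases n with
      | zero => exact absurd ⟨y, hy, hx'⟩ hn.2
      | succ n =>
        obtain ⟨y', ⟨x, hx, h1⟩, h2⟩ := hn
        obtain rfl := hu'.2 _ _ _ hx' h2
        exact ⟨x, (hKmem _ _).2 (Or.inl ⟨h1, Set.mem_iUnion.2 ⟨n, hx⟩⟩)⟩
    · exact ⟨x', (hKmem _ _).2 (Or.inr ⟨hx', hxA⟩)⟩
  choose! f hf using htot
  refine ⟨f, ⟨fun x hx => (hKm _ _ (hf x hx)).2, fun x hx x' hx' h => ?_, fun y hy => ?_⟩, ?_⟩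
  · have := hf x' hx'
    rw [← h] at this
    exact hKu.2 _ _ _ (hf x hx) this
  · obtain ⟨x, hx⟩ := hsurj y hy
    have hxX := (hKm _ _ hx).1
    exact ⟨x, hxX, hKu.1 _ _ _ (hf x hxX) hx⟩
  · convert hK.isBorel using 1
    ext p
    constructor
    · rintro ⟨x, hx, rfl⟩
      exact hf x hx
    · intro hp
      obtain ⟨x, y, rfl⟩ := N.exists_pair p
      have hx := (hKm x y hp).1
      exact ⟨x, hx, by rw [hKu.1 _ _ _ hp (hf x hx)]⟩

end NonstandardUniverse

/-! ### Construction of piecewise internal injections -/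

namespace NonstandardUniverse

open FinType TypedStructure Filter

variable {N : NonstandardUniverse.{u}} {σ τ ρ : FinType}

theorem IsBij.union {R R' : Set (N.Obj (prod σ τ))} {S S' : Set (N.Obj σ)} {T T' : Set (N.Obj τ)}
    (h : IsBij R S T) (h' : IsBij R' S' T') (hS : Disjoint S S') (hT : Disjoint T T') :
    IsBij (R ∪ R') (S ∪ S') (T ∪ T') := by
  refine ⟨?_, ?_, ?_, ?_, ?_, ?_⟩
  · rintro x y (h1 | h1)
    exacts [Or.inl (h.left_mem _ _ h1), Or.inr (h'.left_mem _ _ h1)]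
  · rintro x y (h1 | h1)
    exacts [Or.inl (h.right_mem _ _ h1), Or.inr (h'.right_mem _ _ h1)]
  · rintro x (h1 | h1)
    exacts [(h.exists_right x h1).imp fun _ => Or.inl, (h'.exists_right x h1).imp fun _ => Or.inr]
  · rintro x (h1 | h1)
    exacts [(h.exists_left x h1).imp fun _ => Or.inl, (h'.exists_left x h1).imp fun _ => Or.inr]
  · rintro x y y' (h1 | h1) (h2 | h2)
    · exact h.biUnique.1 _ _ _ h1 h2
    · exact absurd (h'.left_mem _ _ h2) (Set.disjoint_left.1 hS (h.left_mem _ _ h1))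
    · exact absurd (h'.left_mem _ _ h1) (Set.disjoint_left.1 hS (h.left_mem _ _ h2))
    · exact h'.biUnique.1 _ _ _ h1 h2
  · rintro x y y' (h1 | h1) (h2 | h2)
    · exact h.biUnique.2 _ _ _ h1 h2
    · exact absurd (h'.right_mem _ _ h2) (Set.disjoint_left.1 hT (h.right_mem _ _ h1))
    · exact absurd (h'.right_mem _ _ h1) (Set.disjoint_left.1 hT (h.right_mem _ _ h2))
    · exact h'.biUnique.2 _ _ _ h1 h2

theorem IsBij.sdiff {R : Set (N.Obj (prod σ τ))} {S C : Set (N.Obj σ)} {T D : Set (N.Obj τ)}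
    (h : IsBij R S T) (hCD : ∀ x y, N.pair x y ∈ R → (x ∈ C ↔ y ∈ D)) :
    IsBij (R ∩ {p | fst p ∈ Cᶜ}) (S \ C) (T \ D) := by
  refine ⟨?_, ?_, ?_, ?_, ?_, ?_⟩
  · rintro x y ⟨h1, h2⟩
    exact ⟨h.left_mem _ _ h1, by simpa using h2⟩
  · rintro x y ⟨h1, h2⟩
    exact ⟨h.right_mem _ _ h1, by rw [← hCD _ _ h1]; simpa using h2⟩
  · rintro x ⟨h1, h2⟩
    exact (h.exists_right x h1).imp fun y hy => ⟨hy, by simpa using h2⟩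
  · rintro y ⟨h1, h2⟩
    refine (h.exists_left y h1).imp fun x hx => ⟨hx, ?_⟩
    rw [← hCD _ _ hx] at h2
    simpa using h2
  · rintro x y y' ⟨h1, -⟩ ⟨h2, -⟩
    exact h.biUnique.1 _ _ _ h1 h2
  · rintro x y y' ⟨h1, -⟩ ⟨h2, -⟩
    exact h.biUnique.2 _ _ _ h1 h2

theorem IsBij.piecewiseLE {G : Set (N.Obj (prod nat nat))} {S T X Y : Set N.HNat} (h : IsBij G S T)
    (hG : PiecewiseInternal G) (hX : N.IsBorel X) (hXS : X ⊆ S)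
    (hY : ∀ x ∈ X, ∀ y, N.pair x y ∈ G → y ∈ Y) : PiecewiseLE X Y :=
  hG.piecewiseLE hX (fun x _ => h.biUnique.1 x) (fun x _ x' _ => h.biUnique.2 x x')
    (fun x hx => h.exists_right x (hXS hx)) hY

theorem IsBij.iUnion {R : ℕ → Set (N.Obj (prod σ τ))} {S : ℕ → Set (N.Obj σ)}
    {T : ℕ → Set (N.Obj τ)} (h : ∀ n, IsBij (R n) (S n) (T n))
    (hS : ∀ m n, m ≠ n → Disjoint (S m) (S n)) (hT : ∀ m n, m ≠ n → Disjoint (T m) (T n)) :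
    IsBij (⋃ n, R n) (⋃ n, S n) (⋃ n, T n) := by
  simp only [Set.disjoint_left] at hS hT
  refine ⟨?_, ?_, ?_, ?_, ?_, ?_⟩ <;> simp only [Set.mem_iUnion]
  · rintro x y ⟨n, hn⟩
    exact ⟨n, (h n).left_mem _ _ hn⟩
  · rintro x y ⟨n, hn⟩
    exact ⟨n, (h n).right_mem _ _ hn⟩
  · rintro x ⟨n, hn⟩
    exact ((h n).exists_right x hn).imp fun y hy => ⟨n, hy⟩
  · rintro x ⟨n, hn⟩
    exact ((h n).exists_left x hn).imp fun y hy => ⟨n, hy⟩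
  · rintro x y y' ⟨n, hn⟩ ⟨m, hm⟩
    obtain rfl : m = n := by
      by_contra hne
      exact hS _ _ hne ((h m).left_mem _ _ hm) ((h n).left_mem _ _ hn)
    exact (h m).biUnique.1 _ _ _ hn hm
  · rintro x x' y ⟨n, hn⟩ ⟨m, hm⟩
    obtain rfl : m = n := by
      by_contra hne
      exact hT _ _ hne ((h m).right_mem _ _ hm) ((h n).right_mem _ _ hn)
    exact (h m).biUnique.2 _ _ _ hn hm

theorem iUnion_succ_sdiff {α : Type*} {Y : ℕ → Set α} (h0 : Y 0 = ∅) :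
    ⋃ n, (Y (n + 1) \ Y n) = ⋃ n, Y n := by
  refine Set.Subset.antisymm (Set.iUnion_subset fun n x hx => Set.mem_iUnion.2 ⟨n + 1, hx.1⟩) ?_
  intro x hx
  obtain ⟨n, hn⟩ := Set.mem_iUnion.1 hx
  induction n with
  | zero => rw [h0] at hn; exact absurd hn (Set.notMem_empty x)
  | succ n ih =>
    by_cases h : x ∈ Y n
    · exact ih h
    · exact Set.mem_iUnion.2 ⟨n, hn, h⟩

theorem disjoint_succ_sdiff {α : Type*} {Y : ℕ → Set α} (h : Monotone Y) (m n : ℕ) (hmn : m ≠ n) :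
    Disjoint (Y (m + 1) \ Y m) (Y (n + 1) \ Y n) := by
  rw [Set.disjoint_left]
  rintro x ⟨h1, h2⟩ ⟨h3, h4⟩
  rcases lt_or_gt_of_ne hmn with hlt | hlt
  · exact h4 (h (Nat.succ_le_of_lt hlt) h1)
  · exact h2 (h (Nat.succ_le_of_lt hlt) h3)

/-- The union of an increasing sequence of hyperfinite sets is in piecewise internal bijection
with the union of the corresponding initial segments. -/
theorem exists_isBij_iUnion {Y : ℕ → Set N.HNat} {w : ℕ → N.HNat} (hY : Monotone Y)
    (h0 : Y 0 = ∅) (hw : ∀ n, HasCard (Y n) (w n)) :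
    ∃ G, PiecewiseInternal G ∧ IsBij G (⋃ n, Y n) (⋃ n, Set.Iio (w n)) := by
  have hwm : Monotone w := fun m n hmn => (hw m).le_of_subset (hw n).cardLE (hY hmn)
  have hw0 : w 0 = 0 := by
    have h1 := hw 0
    have h2 := h1.diff h1 subset_rfl
    rw [Set.sdiff_self, tsub_self] at h2
    rw [h0] at h1
    exact h1.unique h2
  have hex : ∀ n, ∃ R, IsInternal R ∧
      IsBij R (Y (n + 1) \ Y n) (Set.Iio (w (n + 1)) \ Set.Iio (w n)) := fun n =>
    ((hw n).diff (hw (n + 1)) (hY n.le_succ)).exists_isBij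
      ((hasCard_Iio _).diff (hasCard_Iio _) (Set.Iio_subset_Iio (hwm n.le_succ)))
  choose R hR hbij using hex
  refine ⟨⋃ n, R n, .iUnion fun n => (hR n).piecewiseInternal (hbij n).biUnique, ?_⟩
  rw [← iUnion_succ_sdiff h0, ← iUnion_succ_sdiff (Y := fun n => Set.Iio (w n))]
  · exact IsBij.iUnion hbij (disjoint_succ_sdiff hY)
      (disjoint_succ_sdiff (Y := fun n => Set.Iio (w n)) fun m n hmn => Set.Iio_subset_Iio (hwm hmn))
  · ext x
    simp [hw0]

/-- The finite unions of the cover form an increasing sequence, and the bijection of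
`exists_isBij_iUnion` takes the `n`-th one into an initial segment no longer than the sum of the
first `n` bounds. -/
theorem piecewiseLE_of_subset_iUnion {X U : Set N.HNat} (hX : N.IsBorel X) {E : ℕ → Set N.HNat}
    {e : ℕ → N.HNat} (hE : ∀ n, CardLE (E n) (e n)) (hXE : X ⊆ ⋃ n, E n)
    (hU : ∀ n x, x < ∑ i ∈ Finset.range n, e i → x ∈ U) : PiecewiseLE X U := by
  choose w hw hw' using fun n => (cardLE_iUnion_lt hE n).exists_hasCard
  obtain ⟨G, hG, hbij⟩ := exists_isBij_iUnion (Y := fun n => ⋃ i < n, E i)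
    (fun m n hmn => Set.biUnion_subset_biUnion_left fun i hi => lt_of_lt_of_le hi hmn)
    (by simp) hw'
  refine hbij.piecewiseLE hG hX (fun x hx => ?_) (fun x hx y hxy => ?_)
  · obtain ⟨i, hi⟩ := Set.mem_iUnion.1 (hXE hx)
    exact Set.mem_iUnion.2 ⟨i + 1, Set.mem_iUnion₂.2 ⟨i, i.lt_succ_self, hi⟩⟩
  · obtain ⟨n, hn⟩ := Set.mem_iUnion.1 (hbij.right_mem _ _ hxy)
    exact hU n y (lt_of_lt_of_le hn (hw n))

theorem piecewiseLE_of_iUnion_Iio {X W : Set N.HNat} (hW : N.IsBorel W) {w : ℕ → N.HNat}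
    (hw : Monotone w) (hw0 : w 0 = 0) (hWw : W ⊆ ⋃ n, Set.Iio (w n))
    (hX : ∀ n, ∃ Y ⊆ X, HasCard Y (w n)) : PiecewiseLE W X := by
  have h0 : HasCard (∅ : Set N.HNat) (w 0) := by
    have h1 := hasCard_Iio (N := N) 0
    have h2 := h1.diff h1 subset_rfl
    rwa [Set.sdiff_self, tsub_self, ← hw0] at h2
  -- The given subsets of `X` need not be nested, so each is replaced by an extension of the
  -- previous one inside `X`.
  have hstep : ∀ n (Y : {Y : Set N.HNat // Y ⊆ X ∧ HasCard Y (w n)}),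
      ∃ Y' : {Y : Set N.HNat // Y ⊆ X ∧ HasCard Y (w (n + 1))}, Y.1 ⊆ Y'.1 := by
    rintro n ⟨Y, hY, hY'⟩
    obtain ⟨Z, hZ, hZ'⟩ := hX (n + 1)
    obtain ⟨D, h1, h2, h3⟩ := hY'.exists_between hZ' (hw n.le_succ)
    exact ⟨⟨D, h2.trans (Set.union_subset hY hZ), h3⟩, h1⟩
  choose f hf using hstep
  let Y : (n : ℕ) → {Y : Set N.HNat // Y ⊆ X ∧ HasCard Y (w n)} := fun n =>
    Nat.rec ⟨∅, Set.empty_subset _, h0⟩ (fun n Y => f n Y) n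
  obtain ⟨G, hG, hbij⟩ := exists_isBij_iUnion (Y := fun n => (Y n).1) (w := w)
    (monotone_nat_of_le_succ fun n => hf n (Y n)) rfl (fun n => (Y n).2.2)
  refine hbij.relInv.piecewiseLE hG.relInv hW hWw (fun x hx y hxy => ?_)
  obtain ⟨n, hn⟩ := Set.mem_iUnion.1 (hbij.left_mem _ _ (pair_mem_relInv.1 hxy))
  exact (Y n).2.1 hn

/-- A decreasing sequence of hyperfinite sets is mapped onto a sequence of initial segments by one
internal bijection. -/
theorem exists_isBij_of_antitone {C : ℕ → Set N.HNat} {b : ℕ → N.HNat} (hC : Antitone C)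
    (hb : ∀ n, HasCard (C n) (b n)) :
    ∃ R, IsInternal R ∧ IsBij R (C 0) (Set.Iio (b 0)) ∧
      ∀ n x y, N.pair x y ∈ R → (x ∈ C n ↔ y ∈ Set.Iio (b n)) := by
  have hbm : Antitone b := fun m n hmn => (hb n).le_of_subset (hb m).cardLE (hC hmn)
  -- Finitely many levels are handled by induction: the bijection is kept outside `C n` and rebuilt
  -- on `C (n + 1)` and on `C n \ C (n + 1)` separately. Saturation then gives one bijection
  -- respecting all levels.
  have hfin : ∀ n, ∃ R, IsInternal R ∧ IsBij R (C 0) (Set.Iio (b 0)) ∧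
      ∀ k ≤ n, ∀ x y, N.pair x y ∈ R → (x ∈ C k ↔ y ∈ Set.Iio (b k)) := by
    intro n
    induction n with
    | zero =>
      obtain ⟨R, hR, h⟩ := (hb 0).exists_isBij (hasCard_Iio (b 0))
      refine ⟨R, hR, h, fun k hk x y hxy => ?_⟩
      obtain rfl : k = 0 := by omega
      exact iff_of_true (h.left_mem _ _ hxy) (h.right_mem _ _ hxy)
    | succ n ih =>
      obtain ⟨R, hR, h, hk⟩ := ih
      have hsub := hC n.le_succ
      have hsubI := Set.Iio_subset_Iio (hbm n.le_succ)
      obtain ⟨P, hP, hPb⟩ := (hb (n + 1)).exists_isBij (hasCard_Iio (b (n + 1)))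
      obtain ⟨Q, hQ, hQb⟩ := ((hb (n + 1)).diff (hb n) hsub).exists_isBij
        ((hasCard_Iio _).diff (hasCard_Iio _) hsubI)
      have h1 := hPb.union hQb disjoint_sdiff_self_right disjoint_sdiff_self_right
      rw [Set.union_sdiff_cancel hsub, Set.union_sdiff_cancel hsubI] at h1
      have h2 := h1.union (h.sdiff (hk n le_rfl)) disjoint_sdiff_self_right
        disjoint_sdiff_self_right
      rw [Set.union_sdiff_cancel (hC (Nat.zero_le n)),
        Set.union_sdiff_cancel (Set.Iio_subset_Iio (hbm (Nat.zero_le n)))] at h2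
      refine ⟨_, (hP.union hQ).union (hR.inter (hb n).isInternal.compl.preimage_fst), h2, ?_⟩
      intro k hkn x y hxy
      rcases Nat.le_succ_iff.1 hkn with hkn | rfl
      · rcases hxy with hxy | hxy
        · exact iff_of_true (hC hkn (h1.left_mem _ _ hxy))
            (Set.Iio_subset_Iio (hbm hkn) (h1.right_mem _ _ hxy))
        · exact hk k hkn x y hxy.1
      · rcases hxy with (hxy | hxy) | hxy
        · exact iff_of_true (hPb.left_mem _ _ hxy) (hPb.right_mem _ _ hxy)
        · exact iff_of_false (hQb.left_mem _ _ hxy).2 (hQb.right_mem _ _ hxy).2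
        · have h3 : x ∉ C n := by simpa using hxy.2
          have h4 := (hk n le_rfl x y hxy.1).not.1 h3
          exact iff_of_false (fun hx => h3 (hsub hx)) (fun hy => h4 (hsubI hy))
  have hQ : ∀ n, IsInternal {p : N.Obj (prod nat nat) | fst p ∈ C n ↔ snd p ∈ Set.Iio (b n)} := by
    intro n
    have h1 := (hb n).isInternal.preimage_fst (τ := nat)
    have h2 := (isInternal_Iio (b n)).preimage_snd (σ := nat)
    convert (h1.inter h2).union (h1.compl.inter h2.compl) using 1
    ext p
    simp only [Set.mem_union, Set.mem_inter_iff, Set.mem_compl_iff, Set.mem_ofPred_eq]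
    tauto
  obtain ⟨A, hA⟩ := exists_mem_forall_of_isInternal
    (S := fun n => {A : N.Obj (pow (prod nat nat)) | IsBij (N.elems A) (C 0) (Set.Iio (b 0))} ∩
      {A | N.elems A ⊆ {p : N.Obj (prod nat nat) | fst p ∈ C n ↔ snd p ∈ Set.Iio (b n)}})
    (fun n => (isInternal_isBij (hb 0).isInternal (isInternal_Iio _)).inter
      (isInternal_elems_subset (hQ n))) (fun n => by
        obtain ⟨R, ⟨A, rfl⟩, h, hk⟩ := hfin n
        refine ⟨A, fun k hkn => ⟨h, fun p hp => ?_⟩⟩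
        obtain ⟨x, y, rfl⟩ := N.exists_pair p
        simpa using hk k hkn x y hp)
  refine ⟨N.elems A, isInternal_elems A, (hA 0).1, fun n x y hxy => ?_⟩
  simpa using (hA n).2 hxy

theorem piecewiseLE_of_subset_iInter {X U : Set N.HNat} (hX : N.IsBorel X) {C : ℕ → Set N.HNat}
    {b : ℕ → N.HNat} (hC : Antitone C) (hb : ∀ n, HasCard (C n) (b n)) (hXC : X ⊆ ⋂ n, C n)
    (hU : ∀ y, (∀ n, y < b n) → y ∈ U) : PiecewiseLE X U := by
  obtain ⟨R, hR, h, hn⟩ := exists_isBij_of_antitone hC hb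
  refine h.piecewiseLE (hR.piecewiseInternal h.biUnique) hX
    (fun x hx => Set.mem_iInter.1 (hXC hx) 0) (fun x hx y hxy => hU y fun n => ?_)
  exact (hn n x y hxy).1 (Set.mem_iInter.1 (hXC hx) n)

theorem piecewiseLE_of_iInter_subset {X U : Set N.HNat} (hU : N.IsBorel U) {C : ℕ → Set N.HNat}
    {b : ℕ → N.HNat} (hC : Antitone C) (hb : ∀ n, HasCard (C n) (b n)) (hXC : ⋂ n, C n ⊆ X)
    (hUb : ∀ y ∈ U, ∀ n, y < b n) : PiecewiseLE U X := by
  obtain ⟨R, hR, h, hn⟩ := exists_isBij_of_antitone hC hb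
  refine h.relInv.piecewiseLE (hR.piecewiseInternal h.biUnique).relInv hU
    (fun x hx => hUb x hx 0) (fun y hy x hxy => hXC (Set.mem_iInter.2 fun n => ?_))
  exact (hn n x y (pair_mem_relInv.1 hxy)).2 (hUb y hy n)

/-! ### Finite sets -/

theorem _root_.Set.Finite.isInternal {S : Set (N.Obj σ)} (hS : S.Finite) : IsInternal S := by
  induction S, hS using Set.Finite.induction_on with
  | empty => exact isInternal_empty
  | insert _ _ ih => exact (isInternal_singleton _).union ih

theorem hasCard_singleton (x : N.Obj σ) : HasCard {x} 1 := by
  obtain ⟨ρ, t, f, _, rfl, -⟩ := N.exists_starFun₂ x x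
  have : {N.starFun f t} = N.elems (N.setFun (fun i => {f i}) t) := by
    ext y
    obtain ⟨ρ', t', π, g, rfl, rfl⟩ := N.exists_starFun₂ t y
    rw [Set.mem_singleton_iff, starFun_starFun, starFun_eq_iff, setFun_starFun]
    exact (N.mem_setFun g (fun i => {f (π i)}) t').symm
  rw [this, one_eq_natFun t, hasCard_setFun]
  exact .of_forall fun i => by simp

theorem _root_.Set.Finite.hasCard {S : Set (N.Obj σ)} (hS : S.Finite) : HasCard S S.ncard := by
  induction S, hS using Set.Finite.induction_on with
  | empty =>
    have h := hasCard_singleton (N.star (FinType.default σ))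
    have h2 := h.diff h subset_rfl
    rwa [Set.sdiff_self, tsub_self, ← Nat.cast_zero, ← Set.ncard_empty (N.Obj σ)] at h2
  | @insert a S ha hS ih =>
    rw [Set.ncard_insert_of_notMem ha hS, Set.insert_eq, Set.union_comm]
    push_cast
    exact ih.union (hasCard_singleton a) (Set.disjoint_singleton_right.2 ha)

theorem exists_eq_natCast_of_lt {x : N.HNat} {n : ℕ} (h : x < n) : ∃ k < n, x = (k : N.HNat) := by
  induction n with
  | zero => exact absurd h (by simp)
  | succ n ih =>
    push_cast at h
    rcases (lt_add_one_iff'.1 h).lt_or_eq with h | h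
    · obtain ⟨k, hk, rfl⟩ := ih h
      exact ⟨k, by omega, rfl⟩
    · exact ⟨n, by omega, h⟩

theorem Iio_natCast (n : ℕ) : Set.Iio (n : N.HNat) = Nat.cast '' Set.Iio n := by
  ext x
  constructor
  · intro h
    obtain ⟨k, hk, rfl⟩ := exists_eq_natCast_of_lt h
    exact ⟨k, hk, rfl⟩
  · rintro ⟨k, hk, rfl⟩
    exact (Nat.cast_lt (α := N.HNat)).2 hk

theorem ncard_Iio_natCast (n : ℕ) : (Set.Iio (n : N.HNat)).ncard = n := by
  rw [Iio_natCast, Set.ncard_image_of_injective _ Nat.cast_injective]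
  simp

theorem finite_Iio_natCast (n : ℕ) : (Set.Iio (n : N.HNat)).Finite := by
  rw [Iio_natCast]; exact (Set.finite_Iio n).image _

theorem piecewiseLE_of_ncard_eq {X Y : Set N.HNat} (hX : X.Finite) (hY : Y.Finite)
    (h : X.ncard = Y.ncard) : PiecewiseLE X Y := by
  have h1 := hX.hasCard
  rw [h] at h1
  obtain ⟨R, hR, hb⟩ := h1.exists_isBij hY.hasCard
  exact hb.piecewiseLE (hR.piecewiseInternal hb.biUnique) hX.isInternal.isBorel subset_rfl
    (fun x _ y hxy => hb.right_mem _ _ hxy)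

end NonstandardUniverse

/-! ### Standard parts of quotients -/

namespace NonstandardUniverse

open FinType TypedStructure Filter Topology

variable {N : NonstandardUniverse.{u}} {σ τ ρ : FinType}

/-- The type of the pair `(c, x)`, as an ultrafilter on pairs of natural numbers. -/
def pairUlt (c x : N.HNat) : Ultrafilter (ℕ × ℕ) := N.ult (N.pair c x)

theorem pairUlt_natFun (f g : σ.Carrier → ℕ) (t : N.Obj σ) :
    pairUlt (N.natFun f t) (N.natFun g t) = (N.ult t).map (fun i => (f i, g i)) :=
  (congrArg N.ult (N.pair_starFun (τ := nat) (ρ := nat) f g t)).trans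
    (N.ult_starFun (τ := prod nat nat) (fun i => (f i, g i)) t)

/-- `r` is the standard part of `x / c`. -/
def IsSt (c x : N.HNat) (r : ℝ) : Prop :=
  Tendsto (fun p : ℕ × ℕ => (p.2 : ℝ) / p.1) (pairUlt c x) (𝓝 r)

theorem isSt_natFun {f g : σ.Carrier → ℕ} {t : N.Obj σ} {r : ℝ} :
    IsSt (N.natFun f t) (N.natFun g t) r ↔ Tendsto (fun i => (g i : ℝ) / f i) (N.ult t) (𝓝 r) := by
  rw [IsSt, pairUlt_natFun, Ultrafilter.coe_map, tendsto_map'_iff]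
  rfl

theorem natFun_ne_zero {f : σ.Carrier → ℕ} {t : N.Obj σ} :
    N.natFun f t ≠ 0 ↔ ∀ᶠ i in N.ult t, f i ≠ 0 := by
  rw [zero_eq_natFun t, Ne, natFun_eq_iff, Ultrafilter.eventually_not]

theorem exists_isSt {c x : N.HNat} {n : ℕ} (h : x ≤ n * c) : ∃ r, IsSt c x r := by
  obtain ⟨ρ, t, f, g, rfl, rfl⟩ := N.exists_natFun₂ c x
  simp only [natCast_eq_natFun n t, natFun_mul, natFun_le] at h
  simp only [isSt_natFun]
  have hc : IsCompact (Set.Icc (0 : ℝ) n) := isCompact_Icc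
  obtain ⟨r, -, hr⟩ := hc.ultrafilter_le_nhds ((N.ult t).map fun i => (g i : ℝ) / f i) (by
    rw [le_principal_iff]
    change ∀ᶠ i in N.ult t, (g i : ℝ) / f i ∈ Set.Icc (0 : ℝ) n
    filter_upwards [h] with i hi
    refine ⟨by positivity, ?_⟩
    -- Division by zero gives `0`, which still lies in the interval, so no assumption on `c` is
    -- needed.
    rcases Nat.eq_zero_or_pos (f i) with h0 | h0
    · simp [h0]
    · rw [div_le_iff₀ (by positivity)]
      exact_mod_cast hi)
  exact ⟨r, hr⟩

theorem IsSt.nonneg {c x : N.HNat} {r : ℝ} (h : IsSt c x r) : 0 ≤ r :=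
  ge_of_tendsto' h fun p => by positivity

theorem IsSt.unique {c x : N.HNat} {r s : ℝ} (h : IsSt c x r) (h' : IsSt c x s) : r = s :=
  tendsto_nhds_unique h h'

theorem IsSt.add {c x y : N.HNat} {r s : ℝ} (h : IsSt c x r) (h' : IsSt c y s) :
    IsSt c (x + y) (r + s) := by
  obtain ⟨ρ, t, f, g, k, rfl, rfl, rfl⟩ := N.exists_natFun₃ c x y
  rw [natFun_add]
  simp only [isSt_natFun] at *
  refine (h.add h').congr fun i => ?_
  push_cast
  ring

theorem IsSt.natCast_mul {c x : N.HNat} {r : ℝ} (h : IsSt c x r) (n : ℕ) :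
    IsSt c (n * x) (n * r) := by
  obtain ⟨ρ, t, f, g, rfl, rfl⟩ := N.exists_natFun₂ c x
  rw [natCast_eq_natFun n t, natFun_mul]
  simp only [isSt_natFun] at *
  refine (h.const_mul _).congr fun i => ?_
  push_cast
  ring

theorem IsSt.mono {c x y : N.HNat} {r s : ℝ} (h : IsSt c x r) (h' : IsSt c y s) (hxy : x ≤ y) :
    r ≤ s := by
  obtain ⟨ρ, t, f, g, k, rfl, rfl, rfl⟩ := N.exists_natFun₃ c x y
  simp only [isSt_natFun, natFun_le] at *
  refine le_of_tendsto_of_tendsto h h' ?_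
  filter_upwards [hxy] with i hi
  gcongr

theorem IsSt.lt {c x y : N.HNat} {r s : ℝ} (h : IsSt c x r) (h' : IsSt c y s) (hrs : r < s) :
    x < y :=
  lt_of_not_ge fun hc => hrs.not_ge (h'.mono h hc)

theorem isSt_self {c : N.HNat} (hc : c ≠ 0) : IsSt c c 1 := by
  obtain ⟨ρ, t, f, rfl⟩ := N.exists_natFun₁ c
  rw [natFun_ne_zero] at hc
  rw [isSt_natFun]
  refine tendsto_const_nhds.congr' ?_
  filter_upwards [hc] with i hi
  field_simp

theorem IsSt.trans {c x y : N.HNat} {r s : ℝ} (hx : x ≠ 0) (h : IsSt c x r) (h' : IsSt x y s) :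
    IsSt c y (s * r) := by
  obtain ⟨ρ, t, f, g, k, rfl, rfl, rfl⟩ := N.exists_natFun₃ c x y
  rw [natFun_ne_zero] at hx
  simp only [isSt_natFun] at *
  refine (h'.mul h).congr' ?_
  filter_upwards [hx] with i hi
  field_simp

theorem IsSt.inv {c x : N.HNat} {r : ℝ} (hr : r ≠ 0) (h : IsSt c x r) : IsSt x c r⁻¹ := by
  obtain ⟨ρ, t, f, g, rfl, rfl⟩ := N.exists_natFun₂ c x
  simp only [isSt_natFun] at *
  refine (h.inv₀ hr).congr fun i => ?_
  rw [inv_div]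

theorem floorMul_natFun (f : σ.Carrier → ℕ) (t : N.Obj σ) (r : ℝ) :
    N.floorMul (N.natFun f t) r = N.natFun (fun i => ⌊(f i : ℝ) * r⌋₊) t :=
  N.starFun_starFun (τ := nat) (ρ := nat) _ f t

theorem IsNonstandard.natCast_lt {c : N.HNat} (hc : N.IsNonstandard c) (n : ℕ) : (n : N.HNat) < c := by
  by_contra h
  obtain ⟨k, -, hk⟩ := exists_eq_natCast_of_lt (n := n + 1)
    (lt_of_le_of_lt (not_lt.1 h) (Nat.cast_lt.2 n.lt_succ_self))
  exact hc k hk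

theorem IsNonstandard.ne_zero {c : N.HNat} (hc : N.IsNonstandard c) : c ≠ 0 := by
  simpa using (hc.natCast_lt 0).ne'

theorem IsNonstandard.tendsto {f : σ.Carrier → ℕ} {t : N.Obj σ}
    (hc : N.IsNonstandard (N.natFun f t)) : Tendsto f (N.ult t) atTop := by
  rw [tendsto_atTop]
  intro n
  have := hc.natCast_lt n
  rw [natCast_eq_natFun n t, natFun_lt] at this
  exact this.mono fun i hi => hi.le

theorem isSt_floorMul {c : N.HNat} (hc : N.IsNonstandard c) {r : ℝ} (hr : 0 ≤ r) :
    IsSt c (N.floorMul c r) r := by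
  obtain ⟨ρ, t, f, rfl⟩ := N.exists_natFun₁ c
  rw [floorMul_natFun, isSt_natFun]
  have h1 := (tendsto_nat_floor_mul_div_atTop hr).comp
    (tendsto_natCast_atTop_atTop.comp hc.tendsto)
  refine h1.congr fun i => ?_
  simp [mul_comm]

theorem floorMul_of_nonpos (c : N.HNat) {r : ℝ} (hr : r ≤ 0) : N.floorMul c r = 0 := by
  obtain ⟨ρ, t, f, rfl⟩ := N.exists_natFun₁ c
  rw [floorMul_natFun, zero_eq_natFun t, natFun_eq_iff]
  refine .of_forall fun i => Nat.floor_of_nonpos ?_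
  exact mul_nonpos_of_nonneg_of_nonpos (by positivity) hr

/-- Elements `x` with finite `x / c` of standard part less than `r`. -/
def stLT (c : N.HNat) (r : ℝ) : Set N.HNat := {x | ∃ s < r, IsSt c x s}

/-- Elements `x` with finite `x / c` of standard part at most `r`. -/
def stLE (c : N.HNat) (r : ℝ) : Set N.HNat := {x | ∃ s ≤ r, IsSt c x s}

theorem IsSt.exists_of_le {c x y : N.HNat} {r : ℝ} (hc : c ≠ 0) (h : IsSt c y r) (hxy : x ≤ y) :
    ∃ s ≤ r, IsSt c x s := by
  obtain ⟨n, hn⟩ := exists_nat_gt r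
  have h1 := (isSt_self hc).natCast_mul n
  rw [mul_one] at h1
  obtain ⟨s, hs⟩ := exists_isSt (hxy.trans (h.lt h1 hn).le)
  exact ⟨s, hs.mono h hxy, hs⟩

theorem stLT_eq_iUnion {c : N.HNat} (hc : N.IsNonstandard c) (r : ℝ) :
    stLT c r = ⋃ n : ℕ, Set.Iio (N.floorMul c (r - 1 / (n + 1))) := by
  ext x
  simp only [stLT, Set.mem_ofPred_eq, Set.mem_iUnion, Set.mem_Iio]
  constructor
  · rintro ⟨s, hs, hx⟩
    obtain ⟨n, hn⟩ := exists_nat_one_div_lt (sub_pos.2 hs)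
    have hs' : s < r - 1 / (n + 1) := by linarith
    exact ⟨n, hx.lt (isSt_floorMul hc (hx.nonneg.trans hs'.le)) hs'⟩
  · rintro ⟨n, hn⟩
    rcases le_total (r - 1 / (n + 1)) 0 with h | h
    · rw [floorMul_of_nonpos c h] at hn
      exact absurd hn not_lt_zero
    · obtain ⟨s, hs, hs'⟩ := (isSt_floorMul hc h).exists_of_le hc.ne_zero hn.le
      exact ⟨s, hs.trans_lt (sub_lt_self _ (by positivity)), hs'⟩

theorem stLE_eq_iInter {c : N.HNat} (hc : N.IsNonstandard c) {r : ℝ} (hr : 0 ≤ r) :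
    stLE c r = ⋂ n : ℕ, Set.Iio (N.floorMul c (r + 1 / (n + 1))) := by
  ext x
  simp only [stLE, Set.mem_ofPred_eq, Set.mem_iInter, Set.mem_Iio]
  have hst : ∀ n : ℕ, IsSt c (N.floorMul c (r + 1 / (n + 1))) (r + 1 / (n + 1)) :=
    fun n => isSt_floorMul hc (by positivity)
  constructor
  · rintro ⟨s, hs, hx⟩ n
    exact hx.lt (hst n) (hs.trans_lt (lt_add_of_pos_right _ (by positivity)))
  · intro h
    obtain ⟨s, -, hs⟩ := (hst 0).exists_of_le hc.ne_zero (h 0).le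
    refine ⟨s, le_of_forall_pos_lt_add fun ε hε => ?_, hs⟩
    obtain ⟨n, hn⟩ := exists_nat_one_div_lt hε
    have := hs.mono (hst n) (h n).le
    linarith

theorem isBorel_stLT {c : N.HNat} (hc : N.IsNonstandard c) (r : ℝ) : N.IsBorel (stLT c r) := by
  rw [stLT_eq_iUnion hc]
  exact IsBorel.iUnion fun n => (isInternal_Iio _).isBorel

theorem isBorel_stLE {c : N.HNat} (hc : N.IsNonstandard c) {r : ℝ} (hr : 0 ≤ r) :
    N.IsBorel (stLE c r) := by
  rw [stLE_eq_iInter hc hr]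
  exact IsBorel.iInter fun n => (isInternal_Iio _).isBorel

theorem isBorel_setOf_isSt {c : N.HNat} (hc : N.IsNonstandard c) {r : ℝ} (hr : 0 ≤ r) :
    N.IsBorel {x | IsSt c x r} := by
  convert (isBorel_stLE hc hr).diff (isBorel_stLT hc r) using 1
  ext x
  constructor
  · intro h
    exact ⟨⟨r, le_rfl, h⟩, fun ⟨s, hs, h'⟩ => hs.ne (h'.unique h)⟩
  · rintro ⟨⟨s, hs, h⟩, h'⟩
    obtain rfl : s = r := hs.antisymm (not_lt.1 fun hlt => h' ⟨s, hlt, h⟩)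
    exact h

/-- If `x / c` has standard part `r`, every `y` between `x` and `⌊c r⌋` has the same one, so `x / y`
is near `1`. If the standard part is less than `r`, the choice `y = ⌊c r⌋` witnesses membership. -/
theorem realCut_eq {c : N.HNat} (hc : N.IsNonstandard c) {r : ℝ} (hr : 0 < r) :
    N.realCut c r = stLT c r := by
  have hF := isSt_floorMul hc hr.le
  ext x
  constructor
  · rintro ⟨hx, y, hy, hxy, hnear⟩
    change x ≤ _ at hx
    change y ≤ _ at hy
    change x < y at hxy
    simp only [QuotNearOne, not_forall] at hnear
    obtain ⟨n, hn⟩ := hnear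
    have h1 : (n : N.HNat) * x + y < n * y := by
      by_contra hc
      refine hn ⟨?_, not_lt.1 hc⟩
      exact (mul_le_mul_of_nonneg_left hxy.le zero_le).trans le_self_add
    obtain ⟨s, hs, hs'⟩ := hF.exists_of_le hc.ne_zero hx
    obtain ⟨q, hq, hq'⟩ := hF.exists_of_le hc.ne_zero hy
    have h2 := ((hs'.natCast_mul n).add hq').mono (hq'.natCast_mul n) h1.le
    refine ⟨s, hs.lt_of_ne ?_, hs'⟩
    rintro rfl
    have h3 := hs'.mono hq' hxy.le
    obtain rfl : q = s := le_antisymm hq h3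
    linarith
  · rintro ⟨s, hs, hx⟩
    have hlt := hx.lt hF hs
    refine ⟨hlt.le, _, le_rfl (a := N.floorMul c r), hlt, fun hnear => ?_⟩
    have h1 : ∀ n : ℕ, (n : ℝ) * r ≤ n * s + r := fun n =>
      (hF.natCast_mul n).mono ((hx.natCast_mul n).add hF) (hnear n).2
    obtain ⟨n, hn⟩ := exists_nat_gt (r / (r - s))
    rw [div_lt_iff₀ (sub_pos.2 hs)] at hn
    have := h1 n
    linarith

/-- Moving the monads of `r, r / 2, r / 4, …` one step further. -/
theorem stLE_piecewiseLE_stLT {c : N.HNat} (hc : N.IsNonstandard c) {r : ℝ} (hr : 0 < r) :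
    PiecewiseLE (stLE c r) (stLT c r) := by
  -- Hilbert's hotel on monads: the monad of `q j` is translated into that of `q (j + 1)` and all
  -- other points stay fixed. The monad of `r = q 0` is thereby vacated.
  let q : ℕ → ℝ := fun j => r / 2 ^ j
  have hq : ∀ j, 0 < q j := fun j => by positivity
  have hq0 : q 0 = r := by simp [q]
  have hqs : ∀ j, q (j + 1) < r := fun j => by
    simp only [q]
    exact div_lt_self hr (one_lt_pow₀ (by norm_num) (by omega))
  have hqi : Function.Injective q := by
    intro i j hij
    simp only [q] at hij
    have h2 : (2 : ℝ) ^ i = 2 ^ j := by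
      field_simp at hij
      exact hij.symm
    exact Nat.pow_right_injective le_rfl (by exact_mod_cast h2)
  let a : ℕ → N.HNat := fun j => N.floorMul c (q j)
  have ha : ∀ j, IsSt c (a j) (q j) := fun j => isSt_floorMul hc (hq j).le
  let M : ℕ → Set N.HNat := fun j => {x | IsSt c x (q j)}
  have hM : ∀ j, N.IsBorel (M j) := fun j => isBorel_setOf_isSt hc (hq j).le
  have hMd : ∀ {i j x}, x ∈ M i → x ∈ M j → i = j := 
    fun {i j x} h h' => hqi (IsSt.unique (c := c) (x := x) h h')
  let G : Set (N.Obj (prod nat nat)) :=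
    (⋃ j, translation (a (j + 1)) (a j) ∩ {p | fst p ∈ M j}) ∪
      ({p | fst p = snd p} ∩ {p | fst p ∈ (⋃ j, M j)ᶜ})
  have hG : PiecewiseInternal G := by
    refine .union (.iUnion fun j => .restrict ?_ (hM j)) (.restrict ?_ (IsBorel.iUnion hM).compl)
    · exact (isInternal_translation _ _).piecewiseInternal (biUnique_translation _ _)
    · exact isInternal_diagonal.piecewiseInternal biUnique_diagonal
  have hGm : ∀ x y, N.pair x y ∈ G ↔ (∃ j, (y + a j = x + a (j + 1)) ∧ x ∈ M j) ∨
      (x = y ∧ ∀ j, x ∉ M j) := by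
    intro x y
    simp [G, translation]
  have hMs : ∀ {j} {x y : N.HNat}, x ∈ M j → y + a j = x + a (j + 1) → y ∈ M (j + 1) := by
    intro j x y hx hxy
    have h1 := IsSt.add hx (ha (j + 1))
    obtain ⟨s, -, hs⟩ := h1.exists_of_le hc.ne_zero (hxy ▸ (le_self_add : y ≤ y + a j))
    have h2 := hs.add (ha j)
    rw [hxy] at h2
    have h3 := h2.unique h1
    obtain rfl : s = q (j + 1) := by linarith
    exact hs
  refine hG.piecewiseLE (isBorel_stLE hc hr.le) ?_ ?_ ?_ ?_
  · intro x hx y y' h h'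
    rw [hGm] at h h'
    rcases h with ⟨j, h1, h2⟩ | ⟨rfl, h1⟩ <;> rcases h' with ⟨k, h3, h4⟩ | ⟨rfl, h3⟩
    · obtain rfl := hMd h2 h4
      exact add_right_cancel (h1.trans h3.symm)
    · exact absurd h2 (h3 j)
    · exact absurd h4 (h1 k)
    · rfl
  · intro x hx x' hx' y h h'
    rw [hGm] at h h'
    rcases h with ⟨j, h1, h2⟩ | ⟨rfl, h1⟩ <;> rcases h' with ⟨k, h3, h4⟩ | ⟨rfl, h3⟩
    · have : j + 1 = k + 1 := hMd (hMs h2 h1) (hMs h4 h3)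
      obtain rfl : j = k := by omega
      exact add_right_cancel (h1.symm.trans h3)
    · exact absurd (hMs h2 h1) (h3 _)
    · exact absurd (hMs h4 h3) (h1 _)
    · rfl
  · intro x hx
    by_cases h : ∃ j, x ∈ M j
    · obtain ⟨j, hj⟩ := h
      -- The shift is downwards, so the truncated subtraction must be exact: the right side has
      -- standard part `q j + q (j + 1) > q j`.
      have h1 : a j ≤ x + a (j + 1) :=
        ((ha j).lt (IsSt.add hj (ha (j + 1))) (lt_add_of_pos_right _ (hq _))).le
      exact ⟨x + a (j + 1) - a j, (hGm _ _).2 (Or.inl ⟨j, tsub_add_cancel_of_le h1, hj⟩)⟩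
    · push Not at h
      exact ⟨x, (hGm _ _).2 (Or.inr ⟨rfl, h⟩)⟩
  · intro x hx y h
    rw [hGm] at h
    rcases h with ⟨j, h1, h2⟩ | ⟨rfl, h1⟩
    · exact ⟨_, hqs j, hMs h2 h1⟩
    · obtain ⟨s, hs, h⟩ := hx
      refine ⟨s, hs.lt_of_ne ?_, h⟩
      rintro rfl
      exact h1 0 (by rw [← hq0] at h; exact h)

end NonstandardUniverse

/-! ### Minimal cuts -/

namespace NonstandardUniverse

open FinType TypedStructure Filter Topology

variable {N : NonstandardUniverse.{u}} {σ τ ρ : FinType}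

/-- An internal subset of the graph is an internal injection into `[0, d)`, so has at most `d`
elements. `IsBorel.exists_cover` applies to the graph, and projecting its cover covers `S`. -/
theorem BorelLE.exists_cover {S T : Set N.HNat} (h : N.BorelLE S T) {d : N.HNat}
    (hT : T ⊆ Set.Iio d) {n : ℕ} (hn : 0 < n) :
    ∃ C e, S ⊆ C ∧ CardLE C e ∧ n * e ≤ (n + 1) * d := by
  obtain ⟨G, hG, hu, ht, hm⟩ := borelLE_iff.1 h
  obtain ⟨C, e, hC, he, hed⟩ := hG.exists_cover (d := d) (fun Y hY hYi => by
    refine CardLE.of_image_snd hYi ⟨fun _ _ _ h h' => hu.1 _ _ _ (hY h) (hY h'),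
      fun _ _ _ h h' => hu.2 _ _ _ (hY h) (hY h')⟩ ?_
    refine (hasCard_Iio d).cardLE.mono hYi.image_snd ?_ le_rfl
    rintro _ ⟨p, hp, rfl⟩
    refine hT (hm (fst p) (snd p) ?_).2
    rw [pair_fst_snd]
    exact hY hp) hn
  refine ⟨fst '' C, e, fun x hx => ?_, he.image_fst, hed⟩
  obtain ⟨y, hy⟩ := ht x hx
  exact ⟨_, hC hy, fst_pair _ _⟩

/-- A proper subcut `V` omits some `u` in `U`, so lies in `[0, u)`. An injection of `U` into `V`
would give a cover of `[0, w)` by at most `(1 + 1/k) u` elements, which is less than `w`. -/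
theorem isMinimalBorelCut_of_forall_exists {U : Set N.HNat} (hU : N.IsBorelCut U)
    (h : ∀ u ∈ U, ∃ (k : ℕ) (w : N.HNat), 0 < k ∧ Set.Iio w ⊆ U ∧ (k + 1) * u < k * w) :
    N.IsMinimalBorelCut U := by
  refine ⟨hU, fun V hV hVU hE => ?_⟩
  obtain ⟨u, hu, huV⟩ := Set.exists_of_ssubset hVU
  obtain ⟨k, w, hk, hw, hkw⟩ := h u hu
  obtain ⟨C, e, hC, he, hed⟩ := hE.2.exists_cover (d := u)
    (fun v hv => Set.mem_Iio.2 (lt_of_not_ge fun huv => huV (hV v hv u huv))) hk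
  have h1 : w ≤ e := (hasCard_Iio w).le_of_subset he (hw.trans hC)
  exact (hkw.trans_le (mul_le_mul_of_nonneg_left h1 zero_le)).not_ge hed

theorem isMinimalBorelCut_of_isAdditive {U : Set N.HNat} (hU : N.IsBorelCut U)
    (h : N.IsAdditive U) : N.IsMinimalBorelCut U := by
  refine isMinimalBorelCut_of_forall_exists hU fun u hu => ⟨1, u + u + 1, one_pos, fun x hx => ?_, ?_⟩
  · exact hU.1 _ (h u hu u hu) x (lt_add_one_iff'.1 hx)
  · rw [Nat.cast_one, one_mul, add_mul, one_mul, lt_add_one_iff']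

theorem isBorelCut_below (c : N.HNat) : N.IsBorelCut (N.below c) :=
  ⟨fun _ hx _ hy => lt_of_le_of_lt (α := N.HNat) hy hx, (isInternal_Iio c).isBorel⟩

theorem isMinimalBorelCut_below_ofNat (n : ℕ) : N.IsMinimalBorelCut (N.below (N.ofNat n)) := by
  refine isMinimalBorelCut_of_forall_exists (isBorelCut_below _) fun u hu => ?_
  obtain ⟨k, hk, rfl⟩ := exists_eq_natCast_of_lt (n := n) hu
  -- The gap from `k` to `n` is detected at precision `k + 1`, since `(k + 2) k < (k + 1)²`.
  refine ⟨k + 1, n, k.succ_pos, subset_rfl, ?_⟩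
  have : (k + 1 + 1) * k < (k + 1) * n := by nlinarith
  exact_mod_cast this

theorem isCut_stLT {c : N.HNat} (hc : N.IsNonstandard c) (r : ℝ) : N.IsCut (stLT c r) := by
  rintro x ⟨s, hs, hx⟩ y hy
  obtain ⟨q, hq, hq'⟩ := hx.exists_of_le hc.ne_zero hy
  exact ⟨q, hq.trans_lt hs, hq'⟩

theorem isBorelCut_stLT {c : N.HNat} (hc : N.IsNonstandard c) (r : ℝ) : N.IsBorelCut (stLT c r) :=
  ⟨isCut_stLT hc r, isBorel_stLT hc r⟩

theorem isMinimalBorelCut_stLT {c : N.HNat} (hc : N.IsNonstandard c) (r : ℝ) :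
    N.IsMinimalBorelCut (stLT c r) := by
  refine isMinimalBorelCut_of_forall_exists (isBorelCut_stLT hc r) ?_
  rintro u ⟨s, hs, hu⟩
  have hs0 := hu.nonneg
  -- With `w / c` near the midpoint of `s` and `r`, the requirement `(k + 1) s < k (s + r) / 2`
  -- becomes `s < k (r - s) / 2`.
  obtain ⟨k, hk⟩ := exists_nat_gt (s / ((r - s) / 2))
  rw [div_lt_iff₀ (by linarith)] at hk
  have hk0 : 0 < k := by
    rcases Nat.eq_zero_or_pos k with rfl | h
    · simp at hk; linarith
    · exact h
  have hw := isSt_floorMul hc (r := (s + r) / 2) (by linarith)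
  refine ⟨k, N.floorMul c ((s + r) / 2), hk0, fun x hx => ?_, ?_⟩
  · exact isCut_stLT hc r _ ⟨_, by linarith, hw⟩ x (le_of_lt (α := N.HNat) hx)
  · have h1 := hu.natCast_mul (k + 1)
    push_cast at h1
    refine h1.lt (hw.natCast_mul k) ?_
    linarith

end NonstandardUniverse

/-! ### Borel sets and cuts -/

namespace NonstandardUniverse

open FinType TypedStructure Filter Topology

variable {N : NonstandardUniverse.{u}} {σ τ ρ : FinType}

/-- The cut of all `x` such that some internal subset of `X` has more than `x` elements. -/
def innerCut (X : Set N.HNat) : Set N.HNat := {x | ∃ Y ⊆ X, HasCard Y (x + 1)}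

theorem innerCut_mem_of_le {X : Set N.HNat} {x y : N.HNat} (hx : x ∈ innerCut X) (h : y ≤ x) :
    y ∈ innerCut X := by
  obtain ⟨Y, hY, hc⟩ := hx
  obtain ⟨T, hT, hc'⟩ := hc.exists_subset (add_le_add_left h 1)
  exact ⟨T, hT.trans hY, hc'⟩

theorem exists_hasCard_of_mem_innerCut {X : Set N.HNat} {x : N.HNat} (hx : x ∈ innerCut X) :
    ∃ Y ⊆ X, HasCard Y x := by
  obtain ⟨Y, hY, hc⟩ := hx
  obtain ⟨T, hT, hc'⟩ := hc.exists_subset le_self_add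
  exact ⟨T, hT.trans hY, hc'⟩

theorem cardLE_of_notMem_innerCut {X Y : Set N.HNat} {d : N.HNat} (hd : d ∉ innerCut X)
    (hY : Y ⊆ X) (hYi : IsInternal Y) : CardLE Y d := by
  by_contra h
  obtain ⟨T, hT, hc⟩ := exists_hasCard_of_not_cardLE hYi h
  exact hd ⟨T, hT.trans hY, hc⟩

theorem natCast_mem_innerCut {X : Set N.HNat} (hX : X.Infinite) (n : ℕ) :
    (n : N.HNat) ∈ innerCut X := by
  obtain ⟨T, hT, hc⟩ := hX.exists_subset_card_eq (n + 1)
  refine ⟨T, hT, ?_⟩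
  have := T.finite_toSet.hasCard
  rwa [Set.ncard_coe_finset, hc, Nat.cast_add, Nat.cast_one] at this

/-- If `X` has internal covers with at most `b n` elements, it embeds in every set containing the
intersection of the segments `[0, b n)`. -/
theorem piecewiseLE_of_forall_cover {X U : Set N.HNat} (hX : N.IsBorel X) {b : ℕ → N.HNat}
    (h : ∀ n, ∃ C, X ⊆ C ∧ CardLE C (b n)) (hU : ∀ y, (∀ n, y < b n) → y ∈ U) :
    PiecewiseLE X U := by
  choose C hXC hC using h
  have hK : ∀ n, CardLE (⋂ i ≤ n, C i) (b n) := by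
    intro n
    refine (hC n).mono ?_ (fun x hx => Set.mem_iInter₂.1 hx n le_rfl) le_rfl
    have : (⋂ i ≤ n, C i) = (⋃ i < n + 1, (C i)ᶜ)ᶜ := by
      ext x
      simp
    rw [this]
    exact (isInternal_iUnion_lt (fun i => (hC i).isInternal.compl) _).compl
  choose k hk hkc using fun n => (hK n).exists_hasCard
  refine piecewiseLE_of_subset_iInter hX (C := fun n => ⋂ i ≤ n, C i) ?_ hkc ?_ ?_
  · intro m n hmn
    exact Set.biInter_subset_biInter_left fun i hi => le_trans hi hmn
  · exact Set.subset_iInter fun n => Set.subset_iInter₂ fun i _ => hXC i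
  · exact fun y hy => hU y fun n => (hy n).trans_le (hk n)

theorem exists_forall_lt (u : ℕ → N.HNat) : ∃ x, ∀ n, u n < x := by
  obtain ⟨x, hx⟩ := exists_mem_forall_of_isInternal (S := fun n => (Set.Iic (u n))ᶜ)
    (fun n => (isInternal_Iic _).compl) (fun n => by
      refine ⟨∑ i ∈ Finset.range (n + 1), u i + 1, fun k hk => ?_⟩
      rw [Set.mem_compl_iff, Set.mem_Iic, not_le, lt_add_one_iff']
      exact Finset.single_le_sum (f := u) (fun _ _ => zero_le) (by simpa [Nat.lt_succ_iff] using hk))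
  exact ⟨x, fun n => by simpa using hx n⟩

/-- The sets representing all Borel cardinalities. -/
def IsListed (W : Set N.HNat) : Prop :=
  (N.IsBorelCut W ∧ N.IsAdditive W) ∨ (∃ n : ℕ, W = N.below (N.ofNat n)) ∨
    ∃ c : N.HNat, N.IsNonstandard c ∧ ∃ r : ℝ, 0 < r ∧ W = N.realCut c r

theorem isCut_innerCut (X : Set N.HNat) : N.IsCut (innerCut X) :=
  fun _ hx _ h => innerCut_mem_of_le hx h

/-! ### Reduction of an arbitrary Borel set to a listed cut -/

theorem exists_listed_of_finite {X : Set N.HNat} (hX : X.Finite) :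
    ∃ W, IsListed W ∧ PiecewiseLE X W ∧ PiecewiseLE W X :=
  ⟨Set.Iio (X.ncard : N.HNat), Or.inr (Or.inl ⟨_, rfl⟩),
    piecewiseLE_of_ncard_eq hX (finite_Iio_natCast _) (ncard_Iio_natCast _).symm,
    piecewiseLE_of_ncard_eq (finite_Iio_natCast _) hX (ncard_Iio_natCast _)⟩

theorem sum_mem_innerCut {X : Set N.HNat} (hX : X.Infinite) (hadd : N.IsAdditive (innerCut X))
    {e : ℕ → N.HNat} (he : ∀ n, e n ∈ innerCut X) (n : ℕ) :
    ∑ i ∈ Finset.range n, e i ∈ innerCut X := by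
  induction n with
  | zero => simpa using natCast_mem_innerCut hX 0
  | succ n ih =>
    rw [Finset.sum_range_succ]
    exact hadd _ ih _ (he n)

theorem add_one_mem_innerCut {X : Set N.HNat} (hX : X.Infinite) (hadd : N.IsAdditive (innerCut X))
    {x : N.HNat} (hx : x ∈ innerCut X) : x + 1 ∈ innerCut X :=
  hadd _ hx _ (by simpa using natCast_mem_innerCut hX 1)

/-- With a countable cofinal sequence, covering `X` by internal sets of size in the cut embeds it
piece by piece, as sums stay in the cut. Without such a cover, saturation gives an internal subset
of `X` whose size exceeds every `u n`, contradicting the definition of the cut. -/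
theorem exists_listed_of_cofinal {X : Set N.HNat} (hX : N.IsBorel X) (hinf : X.Infinite)
    (hadd : N.IsAdditive (innerCut X)) {u : ℕ → N.HNat} (hu : ∀ n, u n ∈ innerCut X)
    (hcof : ∀ x ∈ innerCut X, ∃ n, x ≤ u n) :
    ∃ W, IsListed W ∧ PiecewiseLE X W ∧ PiecewiseLE W X := by
  have hW : N.IsBorel (innerCut X) := by
    have : innerCut X = ⋃ n, Set.Iic (u n) := by
      ext x
      rw [Set.mem_iUnion]
      exact ⟨fun hx => hcof x hx, fun ⟨n, hn⟩ => innerCut_mem_of_le (hu n) hn⟩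
    rw [this]
    exact .iUnion fun n => (isInternal_Iic _).isBorel
  refine ⟨innerCut X, Or.inl ⟨⟨isCut_innerCut X, hW⟩, hadd⟩, ?_, ?_⟩
  · rcases hX.cover_or_exists_iInter_subset (fun E => ∃ e ∈ innerCut X, CardLE E e) with
      ⟨E, -, hE, hXE⟩ | rfl | ⟨D, hD, hanti, hnot, hDX⟩
    · choose e he hEe using hE
      exact piecewiseLE_of_subset_iUnion hX hEe hXE fun n x hx =>
        innerCut_mem_of_le (sum_mem_innerCut hinf hadd he n) hx.le
    · exact absurd Set.finite_empty hinf
    · exfalso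
      push Not at hnot
      obtain ⟨A, hA⟩ := exists_mem_forall_of_isInternal
        (S := fun n => {A : N.Obj (pow nat) | CardLE (N.elems A) (u n)}ᶜ ∩ {A | N.elems A ⊆ D n})
        (fun n => (isInternal_cardLE _).compl.inter (isInternal_elems_subset (hD n))) (fun n => by
          obtain ⟨A, hA⟩ := hD n
          refine ⟨A, fun k hk => ⟨?_, ?_⟩⟩
          · rw [Set.mem_compl_iff, Set.mem_ofPred_eq, hA]
            exact hnot n _ (hu k)
          · rw [Set.mem_ofPred_eq, hA]
            exact hanti hk)
      have hAX : N.elems A ⊆ X := fun x hx => hDX (Set.mem_iInter.2 fun n => (hA n).2 hx)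
      have hAn : ∀ e ∈ innerCut X, ¬ CardLE (N.elems A) e := by
        intro e he h
        obtain ⟨n, hn⟩ := hcof e he
        exact (hA n).1 (h.mono_right hn)
      obtain ⟨d, hd⟩ := exists_forall_lt u
      have hdn : d ∉ innerCut X := fun h => by
        obtain ⟨n, hn⟩ := hcof d h
        exact (hd n).not_ge hn
      obtain ⟨y, -, hy⟩ := (cardLE_of_notMem_innerCut hdn hAX ⟨A, rfl⟩).exists_hasCard
      refine hAn y ?_ hy.cardLE
      -- The inner cut asks for `x + 1` elements, so a subset of size `y` shows only that `y - 1` is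
      -- in it; additivity recovers `y`.
      have h1 : y - 1 + 1 = y := by
        refine tsub_add_cancel_of_le ?_
        rw [Order.one_le_iff_pos, pos_iff_ne_zero]
        rintro rfl
        exact hAn 0 (by simpa using natCast_mem_innerCut hinf 0) hy.cardLE
      rw [← h1]
      refine add_one_mem_innerCut hinf hadd ⟨_, hAX, ?_⟩
      rwa [h1]
  · refine piecewiseLE_of_iUnion_Iio hW (w := fun n => ∑ i ∈ Finset.range n, (u i + 1)) ?_ (by simp)
      ?_ ?_
    · refine monotone_nat_of_le_succ fun n => ?_
      rw [Finset.sum_range_succ]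
      exact le_self_add
    · intro x hx
      obtain ⟨n, hn⟩ := hcof x hx
      refine Set.mem_iUnion.2 ⟨n + 1, ?_⟩
      rw [Set.mem_Iio, Finset.sum_range_succ]
      exact (lt_add_one_iff'.2 hn).trans_le le_add_self
    · exact fun n => exists_hasCard_of_mem_innerCut
        (sum_mem_innerCut hinf hadd (fun i => add_one_mem_innerCut hinf hadd (hu i)) n)

/-- Without countable cofinality a countable cover by sets of size in the cut merges into one such
set, which is too small for `X`. So `X` contains an intersection of large sets. Either their sizes
are eventually hyperfinite and coinitial above the cut, or saturation yields an internally infinite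
subset, equivalent to `*ℕ`. -/
theorem exists_listed_of_not_cofinal {X : Set N.HNat} (hX : N.IsBorel X) (hinf : X.Infinite)
    (hadd : N.IsAdditive (innerCut X))
    (hcof : ∀ u : ℕ → N.HNat, (∀ n, u n ∈ innerCut X) → ∃ x ∈ innerCut X, ∀ n, u n < x) :
    ∃ W, IsListed W ∧ PiecewiseLE X W ∧ PiecewiseLE W X := by
  rcases hX.cover_or_exists_iInter_subset (fun E => ∃ e ∈ innerCut X, CardLE E e) with
    ⟨E, hEi, hE, hXE⟩ | rfl | ⟨D, hD, hanti, hnot, hDX⟩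
  · exfalso
    choose e he hEe using hE
    obtain ⟨x, ⟨Y, hYX, hY⟩, hx⟩ := hcof _ (sum_mem_innerCut hinf hadd he)
    obtain ⟨C, -, -, hEC, hC⟩ := exists_cover_of_forall hEi isInternal_empty isInternal_univ
      (fun n => Set.subset_univ _) (d := x) (fun n => by
        rw [Set.sdiff_empty]
        exact (cardLE_iUnion_lt hEe n).mono_right (hx n).le)
    rw [Set.sdiff_empty] at hC
    have h1 := hY.le_of_subset hC (hYX.trans (hXE.trans (Set.iUnion_subset hEC)))
    exact (lt_add_one_iff'.2 le_rfl).not_ge h1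
  · exact absurd Set.finite_empty hinf
  · push Not at hnot
    by_cases hfin : ∃ n d, CardLE (D n) d
    · obtain ⟨m, d, hd⟩ := hfin
      have hanti' : Antitone fun n => D (m + n) := fun i j hij => hanti (by omega)
      have hDX' : ⋂ n, D (m + n) ⊆ X := fun x hx => hDX (Set.mem_iInter.2 fun n =>
        hanti (Nat.le_add_left n m) (Set.mem_iInter.1 hx n))
      choose b hbd hb using fun n =>
        (hd.mono (hD (m + n)) (hanti (Nat.le_add_right m n)) le_rfl).exists_hasCard
      have hbn : ∀ n, b n ∉ innerCut X := fun n h => hnot _ _ h (hb n).cardLE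
      have hmem : ∀ y, y ∈ innerCut X ↔ ∀ n, y < b n := by
        intro y
        constructor
        · intro hy n
          exact lt_of_not_ge fun h => hbn n (innerCut_mem_of_le hy h)
        · intro hy
          obtain ⟨T, hT, hc⟩ := exists_hasCard_subset_iInter (fun n => hD (m + n)) hanti'
            (d := y + 1) (fun n => (hb n).exists_subset (Order.add_one_le_of_lt (hy n)))
          exact ⟨T, hT.trans hDX', hc⟩
      have hW : N.IsBorel (innerCut X) := by
        have : innerCut X = ⋂ n, Set.Iio (b n) := by
          ext x
          rw [hmem, Set.mem_iInter]
          rfl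
        rw [this]
        exact .iInter fun n => (isInternal_Iio _).isBorel
      refine ⟨innerCut X, Or.inl ⟨⟨isCut_innerCut X, hW⟩, hadd⟩, ?_,
        piecewiseLE_of_iInter_subset hW hanti' hb hDX' fun y hy => (hmem y).1 hy⟩
      refine piecewiseLE_of_forall_cover hX (b := b) (fun n => ?_) fun y hy => (hmem y).2 hy
      -- By additivity half of `b n` is still outside the cut, so the loss of a factor `2` in
      -- `IsBorel.exists_cover` with precision `1` leaves a cover of size at most `b n`.
      obtain ⟨q, hq⟩ := exists_div (b n) two_pos
      have hqn : q ∉ innerCut X := by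
        intro h
        have h1 := add_one_mem_innerCut hinf hadd h
        refine hbn n (innerCut_mem_of_le (hadd _ h1 _ h1) ?_)
        have h2 : ¬ ((2 : ℕ) : N.HNat) * (q + 1) ≤ b n := by
          rw [hq]
          exact (lt_add_one_iff'.2 le_rfl).not_ge
        rw [Nat.cast_two, two_mul] at h2
        exact (not_le.1 h2).le
      obtain ⟨C, e, hXC, hC, hCe⟩ := hX.exists_cover
        (fun Y => cardLE_of_notMem_innerCut hqn) one_pos
      refine ⟨C, hXC, hC.mono_right ?_⟩
      have h2 := (hq q).2 le_rfl
      rw [Nat.cast_one, one_mul, one_add_one_eq_two] at hCe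
      exact hCe.trans (by simpa using h2)
    · push Not at hfin
      obtain ⟨A, hA⟩ := exists_mem_forall_of_isInternal
        (S := fun n => {A : N.Obj (pow nat) | ∀ d, ¬ CardLE (N.elems A) d} ∩ {A | N.elems A ⊆ D n})
        (fun n => isInternal_not_finite.inter (isInternal_elems_subset (hD n))) (fun n => by
          obtain ⟨A, hA⟩ := hD n
          refine ⟨A, fun k hk => ⟨?_, ?_⟩⟩
          · rw [Set.mem_ofPred_eq, hA]
            exact hfin n
          · rw [Set.mem_ofPred_eq, hA]
            exact hanti hk)
      have hAX : N.elems A ⊆ X := fun x hx => hDX (Set.mem_iInter.2 fun n => (hA n).2 hx)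
      obtain ⟨R, hR, hb⟩ := exists_isBij_univ ⟨A, rfl⟩ (hA 0).1
      have huniv : N.IsBorel (Set.univ : Set N.HNat) := isInternal_univ.isBorel
      refine ⟨Set.univ, Or.inl ⟨⟨fun _ _ _ _ => trivial, huniv⟩, fun _ _ _ _ => trivial⟩,
        hX.piecewiseLE_of_subset (Set.subset_univ _), ?_⟩
      exact hb.relInv.piecewiseLE (hR.piecewiseInternal hb.biUnique).relInv huniv subset_rfl
        fun x _ y h => hAX (hb.relInv.right_mem _ _ h)

theorem floorMul_mono (c : N.HNat) {r s : ℝ} (h : r ≤ s) : N.floorMul c r ≤ N.floorMul c s := by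
  obtain ⟨ρ, t, f, rfl⟩ := N.exists_natFun₁ c
  rw [floorMul_natFun, floorMul_natFun, natFun_le]
  exact .of_forall fun i => Nat.floor_mono (by gcongr)

theorem IsCut.exists_add_notMem {U : Set N.HNat} (hU : N.IsCut U) (h : ¬ N.IsAdditive U) :
    ∃ c ∈ U, c + c ∉ U := by
  simp only [IsAdditive, not_forall] at h
  obtain ⟨x, hx, y, hy, hxy⟩ := h
  refine ⟨max x y, by rcases max_choice x y with h | h <;> rwa [h], fun h => hxy ?_⟩
  exact hU _ h _ (add_le_add (le_max_left x y) (le_max_right x y))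

/-- The cut lies between standard parts below and at most `r`. Internal subsets of `X` realise all
multiples of `c` below `r`, internal covers come down to any multiple above `r`, and moving monads
closes the remaining gap. -/
theorem exists_listed_of_not_isAdditive {X : Set N.HNat} (hX : N.IsBorel X) (hinf : X.Infinite)
    (hadd : ¬ N.IsAdditive (innerCut X)) :
    ∃ W, IsListed W ∧ PiecewiseLE X W ∧ PiecewiseLE W X := by
  obtain ⟨c, hcX, hc2⟩ := (isCut_innerCut X).exists_add_notMem hadd
  have hc : N.IsNonstandard c := by
    rintro n rfl
    refine hc2 ?_
    have := natCast_mem_innerCut hinf (n + n)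
    rwa [Nat.cast_add] at this
  let A : Set ℝ := {s | ∃ x ∈ innerCut X, IsSt c x s}
  have hbdd : BddAbove A := by
    refine ⟨1 + 1, ?_⟩
    rintro s ⟨x, hx, hs⟩
    exact hs.mono ((isSt_self hc.ne_zero).add (isSt_self hc.ne_zero))
      (le_of_lt (lt_of_not_ge fun h => hc2 (innerCut_mem_of_le hx h)))
  have h1A : 1 ∈ A := ⟨c, hcX, isSt_self hc.ne_zero⟩
  let r := sSup A
  have hr1 : 1 ≤ r := le_csSup hbdd h1A
  have hr : 0 < r := one_pos.trans_le hr1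
  refine ⟨N.realCut c r, Or.inr (Or.inr ⟨c, hc, r, hr, rfl⟩), ?_, ?_⟩ <;> rw [realCut_eq hc hr]
  · refine PiecewiseLE.trans ?_ (stLE_piecewiseLE_stLT hc hr)
    refine piecewiseLE_of_forall_cover hX (b := fun n => N.floorMul c (r + 1 / (n + 1)))
      (fun n => ?_) (fun y hy => by rw [stLE_eq_iInter hc hr.le]; exact Set.mem_iInter.2 hy)
    obtain ⟨ε, hε, hn⟩ : ∃ ε : ℝ, 0 < ε ∧ (1 : ℝ) / (n + 1) = ε + ε :=
      ⟨1 / (n + 1) / 2, by positivity, by ring⟩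
    have hd := isSt_floorMul hc (r := r + ε) (by positivity)
    have hb := isSt_floorMul hc (r := r + (ε + ε)) (by positivity)
    have hdn : N.floorMul c (r + ε) ∉ innerCut X := by
      intro h
      have : r + ε ≤ r := le_csSup hbdd ⟨_, h, hd⟩
      linarith
    -- Chosen so that `(1 + 1/k)(r + ε) < r + 2ε`: half of `1 / (n + 1)` separates the bound from
    -- the cut, the other half absorbs the covering loss.
    obtain ⟨k, hk⟩ := exists_nat_gt ((r + ε) / ε)
    have hk0 : 0 < k := by
      have : (0 : ℝ) < k := lt_trans (by positivity) hk
      exact_mod_cast this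
    rw [div_lt_iff₀ hε] at hk
    obtain ⟨C, e, hXC, hC, hCe⟩ := hX.exists_cover
      (fun Y => cardLE_of_notMem_innerCut hdn) hk0
    refine ⟨C, hXC, hC.mono_right ?_⟩
    simp only [hn]
    by_contra h
    have h1 := (mul_le_mul_of_nonneg_left (not_le.1 h).le (zero_le (a := (k : N.HNat)))).trans hCe
    have h2 := hd.natCast_mul (k + 1)
    push_cast at h2
    have := (hb.natCast_mul k).mono h2 h1
    linarith
  · have hmem : ∀ n : ℕ, N.floorMul c (r - 1 / (n + 1)) ∈ innerCut X := by
      intro n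
      have h0 : (0 : ℝ) < 1 / (n + 1) := by positivity
      have h1 : (1 : ℝ) / (n + 1) ≤ 1 := by
        rw [div_le_one (by positivity)]
        linarith [(Nat.cast_nonneg n : (0 : ℝ) ≤ n)]
      obtain ⟨s, ⟨x, hx, hs⟩, hlt⟩ := exists_lt_of_lt_csSup ⟨1, h1A⟩ (sub_lt_self r h0)
      exact innerCut_mem_of_le hx ((isSt_floorMul hc (by linarith)).lt hs hlt).le
    refine piecewiseLE_of_iUnion_Iio (isBorel_stLT hc r)
      -- A zero is prepended because the sequence of segments must start with the empty one.
      (w := fun n => Nat.casesOn n 0 fun n => N.floorMul c (r - 1 / (n + 1))) ?_ rfl ?_ ?_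
    · refine monotone_nat_of_le_succ fun n => ?_
      rcases n with _ | n
      · exact zero_le
      · refine floorMul_mono c ?_
        gcongr
        linarith
    · rw [stLT_eq_iUnion hc]
      exact Set.iUnion_subset fun n => Set.subset_iUnion_of_subset (n + 1) subset_rfl
    · rintro (_ | n)
      · exact exists_hasCard_of_mem_innerCut (by simpa using natCast_mem_innerCut hinf 0)
      · exact exists_hasCard_of_mem_innerCut (hmem n)

/-- Every Borel set has the cardinality of a listed cut. -/
theorem IsBorel.exists_listed {X : Set N.HNat} (hX : N.IsBorel X) :
    ∃ W, IsListed W ∧ PiecewiseLE X W ∧ PiecewiseLE W X := by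
  rcases X.finite_or_infinite with hf | hinf
  · exact exists_listed_of_finite hf
  by_cases hadd : N.IsAdditive (innerCut X)
  · by_cases hcof : ∃ u : ℕ → N.HNat, (∀ n, u n ∈ innerCut X) ∧ ∀ x ∈ innerCut X, ∃ n, x ≤ u n
    · obtain ⟨u, hu, hcof⟩ := hcof
      exact exists_listed_of_cofinal hX hinf hadd hu hcof
    · push Not at hcof
      exact exists_listed_of_not_cofinal hX hinf hadd hcof
  · exact exists_listed_of_not_isAdditive hX hinf hadd

end NonstandardUniverse

/-! ### Classification of Borel cardinalities -/

namespace NonstandardUniverse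

open FinType TypedStructure Filter Topology

variable {N : NonstandardUniverse.{u}} {σ τ ρ : FinType}

theorem IsListed.isMinimalBorelCut {W : Set N.HNat} (h : IsListed W) : N.IsMinimalBorelCut W := by
  rcases h with ⟨hW, hadd⟩ | ⟨n, rfl⟩ | ⟨c, hc, r, hr, rfl⟩
  · exact isMinimalBorelCut_of_isAdditive hW hadd
  · exact isMinimalBorelCut_below_ofNat n
  · rw [realCut_eq hc hr]
    exact isMinimalBorelCut_stLT hc r

theorem IsCut.subset_or_subset {U V : Set N.HNat} (hU : N.IsCut U) (hV : N.IsCut V) :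
    U ⊆ V ∨ V ⊆ U := by
  by_contra! h
  obtain ⟨x, hx, hxV⟩ := Set.not_subset.1 h.1
  obtain ⟨y, hy, hyU⟩ := Set.not_subset.1 h.2
  rcases le_total x y with hxy | hxy
  · exact hxV (hV y hy x hxy)
  · exact hyU (hU x hx y hxy)

theorem IsBorel.borelLE_of_subset {X Y : Set N.HNat} (hX : N.IsBorel X) (h : X ⊆ Y) :
    N.BorelLE X Y := (hX.piecewiseLE_of_subset h).borelLE

/-- Cuts are nested; if `V` were properly inside `U`, inclusion and the given injection would make
them equivalent, against minimality. -/
theorem IsMinimalBorelCut.subset_of_borelLE {U V : Set N.HNat} (hU : N.IsMinimalBorelCut U)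
    (hV : N.IsBorelCut V) (h : N.BorelLE U V) : U ⊆ V := by
  by_contra hUV
  have hVU := (hU.1.1.subset_or_subset hV.1).resolve_left hUV
  exact hU.2 V hV.1 ⟨hVU, hUV⟩ ⟨hV.2.borelLE_of_subset hVU, h⟩

theorem IsMinimalBorelCut.borelLT {U V : Set N.HNat} (hU : N.IsMinimalBorelCut U)
    (hV : N.IsBorelCut V) (h : V ⊂ U) : N.BorelLT V U :=
  ⟨hV.2.borelLE_of_subset h.1, fun h' => h.2 (hU.subset_of_borelLE hV h')⟩

theorem BorelLT.exists_notMem {U V : Set N.HNat} (h : N.BorelLT V U) (hU : N.IsBorel U) :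
    ∃ u ∈ U, u ∉ V :=
  Set.not_subset.1 fun h' => h.2 (hU.borelLE_of_subset h')

/-! ### The cuts `c/ℕ` and `cℕ` and what lies between them -/

theorem isBorelCut_divNat (c : N.HNat) : N.IsBorelCut (N.divNat c) := by
  refine ⟨fun x hx y hy n => ?_, ?_⟩
  · exact le_trans (mul_le_mul_of_nonneg_left (α := N.HNat) hy zero_le) (hx n)
  · have : N.divNat c = ⋂ n : ℕ, {x : N.HNat | n * x ≤ c} := by
      ext x
      rw [Set.mem_iInter]
      rfl
    rw [this]
    refine .iInter fun n => ?_
    rcases Nat.eq_zero_or_pos n with rfl | hn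
    · simpa using isInternal_univ.isBorel
    · obtain ⟨q, hq⟩ := exists_div c hn
      simp only [hq]
      exact (isInternal_Iic q).isBorel

theorem isBorelCut_mulNat (c : N.HNat) : N.IsBorelCut (N.mulNat c) := by
  refine ⟨fun x ⟨n, hn⟩ y hy => ⟨n, le_trans (α := N.HNat) hy hn⟩, ?_⟩
  have : N.mulNat c = ⋃ n : ℕ, Set.Iic ((n : N.HNat) * c) := by
    ext x
    rw [Set.mem_iUnion]
    rfl
  rw [this]
  exact .iUnion fun n => (isInternal_Iic _).isBorel

theorem isAdditive_mulNat (c : N.HNat) : N.IsAdditive (N.mulNat c) := by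
  rintro x ⟨n, hn⟩ y ⟨m, hm⟩
  refine ⟨n + m, ?_⟩
  have : x + y ≤ ((n + m : ℕ) : N.HNat) * c := by
    rw [Nat.cast_add, add_mul]
    exact add_le_add hn hm
  exact this

theorem isMinimalBorelCut_mulNat (c : N.HNat) : N.IsMinimalBorelCut (N.mulNat c) :=
  isMinimalBorelCut_of_isAdditive (isBorelCut_mulNat c) (isAdditive_mulNat c)

theorem le_of_mem_divNat {c x : N.HNat} (h : x ∈ N.divNat c) : x ≤ c := by
  have : ((1 : ℕ) : N.HNat) * x ≤ c := h 1
  simpa using this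

/-- Both inclusions are proper, with `c` and `2c` as witnesses. The first is strict in cardinality
by minimality of `U`, the second by minimality of the additive cut `cℕ`. -/
theorem IsMinimalBorelCut.borelLT_and_borelLT {U : Set N.HNat} (hU : N.IsMinimalBorelCut U)
    {c : N.HNat} (hc : c ∈ U) (hc2 : c + c ∉ U) :
    N.BorelLT (N.divNat c) U ∧ N.BorelLT U (N.mulNat c) := by
  have hc0 : 0 < c := by
    rw [pos_iff_ne_zero]
    rintro rfl
    rw [add_zero] at hc2
    exact hc2 hc
  have h2 : ((2 : ℕ) : N.HNat) * c = c + c := by rw [Nat.cast_two, two_mul]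
  constructor
  · refine hU.borelLT (isBorelCut_divNat c) ⟨fun x hx => hU.1.1 c hc x (le_of_mem_divNat hx), ?_⟩
    intro h
    have h1 : ((2 : ℕ) : N.HNat) * c ≤ c := h hc 2
    rw [h2] at h1
    exact (lt_add_of_pos_right c hc0).not_ge h1
  · refine (isMinimalBorelCut_mulNat c).borelLT hU.1 ⟨fun x hx => ⟨2, ?_⟩, fun h => hc2 (h ⟨2, ?_⟩)⟩
    · have : x ≤ ((2 : ℕ) : N.HNat) * c := by
        rw [h2]
        exact le_of_not_ge fun h => hc2 (hU.1.1 x hx _ h)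
      exact this
    · exact h2.ge

theorem divNat_ssubset_stLT {c : N.HNat} (hc : N.IsNonstandard c) {r : ℝ} (hr : 0 < r) :
    N.divNat c ⊂ stLT c r := by
  have hself := isSt_self hc.ne_zero
  have key : ∀ {x : N.HNat} {s : ℝ}, x ∈ N.divNat c → IsSt c x s → s ≤ 0 := by
    intro x s hx hs
    by_contra! h
    obtain ⟨n, hn⟩ := exists_nat_gt (1 / s)
    rw [div_lt_iff₀ h] at hn
    exact hn.not_ge ((hs.natCast_mul n).mono hself (hx n))
  refine ⟨fun x hx => ?_, fun h => ?_⟩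
  · obtain ⟨s, -, hs⟩ := hself.exists_of_le hc.ne_zero (le_of_mem_divNat hx)
    exact ⟨s, (key hx hs).trans_lt hr, hs⟩
  · have h1 := isSt_floorMul hc (r := r / 2) (by positivity)
    have := key (h ⟨_, half_lt_self hr, h1⟩) h1
    linarith

theorem stLT_ssubset_mulNat {c : N.HNat} (hc : N.IsNonstandard c) (r : ℝ) :
    stLT c r ⊂ N.mulNat c := by
  obtain ⟨n, hn⟩ := exists_nat_gt r
  have h1 := (isSt_self hc.ne_zero).natCast_mul n
  rw [mul_one] at h1
  refine ⟨?_, fun h => ?_⟩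
  · rintro x ⟨s, hs, hx⟩
    exact ⟨n, (hx.lt h1 (hs.trans hn)).le⟩
  · obtain ⟨s, hs, hx⟩ := h ⟨n, le_refl ((n : N.HNat) * c)⟩
    have := hx.unique h1
    linarith

/-- The point `⌊c r⌋` has standard part exactly `r`, so it separates the two cuts when `r < s`. -/
theorem le_of_stLT_subset_stLT {c : N.HNat} (hc : N.IsNonstandard c) {r s : ℝ} (hr : 0 ≤ r)
    (h : stLT c s ⊆ stLT c r) : s ≤ r := by
  by_contra! hrs
  have h1 := isSt_floorMul hc hr
  obtain ⟨q, hq, h2⟩ := h ⟨r, hrs, h1⟩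
  exact hq.ne (h2.unique h1)

theorem stLT_eq_stLT_of_isSt {c d : N.HNat} {p : ℝ} (hc : c ≠ 0) (hd : d ≠ 0) (hp : 0 < p)
    (h : IsSt d c p) (r : ℝ) : stLT d r = stLT c (r * p⁻¹) := by
  ext x
  constructor
  · rintro ⟨s, hs, hx⟩
    exact ⟨s * p⁻¹, by gcongr, (h.inv hp.ne').trans hd hx⟩
  · rintro ⟨s, hs, hx⟩
    refine ⟨s * p, ?_, h.trans hc hx⟩
    rwa [← div_eq_mul_inv, lt_div_iff₀ hp] at hs

theorem IsAdditive.mulNat_subset {U : Set N.HNat} (hadd : N.IsAdditive U) (hU : N.IsCut U)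
    {u : N.HNat} (hu : u ∈ U) : N.mulNat u ⊆ U := by
  rintro x ⟨n, hn⟩
  refine hU _ ?_ x hn
  change (n : N.HNat) * u ∈ U
  clear hn
  induction n with
  | zero => simpa using hU u hu 0 (zero_le (a := u))
  | succ n ih =>
    rw [Nat.cast_succ, add_mul, one_mul]
    exact hadd _ ih _ hu

/-- The listed cuts strictly between `c/ℕ` and `cℕ`. -/
theorem IsListed.exists_eq_stLT {U : Set N.HNat} (hU : IsListed U) {c : N.HNat}
    (hc : N.IsNonstandard c) (h1 : N.BorelLT (N.divNat c) U) (h2 : N.BorelLT U (N.mulNat c)) :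
    ∃ r : ℝ, 0 < r ∧ U = stLT c r := by
  have hUb := hU.isMinimalBorelCut.1
  obtain ⟨u, hu, huc⟩ := h1.exists_notMem hUb.2
  obtain ⟨v, ⟨k, hk⟩, hvU⟩ := h2.exists_notMem (isBorelCut_mulNat c).2
  replace hk : v ≤ (k : N.HNat) * c := hk
  simp only [divNat, Set.mem_ofPred_eq, not_forall] at huc
  obtain ⟨n, hn⟩ := huc
  replace hn : c < (n : N.HNat) * u := not_le.1 hn
  rcases hU with ⟨-, hadd⟩ | ⟨m, rfl⟩ | ⟨d, hd, r, hr, rfl⟩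
  -- Now `c < n u` with `u` in `U`, and some `v ≤ k c` is outside `U`. An additive `U` would contain
  -- `c` and hence `v`; a finite `U` has only standard elements. In the last case `c / d` has a
  -- positive standard part, since otherwise `v` would be in `U`, and the cut is rescaled from `d`
  -- to `c`.
  · have hcU := hadd.mulNat_subset hUb.1 hu ⟨n, hn.le⟩
    exact absurd (hadd.mulNat_subset hUb.1 hcU ⟨k, hk⟩) hvU
  · obtain ⟨j, -, rfl⟩ := exists_eq_natCast_of_lt (n := m) hu
    have := hc.natCast_lt (n * j)
    rw [Nat.cast_mul] at this
    exact absurd hn this.not_gt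
  · rw [realCut_eq hd hr] at hu hvU ⊢
    obtain ⟨s, hs, hus⟩ := hu
    obtain ⟨p, hp, hcp⟩ := (hus.natCast_mul n).exists_of_le hd.ne_zero hn.le
    have hp0 : 0 < p := by
      refine hcp.nonneg.lt_of_ne ?_
      rintro rfl
      obtain ⟨q, hq, hvq⟩ := (hcp.natCast_mul k).exists_of_le hd.ne_zero hk
      exact hvU ⟨q, by simpa using hq.trans_lt (by simpa using hr), hvq⟩
    exact ⟨r * p⁻¹, by positivity, stLT_eq_stLT_of_isSt hc.ne_zero hd.ne_zero hp0 hcp r⟩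

/-- Equivalent minimal Borel cuts contain each other, so `U` equals the listed cut equivalent to it.
-/
theorem IsMinimalBorelCut.isListed {U : Set N.HNat} (hU : N.IsMinimalBorelCut U) : IsListed U := by
  obtain ⟨W, hW, h, h'⟩ := hU.1.2.exists_listed
  have hm := hW.isMinimalBorelCut
  rwa [(hU.subset_of_borelLE hm.1 h.borelLE).antisymm (hm.subset_of_borelLE hU.1 h'.borelLE)]

end NonstandardUniverse

open NonstandardUniverse

theorem mainTheorem4 (N : NonstandardUniverse.{u}) :
    -- every Borel set admits a Borel bijection onto a Borel cut, and among the Borel cuts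
    -- Borel equivalent to it there is a least one, the unique minimal Borel cut in its class
    (∀ X : Set N.HNat, N.IsBorel X →
      ∃ U : Set N.HNat, N.IsMinimalBorelCut U ∧ N.BorelEquiv X U ∧ N.BorelBijective X U ∧
        (∀ V, N.IsBorelCut V → N.BorelEquiv X V → U ⊆ V) ∧
        (∀ V, N.IsMinimalBorelCut V → N.BorelEquiv X V → V = U)) ∧
    -- any two Borel sets are comparable
    (∀ X Y : Set N.HNat, N.IsBorel X → N.IsBorel Y → N.BorelLE X Y ∨ N.BorelLE Y X) ∧
    -- the list of all minimal Borel cuts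
    (∀ U : Set N.HNat, N.IsMinimalBorelCut U ↔
      (N.IsBorelCut U ∧ N.IsAdditive U) ∨
      (∃ n : ℕ, U = N.below (N.ofNat n)) ∨
      (∃ c : N.HNat, N.IsNonstandard c ∧ ∃ r : ℝ, 0 < r ∧ U = N.realCut c r)) ∧
    -- a minimal Borel cut that is not additive lies between `c/ℕ` and `cℕ` for some `c`
    (∀ U : Set N.HNat, N.IsMinimalBorelCut U → ¬ N.IsAdditive U →
      ∃ c ∈ U, N.add c c ∉ U ∧ N.BorelLT (N.divNat c) U ∧ N.BorelLT U (N.mulNat c)) ∧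
    -- the minimal Borel cuts between `c/ℕ` and `cℕ`
    (∀ c : N.HNat, N.IsNonstandard c →
      (∀ U : Set N.HNat,
        (N.IsMinimalBorelCut U ∧ N.BorelLT (N.divNat c) U ∧ N.BorelLT U (N.mulNat c)) ↔
          ∃ r : ℝ, 0 < r ∧ U = N.realCut c r) ∧
      (∀ r s : ℝ, 0 < r → 0 < s → N.realCut c r = N.realCut c s → r = s)) := by
  refine ⟨fun X hX => ?_, fun X Y hX hY => ?_, fun U => ⟨fun h => h.isListed, IsListed.isMinimalBorelCut⟩,
    fun U hU hadd => ?_, fun c hc => ⟨fun U => ⟨?_, ?_⟩, fun r s hr hs h => ?_⟩⟩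
  · obtain ⟨W, hW, h, h'⟩ := hX.exists_listed
    have hm := hW.isMinimalBorelCut
    have hle : ∀ V, N.IsBorelCut V → N.BorelEquiv X V → W ⊆ V := fun V hV hXV =>
      hm.subset_of_borelLE hV (h'.trans_borelLE hXV.1)
    refine ⟨W, hm, ⟨h.borelLE, h'.borelLE⟩, h.borelBijective hX hm.1.2 h', hle, fun V hV hXV => ?_⟩
    exact (hV.subset_of_borelLE hm.1 (hXV.2.trans_piecewiseLE h)).antisymm (hle V hV.1 hXV)
  · obtain ⟨W, hW, h, h'⟩ := hX.exists_listed
    obtain ⟨Z, hZ, k, k'⟩ := hY.exists_listed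
    have hWb := hW.isMinimalBorelCut.1
    have hZb := hZ.isMinimalBorelCut.1
    rcases hWb.1.subset_or_subset hZb.1 with hs | hs
    · exact Or.inl (h.trans ((hWb.2.piecewiseLE_of_subset hs).trans k')).borelLE
    · exact Or.inr (k.trans ((hZb.2.piecewiseLE_of_subset hs).trans h')).borelLE
  · obtain ⟨c, hc, hc2⟩ := hU.1.1.exists_add_notMem hadd
    exact ⟨c, hc, hc2, hU.borelLT_and_borelLT hc hc2⟩
  · rintro ⟨hU, h1, h2⟩
    obtain ⟨r, hr, rfl⟩ := hU.isListed.exists_eq_stLT hc h1 h2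
    exact ⟨r, hr, (realCut_eq hc hr).symm⟩
  · rintro ⟨r, hr, rfl⟩
    rw [realCut_eq hc hr]
    have hm := isMinimalBorelCut_stLT hc r
    exact ⟨hm, hm.borelLT (isBorelCut_divNat c) (divNat_ssubset_stLT hc hr),
      (isMinimalBorelCut_mulNat c).borelLT hm.1 (stLT_ssubset_mulNat hc r)⟩
  · rw [realCut_eq hc hr, realCut_eq hc hs] at h
    exact (le_of_stLT_subset_stLT hc hs.le h.subset).antisymm (le_of_stLT_subset_stLT hc hr.le h.superset)
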